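/- \textbf{Theorem 2 (Posterior contraction).} \emph{Model.} For $n\ge 1$ let $Z_1,\dots,Z_n$ be independent responses with values in $\{0,\dots,m-1\}$, $m\ge 2$, such that $\log\{\mathbb P(Z_i=\ell)/\mathbb P(Z_i=0)\}=X_{i(\ell)}^T\beta$ for $\ell=1,\dots,m-1$, where $\beta\in\mathbb R^d$ and $X_{i(\ell)}^T$ is the $\ell$th row of a given matrix $X_i\in\mathbb R^{(m-1)\times d}$. Let $X=(X_1^T,\dots,X_n^T)^T\neq 0$. Let $G_1,\dots,G_p$ be a partition of $\{1,\dots,d\}$ into non-empty groups, $g_j=|G_j|$, $\overline g=\max_j g_j$; let $\beta_j$ be the subvector of $\beta$ and $X_{\cdot j}$ the column submatrix of $X$ with indices in $G_j$. The quantities $m,p,d,G_1,\dots,G_p,X$ may depend on $n$. Put $\lVert\beta\rVert_{2,1}=\sum_{j=1}^p\lVert\beta_j\rVert_2$, $\lVert\beta_S\rVert_{2,1}=\sum_{j\in S}\lVert\beta_j\rVert_2$, $S_\beta=\{j:\beta_j\ne0\}$, $s_\beta=|S_\beta|$, $d_S=\sum_{j\in S}g_j$, and, for a matrix $A$ with $d$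 columns, $\lVert A\rVert_\ast=\max_j\lVert A_{\cdot j}\rVert_{\rm sp}$ (spectral norm). Write $L_n=\log p\vee\overline g\log n$. \emph{Prior.} Fix constants $A_1,A_2,A_3,A_4>0$. Under the prior, a group index set $S$ with $|S|=s$ has probability $\pi_p(s)\binom ps^{-1}$, where $\pi_p$ is a probability mass function on $\{0,\dots,p\}$ with $$\frac{A_1}{(p\vee n^{\overline g})^{A_3}}\le\frac{\pi_p(s)}{\pi_p(s-1)}\le\frac{A_2}{(p\vee n^{\overline g})^{A_4}},\qquad s=1,\dots,p;$$ given $S$, $\beta_{S^c}=0$ and $\beta_S$ has the density $$h_S(\beta_S)=\Big(\frac{\lambda}{\sqrt\pi}\Big)^{d_S}\frac{\prod_{j\in S}\Gamma(g_j/2)}{2^{s}\prod_{j\in S}\Gamma(g_j)}\,e^{-\lambda\lVert\beta_S\rVert_{2,1}},\qquad \lambda=8\lVert X\rVert_\ast\sqrt{L_n},$$ on $\mathbb R^{d_S}$. Let $\Pi(\cdot\mid Y)$ be the posterior distribution of $\beta$ given the data $Y=(\mathbf 1(Z_i=\ell))_{1\le i\le n,\,1\le\ell\le m-1}$. \emph{Compatibility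 numbers.} For a true parameter $\beta_0\in\mathbb R^d$ let $\mathbb E_0$ be the expectation under $\beta_0$, $W$ the covariance matrix of $Y$ under $\beta_0$, $S_0=S_{\beta_0}$, $s_0=|S_0|$, and $$\phi(S)=\inf\Big\{\tfrac{\lVert W^{1/2}X\beta\rVert_2\sqrt{|S|}}{\lVert X\rVert_\ast\lVert\beta\rVert_{2,1}}:\lVert\beta_{S^c}\rVert_{2,1}\le7\lVert\beta_S\rVert_{2,1},\ \beta_S\ne0\Big\},$$ $$\psi_1(t)=\inf\Big\{\tfrac{\lVert W^{1/2}X\beta\rVert_2\sqrt{s_\beta}}{\lVert X\rVert_\ast\lVert\beta\rVert_{2,1}}:1\le s_\beta\le t\Big\},\qquad \psi_2(t)=\inf\Big\{\tfrac{\lVert W^{1/2}X\beta\rVert_2}{\lVert X\rVert_\ast\lVert\beta\rVert_2}:1\le s_\beta\le t\Big\}.$$ Put $\xi_0=s_0+A_4^{-1}\{4+100/\phi^2(S_0)\}s_0$, write $\psi_k=\psi_k(\xi_0+s_0)$ and $\phi=\phi(S_0)$, and let $$\mathcal B_2(M)=\Big\{\beta_0\in\mathbb R^d: s_0\sqrt{L_n}\,\max_{1\le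 i\le n}\lVert X_i\rVert_\ast\le M\psi_1^2\phi^2\lVert X\rVert_\ast\Big\}.$$ (If $\beta_0=0$, then $\xi_0=0$, $\beta_0\in\mathcal B_2(M)$, and the three radii below are $0$.) \emph{Claim.} There are constants $M_3,M_4>0$, depending only on $A_1,\dots,A_4$, such that for every sequence (indexed by $n$) of models and priors as above, as $n\to\infty$, $$\sup_{\beta_0\in\mathcal B_2(M_3)}\mathbb E_0\Pi\Big\{\beta:\lVert W^{1/2}X(\beta-\beta_0)\rVert_2>\frac{M_4\sqrt{s_0L_n}}{\psi_1\phi}\,\Big|\,Y\Big\}\to0,$$ $$\sup_{\beta_0\in\mathcal B_2(M_3)}\mathbb E_0\Pi\Big\{\beta:\lVert\beta-\beta_0\rVert_2>\frac{M_4\sqrt{s_0L_n}}{\psi_1\psi_2\phi\lVert X\rVert_\ast}\,\Big|\,Y\Big\}\to0,$$ $$\sup_{\beta_0\in\mathcal B_2(M_3)}\mathbb E_0\Pi\Big\{\beta:\lVert\beta-\beta_0\rVert_{2,1}>\frac{M_4s_0\sqrt{L_n}}{\psi_1^2\phi^2\lVert X\rVert_\ast}\,\Big|\,Y\Big\}\to0.$$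 -/

import Mathlib

/-!
Group sparse logit models for categorical responses.

Conventions.  There are `n` observations and `q + 1` categories, numbered `0, …, q`, where `0` is
the reference category (so `q = m - 1`).  The rows of the design matrix are indexed by pairs
`(i, ℓ) : Fin n × Fin q`, the row `(i, ℓ)` being the covariate vector of observation `i` and of the
category `ℓ.succ`.  The partition of the `d` coordinates into `p` groups is given by the map
`grp : Fin d → Fin p` that sends a coordinate to its group; all groups are non-empty exactly
when `grp` is surjective.
-/

open Filter Topology MeasureTheory
open scoped ENNReal

noncomputable section

namespace GroupLogit

/-! ### Norms -/

/-- The Euclidean norm of a vector. -/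
def l2 {ι : Type*} [Fintype ι] (v : ι → ℝ) : ℝ := ‖WithLp.toLp 2 v‖

/-- The spectral norm of a rectangular matrix. -/
def spNorm {ρ κ : Type*} [Fintype ρ] [Fintype κ] [DecidableEq κ] (A : Matrix ρ κ ℝ) : ℝ :=
  ‖(Matrix.toEuclideanLin A).toContinuousLinearMap‖

section Groups

variable {d p : ℕ} (grp : Fin d → Fin p)

/-- The index set `G_j` of the `j`-th group. -/
abbrev Group (j : Fin p) : Type := {k : Fin d // grp k = j}

/-- `g_j`, the size of the `j`-th group. -/
def gsize (j : Fin p) : ℕ := Fintype.card (Group grp j)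

/-- The largest group size. -/
def gbar : ℕ := Finset.univ.sup (gsize grp)

/-- The subvector `β_j`. -/
def sub (β : Fin d → ℝ) (j : Fin p) : Group grp j → ℝ := fun k => β k.1

/-- `‖β_S‖_{2,1}`, the sum of `‖β_j‖₂` over `j ∈ S`. -/
def l21On (S : Finset (Fin p)) (β : Fin d → ℝ) : ℝ := ∑ j ∈ S, l2 (sub grp β j)

/-- `‖β‖_{2,1}`. -/
def l21 (β : Fin d → ℝ) : ℝ := l21On grp Finset.univ β

open Classical in
/-- `S_β`, the set of the groups on which `β` is not zero. -/
def supp (β : Fin d → ℝ) : Finset (Fin p) := Finset.univ.filter fun j => sub grp β j ≠ 0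

/-- `s_β`. -/
def suppCard (β : Fin d → ℝ) : ℕ := (supp grp β).card

/-- `d_S`, the number of coordinates in the groups of `S`. -/
def dimOn (S : Finset (Fin p)) : ℕ := ∑ j ∈ S, gsize grp j

/-- `‖A‖_*`, the largest spectral norm of the column blocks `A_{·j}`. -/
def starNorm {ρ : Type*} [Fintype ρ] (A : Matrix ρ (Fin d) ℝ) : ℝ :=
  ⨆ j : Fin p, spNorm (A.submatrix id (Subtype.val : Group grp j → Fin d))

end Groups

/-! ### The logit model -/

section Model

variable {n q d : ℕ} (X : Matrix (Fin n × Fin q) (Fin d) ℝ)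

/-- The block `X_i` of the `i`-th observation. -/
def block (i : Fin n) : Matrix (Fin q) (Fin d) ℝ := X.submatrix (fun ℓ => (i, ℓ)) id

/-- The linear predictors of observation `i`: `0` for the reference category and
`(X β)_{(i, ℓ)}` for the others. -/
def linPred (β : Fin d → ℝ) (i : Fin n) : Fin (q + 1) → ℝ :=
  Fin.cons 0 fun ℓ => (X.mulVec β) (i, ℓ)

/-- The probability that observation `i` falls into category `c`. -/
def catProb (β : Fin d → ℝ) (i : Fin n) (c : Fin (q + 1)) : ℝ :=
  Real.exp (linPred X β i c) / ∑ c' : Fin (q + 1), Real.exp (linPred X β i c')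

/-- `f_β^n`, the probability mass function of the independent responses
`z = (Z_1, …, Z_n)`. -/
def density (β : Fin d → ℝ) (z : Fin n → Fin (q + 1)) : ℝ := ∏ i, catProb X β i (z i)

lemma catProb_pos (β : Fin d → ℝ) (i : Fin n) (c : Fin (q + 1)) : 0 < catProb X β i c :=
  div_pos (Real.exp_pos _)
    (Finset.sum_pos (fun _ _ => Real.exp_pos _) ⟨0, Finset.mem_univ _⟩)

lemma sum_catProb (β : Fin d → ℝ) (i : Fin n) : ∑ c, catProb X β i c = 1 := by
  unfold catProb
  rw [← Finset.sum_div]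
  exact div_self
    (Finset.sum_pos (fun _ _ => Real.exp_pos _) ⟨0, Finset.mem_univ _⟩).ne'

/-- The defining relation of the logit model. -/
lemma log_odds (β : Fin d → ℝ) (i : Fin n) (ℓ : Fin q) :
    Real.log (catProb X β i ℓ.succ / catProb X β i 0) = (X.mulVec β) (i, ℓ) := by
  have h : (∑ c' : Fin (q + 1), Real.exp (linPred X β i c')) ≠ 0 :=
    (Finset.sum_pos (fun _ _ => Real.exp_pos _) ⟨0, Finset.mem_univ _⟩).ne'
  unfold catProb
  rw [div_div_div_cancel_right₀ h, ← Real.exp_sub, Real.log_exp]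
  simp [linPred]

lemma sum_density (β : Fin d → ℝ) : ∑ z, density X β z = 1 := by
  unfold density
  rw [← Fintype.piFinset_univ, ← Finset.prod_univ_sum]
  simp [sum_catProb]

lemma density_pos (β : Fin d → ℝ) (z : Fin n → Fin (q + 1)) : 0 < density X β z :=
  Finset.prod_pos fun i _ => catProb_pos X β i (z i)

/-- The response vector `Y`, with entries `Y_{iℓ} = 1(Z_i = ℓ)` for the non-reference
categories. -/
def resp (z : Fin n → Fin (q + 1)) (r : Fin n × Fin q) : ℝ :=
  if z r.1 = r.2.succ then 1 else 0

/-- `μ = E_β Y`. -/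
def meanVec (β : Fin d → ℝ) (r : Fin n × Fin q) : ℝ := ∑ z, density X β z * resp z r

/-- The covariance matrix `W` of `Y` under the parameter `β`. -/
def covMat (β : Fin d → ℝ) : Matrix (Fin n × Fin q) (Fin n × Fin q) ℝ :=
  Matrix.of fun r r' =>
    ∑ z, density X β z * ((resp z r - meanVec X β r) * (resp z r' - meanVec X β r'))

/-- `W` is positive semidefinite, so that its square root below is the genuine one. -/
lemma covMat_posSemidef (β : Fin d → ℝ) : (covMat X β).PosSemidef := by
  have h : covMat X β = ∑ z, density X β z • Matrix.vecMulVec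
      (fun r => resp z r - meanVec X β r) (star fun r => resp z r - meanVec X β r) := by
    ext r r'
    simp [covMat, Matrix.sum_apply, Matrix.vecMulVec_apply]
  rw [h]
  exact Matrix.posSemidef_sum _ fun z _ =>
    (Matrix.posSemidef_vecMulVec_self_star _).smul (density_pos X β z).le

open scoped MatrixOrder in
/-- `‖W^{1/2} X b‖₂`, with the positive semidefinite square root of the covariance matrix `W` of
`Y` under `β₀`. -/
def predNorm (β₀ b : Fin d → ℝ) : ℝ :=
  l2 ((CFC.sqrt (covMat X β₀)).mulVec (X.mulVec b))

end Model

/-! ### Compatibility numbers -/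

section Compatibility

variable {n q d p : ℕ} (grp : Fin d → Fin p) (X : Matrix (Fin n × Fin q) (Fin d) ℝ)
  (β₀ : Fin d → ℝ)

/-- The compatibility number `φ(S)` (with `W` taken under `β₀`). -/
def phi (S : Finset (Fin p)) : ℝ :=
  sInf {r : ℝ | ∃ β : Fin d → ℝ,
    l21On grp Sᶜ β ≤ 7 * l21On grp S β ∧ (∃ j ∈ S, sub grp β j ≠ 0) ∧
    r = predNorm X β₀ β * √(S.card : ℝ) / (starNorm grp X * l21 grp β)}

/-- The uniform compatibility number `ψ₁(t)`. -/
def psi1 (t : ℝ) : ℝ :=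
  sInf {r : ℝ | ∃ β : Fin d → ℝ, 1 ≤ suppCard grp β ∧ (suppCard grp β : ℝ) ≤ t ∧
    r = predNorm X β₀ β * √(suppCard grp β : ℝ) / (starNorm grp X * l21 grp β)}

/-- The smallest scaled singular value `ψ₂(t)`. -/
def psi2 (t : ℝ) : ℝ :=
  sInf {r : ℝ | ∃ β : Fin d → ℝ, 1 ≤ suppCard grp β ∧ (suppCard grp β : ℝ) ≤ t ∧
    r = predNorm X β₀ β / (starNorm grp X * l2 β)}

/-- `s₀`, as a real number. -/
def s0 : ℝ := (suppCard grp β₀ : ℝ)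

/-- `φ(S₀)`. -/
def phi0 : ℝ := phi grp X β₀ (supp grp β₀)

/-- `ξ₀ = s₀ + A₄⁻¹ (4 + 100 / φ²(S₀)) s₀`. -/
def xi0 (A₄ : ℝ) : ℝ := s0 grp β₀ + A₄⁻¹ * (4 + 100 / phi0 grp X β₀ ^ 2) * s0 grp β₀

/-- `log p ∨ ḡ log n`. -/
def logTerm (n : ℕ) : ℝ := max (Real.log p) ((gbar grp : ℝ) * Real.log n)

/-- The class `B₂(M)` of true parameters. -/
def truthClass (A₄ M : ℝ) : Set (Fin d → ℝ) :=
  {β₀ | s0 grp β₀ * √(logTerm grp n) * (⨆ i : Fin n, starNorm grp (block X i)) ≤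
    M * psi1 grp X β₀ (xi0 grp X β₀ A₄ + s0 grp β₀) ^ 2 * phi0 grp X β₀ ^ 2 * starNorm grp X}

end Compatibility

/-! ### Prior and posterior -/

/-- `π` is a probability mass function on `{0, …, p}` such that, for `s = 1, …, p`,
`A₁ (p ∨ n^ḡ)^(-A₃) ≤ π(s) / π(s-1) ≤ A₂ (p ∨ n^ḡ)^(-A₄)`. -/
structure IsSizePrior (n : ℕ) {d p : ℕ} (grp : Fin d → Fin p) (A₁ A₂ A₃ A₄ : ℝ)
    (π : ℕ → ℝ) : Prop where
  nonneg : ∀ s ≤ p, 0 ≤ π s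
  sum_eq_one : ∑ s ∈ Finset.range (p + 1), π s = 1
  ratio_lower : ∀ s, 1 ≤ s → s ≤ p →
    A₁ / (max (p : ℝ) ((n : ℝ) ^ gbar grp)) ^ A₃ ≤ π s / π (s - 1)
  ratio_upper : ∀ s, 1 ≤ s → s ≤ p →
    π s / π (s - 1) ≤ A₂ / (max (p : ℝ) ((n : ℝ) ^ gbar grp)) ^ A₄

section Bayes

variable {n q d p : ℕ} (grp : Fin d → Fin p) (X : Matrix (Fin n × Fin q) (Fin d) ℝ)
  (π : ℕ → ℝ)

/-- The vector in `ℝ^d` that is equal to `b` on the groups in `S` and zero elsewhere. -/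
def embed (S : Finset (Fin p)) (b : {k : Fin d // grp k ∈ S} → ℝ) (k : Fin d) : ℝ :=
  if h : grp k ∈ S then b ⟨k, h⟩ else 0

/-- `embed` is measurable, so that the push-forward in the prior below is the genuine one. -/
lemma measurable_embed (S : Finset (Fin p)) : Measurable (embed grp S) := by
  refine measurable_pi_lambda _ fun k => ?_
  by_cases h : grp k ∈ S
  · simpa [embed, h] using measurable_pi_apply _
  · simp [embed, h]

/-- `λ = 8 ‖X‖_* √(log p ∨ ḡ log n)`. -/
def lam : ℝ := 8 * starNorm grp X * √(logTerm grp n)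

/-- The prior density `h_S` of the nonzero coefficients. -/
def slabDensity (S : Finset (Fin p)) (b : {k : Fin d // grp k ∈ S} → ℝ) : ℝ :=
  (lam grp X / √Real.pi) ^ dimOn grp S *
    ((∏ j ∈ S, Real.Gamma ((gsize grp j : ℝ) / 2)) /
      (2 ^ S.card * ∏ j ∈ S, Real.Gamma (gsize grp j : ℝ))) *
    Real.exp (-lam grp X * l21On grp S (embed grp S b))

/-- The prior of `β`: the sum over `S` of `π(s) / (p choose s)` times the product of the law with
density `h_S` for `β_S` and the Dirac measure at zero for the other coefficients. -/
def prior : Measure (Fin d → ℝ) :=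
  ∑ S : Finset (Fin p), ENNReal.ofReal (π S.card / (p.choose S.card : ℝ)) •
    Measure.map (embed grp S)
      ((volume : Measure ({k : Fin d // grp k ∈ S} → ℝ)).withDensity fun b =>
        ENNReal.ofReal (slabDensity grp X S b))

/-- The posterior given the responses `z`, by Bayes' rule. -/
def posterior (z : Fin n → Fin (q + 1)) : Measure (Fin d → ℝ) :=
  (∫⁻ β, ENNReal.ofReal (density X β z) ∂(prior grp X π))⁻¹ •
    (prior grp X π).withDensity fun β => ENNReal.ofReal (density X β z)

/-- The expectation under `β₀` of the posterior probability of `B`. -/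
def expPosterior (β₀ : Fin d → ℝ) (B : Set (Fin d → ℝ)) : ℝ≥0∞ :=
  ∑ z, ENNReal.ofReal (density X β₀ z) * posterior grp X π z B

end Bayes

end GroupLogit

end

/-! Write b = β - β₀, K = ‖X‖_*, L = L_n, N = ‖b‖_{2,1}, P = ‖W^{1/2}Xb‖₂, D = `excess` of b.

Likelihood. The log-likelihood ratio is exactly `score` - `excess` (`density_eq_mul_exp`). The score
is linear in b and centred under β₀, with variance P² (`predNorm_sq`). The excess is its cumulant
generating function: deterministic, nonnegative, at most ‖Xb‖₂²/2 by Hoeffding, at least 0.495 P²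
when max_i ‖X_i‖_* N is small (`excess_ge_quadratic`), and growing at least linearly along rays
beyond that (`excess_ge_linear`).

Noise. Each block of the score vector is sub-Gaussian, so outside an event of vanishing probability
every block has norm at most λ/4 = 2K√L (`sum_density_not_scoreEvent_le`). Then the score is at most
λN/4, and the Laplace penalty dominates it.

Evidence. Keep only the model S₀ and centre the slab at β₀, at the price e^{-λ‖β₀‖_{2,1}}. The slab
is invariant under independent sign changes of the groups; averaging over the signs and using Jensen
removes the score and the cross terms of ‖Xb‖₂², leaving Σ_j K²‖b_j‖₂²/2, whose mean is at most s₀L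
for this λ. With the binomial coefficient the loss is e^{-2s₀L} (`le_lintegral_density`,
`sum_quadratic_le`).

Numerator. Suppose the likelihood ratio on B is at most e^{e - λ‖β₀‖ + λ‖β‖ - λN/2}. The slab
absorbs e^{λ‖β‖}, and what remains is a Laplace density of half the rate, of mass at most 2^{d_S}.
The size prior beats 2^{ḡ} per group, so sizes s ≥ k contribute a geometric tail of ratio at most
e^{-0.995 A₄ L} (`lintegral_density_le`, `posterior_le_of_exponent_le`).

This is used twice. With the compatibility number φ, e = 99 s₀L/φ² works for all β (`exponent_le`),
and the more than A₄⁻¹(4 + 100/φ²)s₀ surplus groups outweigh it: the posterior concentrates on sizes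
at most ξ₀ (`posterior_dimension_le`). For such sparse β, ψ₁ compares N with P, and if P exceeds the
radius then D beats the penalty with (A₃ + 4)s₀L to spare (`exponent_le_of_far`), which pays for the
prior cost of reaching size s₀ from size 0 (`posterior_far_le`). The ℓ₂ and ℓ_{2,1} rates follow
from the prediction rate through ψ₂ and ψ₁. -/

noncomputable section

namespace GroupLogit

/-! ### Euclidean norms -/

section Norms

variable {ι κ : Type*} [Fintype ι] [Fintype κ]

lemma l2_nonneg (v : ι → ℝ) : 0 ≤ l2 v := norm_nonneg _

lemma l2_sq (v : ι → ℝ) : l2 v ^ 2 = ∑ i, v i ^ 2 := by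
  simp [l2, EuclideanSpace.norm_sq_eq]

lemma l2_add_le (v w : ι → ℝ) : l2 (v + w) ≤ l2 v + l2 w := by
  simpa [l2] using norm_add_le (WithLp.toLp 2 v) (WithLp.toLp 2 w)

lemma l2_smul (c : ℝ) (v : ι → ℝ) : l2 (c • v) = |c| * l2 v := by
  simpa [l2] using norm_smul c (WithLp.toLp 2 v)

@[simp] lemma l2_zero : l2 (0 : ι → ℝ) = 0 := by simp [l2]

lemma l2_eq_zero {v : ι → ℝ} : l2 v = 0 ↔ v = 0 := by simp [l2]

lemma continuous_l2 : Continuous (l2 : (ι → ℝ) → ℝ) :=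
  continuous_norm.comp (PiLp.continuous_toLp 2 _)

lemma measurable_l2 : Measurable (l2 : (ι → ℝ) → ℝ) := continuous_l2.measurable

lemma sum_mul_le_l2 (v w : ι → ℝ) : ∑ i, v i * w i ≤ l2 v * l2 w := by
  refine le_of_sq_le_sq ?_ (mul_nonneg (l2_nonneg v) (l2_nonneg w)) |>.trans_eq' rfl
  rw [mul_pow, l2_sq, l2_sq]
  exact Finset.sum_mul_sq_le_sq_mul_sq _ _ _

lemma abs_apply_le_l2 (v : ι → ℝ) (i : ι) : |v i| ≤ l2 v := by
  refine abs_le_of_sq_le_sq ?_ (l2_nonneg v)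
  rw [l2_sq]
  exact Finset.single_le_sum (f := fun i => v i ^ 2) (fun _ _ => sq_nonneg _) (Finset.mem_univ i)

lemma l2_sum_le {α : Type*} (s : Finset α) (f : α → ι → ℝ) :
    l2 (∑ a ∈ s, f a) ≤ ∑ a ∈ s, l2 (f a) := by
  classical
  induction s using Finset.induction_on with
  | empty => simp
  | insert a s ha ih =>
    rw [Finset.sum_insert ha, Finset.sum_insert ha]
    exact (l2_add_le _ _).trans (by gcongr)

variable [DecidableEq κ]

lemma spNorm_nonneg (A : Matrix ι κ ℝ) : 0 ≤ spNorm A := norm_nonneg _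

lemma l2_mulVec_le (A : Matrix ι κ ℝ) (v : κ → ℝ) : l2 (A.mulVec v) ≤ spNorm A * l2 v := by
  simpa [l2, spNorm, Matrix.toLpLin_apply] using
    (Matrix.toEuclideanLin A).toContinuousLinearMap.le_opNorm (WithLp.toLp 2 v)

end Norms

/-! ### Laplace and Gaussian integrals -/

section Integrals

open Real

variable {ι : Type*} [Fintype ι]

lemma integral_comp_l2 (f : ℝ → ℝ) :
    ∫ x : ι → ℝ, f (l2 x) = ∫ x : EuclideanSpace ℝ ι, f ‖x‖ := by
  have := (PiLp.volume_preserving_toLp ι).integral_comp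
    (MeasurableEquiv.toLp 2 (ι → ℝ)).measurableEmbedding (fun x => f ‖x‖)
  exact this

lemma integrable_comp_l2 (f : ℝ → ℝ) :
    Integrable (fun x : ι → ℝ => f (l2 x)) ↔ Integrable fun x : EuclideanSpace ℝ ι => f ‖x‖ :=
  (PiLp.volume_preserving_toLp ι).integrable_comp_emb
    (MeasurableEquiv.toLp 2 (ι → ℝ)).measurableEmbedding (g := fun x => f ‖x‖)

/-- The normalizing constant of the density proportional to `exp (-κ ‖x‖)` on `ℝ^g`. -/
def laplaceConst (κ : ℝ) (g : ℕ) : ℝ :=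
  (κ / √π) ^ g * (Gamma ((g : ℝ) / 2) / (2 * Gamma (g : ℝ)))

lemma laplaceConst_pos {κ : ℝ} (hκ : 0 < κ) {g : ℕ} (hg : 0 < g) : 0 < laplaceConst κ g := by
  have : 0 < (g : ℝ) := by exact_mod_cast hg
  have h1 := Gamma_pos_of_pos this
  have h2 := Gamma_pos_of_pos (half_pos this)
  unfold laplaceConst
  positivity

variable [Nonempty ι]

lemma radial_integrand_eq {κ : ℝ} {g : ℕ} (hg : 0 < g) (k : ℕ) (r : ℝ) :
    r ^ (g - 1) • (r ^ k * exp (-κ * r)) = r ^ (((g + k : ℕ) : ℝ) - 1) * exp (-(κ * r)) := by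
  rw [smul_eq_mul, ← mul_assoc, ← pow_add, neg_mul]
  have : ((g + k : ℕ) : ℝ) - 1 = ((g - 1 + k : ℕ) : ℝ) := by
    rw [show g + k = (g - 1 + k) + 1 by omega]; push_cast; ring
  rw [this, rpow_natCast]

lemma integrable_pow_l2_mul_exp {κ : ℝ} (hκ : 0 < κ) (k : ℕ) :
    Integrable fun x : ι → ℝ => l2 x ^ k * exp (-κ * l2 x) := by
  rw [integrable_comp_l2 (fun r => r ^ k * exp (-κ * r)),
    integrable_fun_norm_addHaar volume (f := fun r => r ^ k * exp (-κ * r)), finrank_euclideanSpace]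
  have hg : 0 < Fintype.card ι := Fintype.card_pos
  have := integrableOn_rpow_mul_exp_neg_mul_rpow (p := 1)
    (s := ((Fintype.card ι + k : ℕ) : ℝ) - 1) (b := κ) (by
      have : (1 : ℝ) ≤ ((Fintype.card ι + k : ℕ) : ℝ) := by exact_mod_cast (by omega)
      linarith) (by norm_num) hκ
  refine this.congr_fun (fun r _ => ?_) measurableSet_Ioi
  rw [radial_integrand_eq hg k r]
  simp

/-- Polar coordinates turn the integral into a Gamma integral, and Γ(g/2 + 1) = (g/2) Γ(g/2) makes
the volume of the unit ball cancel against the constant. Only k = 0 (total mass) and k = 2 (second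
moment) are needed. -/
lemma integral_pow_l2_mul_exp {κ : ℝ} (hκ : 0 < κ) (k : ℕ) :
    ∫ x : ι → ℝ, l2 x ^ k * (laplaceConst κ (Fintype.card ι) * exp (-κ * l2 x)) =
      Gamma ((Fintype.card ι + k : ℕ) : ℝ) / (Gamma (Fintype.card ι : ℝ) * κ ^ k) := by
  have hg : 0 < Fintype.card ι := Fintype.card_pos
  have hg' : (0 : ℝ) < Fintype.card ι := by exact_mod_cast hg
  have h1 := Gamma_pos_of_pos hg'
  have h2 := Gamma_pos_of_pos (half_pos hg')
  have h0 : ∫ x : ι → ℝ, l2 x ^ k * exp (-κ * l2 x) =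
      (Fintype.card ι : ℝ) * ((√π ^ Fintype.card ι / Gamma (Fintype.card ι / 2 + 1)) *
        ((1 / κ) ^ (Fintype.card ι + k) * Gamma ((Fintype.card ι + k : ℕ) : ℝ))) := by
    rw [integral_comp_l2 (fun r => r ^ k * exp (-κ * r)),
      integral_fun_norm_addHaar volume (f := fun r => r ^ k * exp (-κ * r)), finrank_euclideanSpace,
      setIntegral_congr_fun measurableSet_Ioi (fun r _ => radial_integrand_eq hg k r),
      integral_rpow_mul_exp_neg_mul_Ioi (by exact_mod_cast (by omega)) hκ, rpow_natCast,
      nsmul_eq_mul, smul_eq_mul, measureReal_def, EuclideanSpace.volume_ball]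
    congr 2
    have : 0 ≤ √π ^ Fintype.card ι / Gamma (Fintype.card ι / 2 + 1) :=
      div_nonneg (by positivity) (Gamma_pos_of_pos (by positivity)).le
    simp [ENNReal.toReal_ofReal this]
  have h3 : ∀ x : ι → ℝ, l2 x ^ k * (laplaceConst κ (Fintype.card ι) * exp (-κ * l2 x)) =
      laplaceConst κ (Fintype.card ι) * (l2 x ^ k * exp (-κ * l2 x)) := fun x => by ring
  simp_rw [h3]
  rw [integral_const_mul, h0, Gamma_add_one (by positivity), laplaceConst]
  have : 0 < √π := by positivity
  rw [div_pow, div_pow, one_pow, pow_add]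
  field_simp

lemma integral_laplace {κ : ℝ} (hκ : 0 < κ) :
    ∫ x : ι → ℝ, laplaceConst κ (Fintype.card ι) * exp (-κ * l2 x) = 1 := by
  have := integral_pow_l2_mul_exp (ι := ι) hκ 0
  have hg' : (0 : ℝ) < Fintype.card ι := by exact_mod_cast Fintype.card_pos
  have h1 := Gamma_pos_of_pos hg'
  simpa [h1.ne'] using this

lemma integral_sq_laplace {κ : ℝ} (hκ : 0 < κ) :
    ∫ x : ι → ℝ, l2 x ^ 2 * (laplaceConst κ (Fintype.card ι) * exp (-κ * l2 x)) =
      (Fintype.card ι : ℝ) * (Fintype.card ι + 1) / κ ^ 2 := by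
  rw [integral_pow_l2_mul_exp hκ 2]
  have hg' : (0 : ℝ) < Fintype.card ι := by exact_mod_cast Fintype.card_pos
  have h1 := Gamma_pos_of_pos hg'
  have : ((Fintype.card ι + 2 : ℕ) : ℝ) = (Fintype.card ι : ℝ) + 1 + 1 := by push_cast; ring
  rw [this, Gamma_add_one (by positivity), Gamma_add_one (by positivity)]
  field_simp

lemma integrable_laplace {κ : ℝ} (hκ : 0 < κ) :
    Integrable fun x : ι → ℝ => laplaceConst κ (Fintype.card ι) * exp (-κ * l2 x) := by
  simpa using (integrable_pow_l2_mul_exp (ι := ι) hκ 0).const_mul _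

lemma integrable_laplace_gauss {κ : ℝ} (hκ : 0 < κ) {a : ℝ} (ha : 0 ≤ a) :
    Integrable fun x : ι → ℝ =>
      laplaceConst κ (Fintype.card ι) * exp (-κ * l2 x) * exp (-a * l2 x ^ 2) := by
  refine (integrable_laplace hκ).mul_bdd (c := 1) ?_ ?_
  · exact (by
      have := measurable_l2 (ι := ι)
      fun_prop : Measurable fun x : ι → ℝ => exp (-a * l2 x ^ 2)).aestronglyMeasurable
  · refine Eventually.of_forall fun x => ?_
    rw [norm_of_nonneg (exp_pos _).le, exp_le_one_iff]
    nlinarith [sq_nonneg (l2 x)]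

/-- Jensen's inequality for t ↦ e^{-at} under the Laplace law, proved by integrating the tangent
line of the exponential at the mean of ‖x‖². -/
lemma le_integral_laplace_gauss {κ : ℝ} (hκ : 0 < κ) {a : ℝ} (ha : 0 ≤ a) :
    exp (-a * ((Fintype.card ι : ℝ) * (Fintype.card ι + 1) / κ ^ 2)) ≤
      ∫ x : ι → ℝ, laplaceConst κ (Fintype.card ι) * exp (-κ * l2 x) * exp (-a * l2 x ^ 2) := by
  set m := (Fintype.card ι : ℝ) * (Fintype.card ι + 1) / κ ^ 2 with hm
  have hc := laplaceConst_pos hκ (Fintype.card_pos (α := ι))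
  have h1 := integral_laplace (ι := ι) hκ
  have h2 := integral_sq_laplace (ι := ι) hκ
  rw [← hm] at h2
  have hi := integrable_laplace (ι := ι) hκ
  have hi2 : Integrable fun x : ι → ℝ =>
      l2 x ^ 2 * (laplaceConst κ (Fintype.card ι) * exp (-κ * l2 x)) := by
    have := (integrable_pow_l2_mul_exp (ι := ι) hκ 2).const_mul (laplaceConst κ (Fintype.card ι))
    refine this.congr (Eventually.of_forall fun x => ?_)
    ring
  calc exp (-a * m) = ∫ x : ι → ℝ, (exp (-a * m) * (1 + a * m) *
        (laplaceConst κ (Fintype.card ι) * exp (-κ * l2 x)) - exp (-a * m) * a *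
        (l2 x ^ 2 * (laplaceConst κ (Fintype.card ι) * exp (-κ * l2 x)))) := by
        rw [integral_sub (hi.const_mul _) (hi2.const_mul _), integral_const_mul
          (exp (-a * m) * (1 + a * m)), integral_const_mul (exp (-a * m) * a), h1, h2]
        ring
    _ ≤ _ := by
        refine integral_mono ((hi.const_mul _).sub (hi2.const_mul _))
          (integrable_laplace_gauss hκ ha) fun x => ?_
        have h3 := add_one_le_exp (a * m - a * l2 x ^ 2)
        have h4 : exp (-a * l2 x ^ 2) = exp (-a * m) * exp (a * m - a * l2 x ^ 2) := by
          rw [← exp_add]; congr 1; ring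
        have h5 : 0 < laplaceConst κ (Fintype.card ι) * exp (-κ * l2 x) := by positivity
        have h6 := mul_le_mul_of_nonneg_left h3
          (mul_pos h5 (exp_pos (-a * m))).le
        simp only
        rw [h4]
        linarith

omit [Nonempty ι]

lemma integral_exp_linear_sub_sq {b : ℝ} (hb : 0 < b) (c : ℝ) :
    ∫ x : ℝ, exp (c * x - b * x ^ 2) = √(π / b) * exp (c ^ 2 / (4 * b)) := by
  have h : ∀ x : ℝ, exp (c * x - b * x ^ 2) =
      exp (-b * (x - c / (2 * b)) ^ 2) * exp (c ^ 2 / (4 * b)) := fun x => by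
    rw [← exp_add]; congr 1; field_simp; ring
  simp_rw [h]
  rw [integral_mul_const, integral_sub_right_eq_self (fun x => exp (-b * x ^ 2)),
    integral_gaussian]

lemma integrable_exp_linear_sub_sq {b : ℝ} (hb : 0 < b) (c : ℝ) :
    Integrable fun x : ℝ => exp (c * x - b * x ^ 2) := by
  have h : ∀ x : ℝ, exp (c * x - b * x ^ 2) =
      exp (-b * (x - c / (2 * b)) ^ 2) * exp (c ^ 2 / (4 * b)) := fun x => by
    rw [← exp_add]; congr 1; field_simp; ring
  simp_rw [h]
  exact ((integrable_exp_neg_mul_sq hb).comp_sub_right (c / (2 * b))).mul_const _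

/-- A sub-Gaussian random vector has exponentially small norm: Gaussian mixing. -/
lemma sum_exp_sq_le_of_subgaussian {Ω : Type*} [Fintype Ω] (f : Ω → ℝ)
    (V : Ω → ι → ℝ) {K : ℝ} (hK : 0 < K)
    (h : ∀ x : ι → ℝ, ∑ z, f z * exp (∑ i, V z i * x i) ≤ exp (K ^ 2 / 2 * l2 x ^ 2)) :
    ∑ z, f z * exp (3 * l2 (V z) ^ 2 / (8 * K ^ 2)) ≤ 2 ^ Fintype.card ι := by
  -- Integrating e^{v·x} against e^{-b‖x‖²} yields e^{‖v‖²/(4b)}, which is the claimed exponent for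
  -- this b. The upper bound leaves the Gaussian rate b - K²/2 = K²/6 = b/4, and the two
  -- normalizations differ by a factor 2 per coordinate.
  set b : ℝ := 2 * K ^ 2 / 3 with hb
  have hb0 : 0 < b := by positivity
  have hprod : ∀ v x : ι → ℝ, exp (∑ i, v i * x i) * exp (-b * l2 x ^ 2) =
      ∏ i, exp (v i * x i - b * x i ^ 2) := fun v x => by
    rw [← exp_add, ← exp_sum, l2_sq, Finset.sum_sub_distrib, ← Finset.mul_sum, neg_mul,
      ← sub_eq_add_neg]
  have hint : ∀ v : ι → ℝ, Integrable fun x : ι → ℝ =>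
      exp (∑ i, v i * x i) * exp (-b * l2 x ^ 2) := fun v => by
    simp_rw [hprod]
    exact Integrable.fintype_prod (f := fun i (t : ℝ) => exp (v i * t - b * t ^ 2))
      fun i => integrable_exp_linear_sub_sq hb0 _
  have hval : ∀ v : ι → ℝ, ∫ x : ι → ℝ, exp (∑ i, v i * x i) * exp (-b * l2 x ^ 2) =
      √(π / b) ^ Fintype.card ι * exp (3 * l2 v ^ 2 / (8 * K ^ 2)) := fun v => by
    simp_rw [hprod]
    rw [integral_fintype_prod_volume_eq_prod (fun i (t : ℝ) => exp (v i * t - b * t ^ 2))]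
    simp_rw [integral_exp_linear_sub_sq hb0]
    rw [Finset.prod_mul_distrib, ← exp_sum, Finset.prod_const, Finset.card_univ, l2_sq, hb]
    congr 2
    rw [Finset.mul_sum, Finset.sum_div]
    refine Finset.sum_congr rfl fun i _ => ?_
    field_simp
    ring
  have hq : ∀ x : ι → ℝ, exp (K ^ 2 / 2 * l2 x ^ 2) * exp (-b * l2 x ^ 2) =
      ∏ i, exp (0 * x i - (K ^ 2 / 6) * x i ^ 2) := fun x => by
    rw [← exp_add, ← exp_sum, l2_sq, ← add_mul, Finset.mul_sum]
    congr 1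
    refine Finset.sum_congr rfl fun i _ => ?_
    rw [hb]; ring
  have hqi : Integrable fun x : ι → ℝ =>
      exp (K ^ 2 / 2 * l2 x ^ 2) * exp (-b * l2 x ^ 2) := by
    simp_rw [hq]
    exact Integrable.fintype_prod (f := fun i (t : ℝ) => exp (0 * t - (K ^ 2 / 6) * t ^ 2))
      fun i => integrable_exp_linear_sub_sq (by positivity) _
  have hqv : ∫ x : ι → ℝ, exp (K ^ 2 / 2 * l2 x ^ 2) * exp (-b * l2 x ^ 2) =
      √(π / b) ^ Fintype.card ι * 2 ^ Fintype.card ι := by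
    simp_rw [hq]
    rw [integral_fintype_prod_volume_eq_prod
      (fun i (t : ℝ) => exp (0 * t - (K ^ 2 / 6) * t ^ 2))]
    simp_rw [integral_exp_linear_sub_sq (show 0 < K ^ 2 / 6 by positivity)]
    have : π / (K ^ 2 / 6) = π / b * 2 ^ 2 := by rw [hb]; field_simp; norm_num
    rw [this, sqrt_mul (by positivity), sqrt_sq (by norm_num)]
    simp [mul_pow]
  have key : √(π / b) ^ Fintype.card ι * ∑ z, f z * exp (3 * l2 (V z) ^ 2 / (8 * K ^ 2)) ≤
      √(π / b) ^ Fintype.card ι * 2 ^ Fintype.card ι := by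
    calc _ = ∑ z, ∫ x : ι → ℝ, f z * (exp (∑ i, V z i * x i) * exp (-b * l2 x ^ 2)) := by
          rw [Finset.mul_sum]
          refine Finset.sum_congr rfl fun z _ => ?_
          rw [integral_const_mul, hval]
          ring
      _ = ∫ x : ι → ℝ, ∑ z, f z * (exp (∑ i, V z i * x i) * exp (-b * l2 x ^ 2)) :=
          (integral_finsetSum _ fun z _ => (hint _).const_mul _).symm
      _ ≤ ∫ x : ι → ℝ, exp (K ^ 2 / 2 * l2 x ^ 2) * exp (-b * l2 x ^ 2) := by
          refine integral_mono (integrable_finsetSum _ fun z _ => (hint _).const_mul _) hqi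
            fun x => ?_
          simp_rw [← mul_assoc, ← Finset.sum_mul]
          exact mul_le_mul_of_nonneg_right (h x) (exp_pos _).le
      _ = _ := hqv
  exact le_of_mul_le_mul_left key (by positivity)

end Integrals

/-! ### Cumulants of bounded variables on a finite probability space -/

section Cumulant

variable {ι : Type*} [Fintype ι] {w x : ι → ℝ}

lemma sum_mul_exp_pos (hw : ∀ i, 0 ≤ w i) (h1 : ∑ i, w i = 1) (x : ι → ℝ) :
    0 < ∑ i, w i * Real.exp (x i) := by
  obtain ⟨i, -, hi⟩ : ∃ i ∈ Finset.univ, w i ≠ 0 := by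
    by_contra! h
    rw [Finset.sum_eq_zero h] at h1
    exact zero_ne_one h1
  exact Finset.sum_pos' (fun i _ => mul_nonneg (hw i) (Real.exp_pos _).le)
    ⟨i, Finset.mem_univ i, mul_pos ((hw i).lt_of_ne' hi) (Real.exp_pos _)⟩

/-- Hoeffding's lemma. -/
lemma sum_mul_exp_sub_mean_le (hw : ∀ i, 0 ≤ w i) (h1 : ∑ i, w i = 1) {r : ℝ}
    (hr : ∀ i, |x i| ≤ r) :
    ∑ i, w i * Real.exp (x i - ∑ k, w k * x k) ≤ Real.exp (r ^ 2 / 2) := by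
  classical
  let : MeasurableSpace ι := ⊤
  let P : PMF ι := PMF.ofFintype (fun i => ENNReal.ofReal (w i)) (by
    rw [← ENNReal.ofReal_sum_of_nonneg fun i _ => hw i, h1, ENNReal.ofReal_one])
  have hP : ∀ f : ι → ℝ, ∫ i, f i ∂P.toMeasure = ∑ i, w i * f i := fun f => by
    rw [PMF.integral_eq_sum]
    refine Finset.sum_congr rfl fun i _ => ?_
    simp [P, ENNReal.toReal_ofReal (hw i)]
  have := (ProbabilityTheory.hasSubgaussianMGF_of_mem_Icc (μ := P.toMeasure) (X := x)
    (a := -r) (b := r) (measurable_from_top.aemeasurable)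
    (Eventually.of_forall fun i => abs_le.mp (hr i))).mgf_le 1
  rw [ProbabilityTheory.mgf, hP, hP] at this
  simp only [one_mul] at this
  refine this.trans_eq ?_
  congr 1
  have h2 : r - -r = 2 * r := by ring
  simp [h2]

lemma cumulant_nonneg (hw : ∀ i, 0 ≤ w i) (h1 : ∑ i, w i = 1) (h0 : ∑ i, w i * x i = 0) :
    0 ≤ Real.log (∑ i, w i * Real.exp (x i)) := by
  refine Real.log_nonneg ?_
  calc (1 : ℝ) = ∑ i, w i * (x i + 1) := by
        simp_rw [mul_add, Finset.sum_add_distrib, mul_one, h0, h1, zero_add]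
    _ ≤ _ := Finset.sum_le_sum fun i _ =>
        mul_le_mul_of_nonneg_left (Real.add_one_le_exp _) (hw i)

/-- For a centred variable of small range the cumulant generating function is nearly half the
variance: Taylor's formula bounds the moment generating function below, and log (1 + v) ≥ v/(1 + v)
≥ v(1 - v) bounds its logarithm. -/
lemma cumulant_ge (hw : ∀ i, 0 ≤ w i) (h1 : ∑ i, w i = 1) (h0 : ∑ i, w i * x i = 0) {ρ : ℝ}
    (hρ1 : ρ ≤ 1) (hx : ∀ i, |x i| ≤ ρ) :
    (1 - ρ) / 2 * ∑ i, w i * x i ^ 2 ≤ Real.log (∑ i, w i * Real.exp (x i)) := by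
  have hρ0 : 0 ≤ ρ := by
    by_contra! h
    have : IsEmpty ι := ⟨fun i => absurd ((abs_nonneg _).trans (hx i)) (not_le.mpr h)⟩
    simp at h1
  set s := ∑ i, w i * x i ^ 2 with hs
  have hs0 : 0 ≤ s := Finset.sum_nonneg fun i _ => mul_nonneg (hw i) (sq_nonneg _)
  have hs1 : s ≤ ρ ^ 2 := by
    calc s ≤ ∑ i, w i * ρ ^ 2 := Finset.sum_le_sum fun i _ =>
          mul_le_mul_of_nonneg_left (sq_le_sq' (abs_le.mp (hx i)).1 (abs_le.mp (hx i)).2) (hw i)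
      _ = ρ ^ 2 := by rw [← Finset.sum_mul, h1, one_mul]
  set v := s * (1 / 2 - 2 / 9 * ρ) with hv
  have hv0 : 0 ≤ v := mul_nonneg hs0 (by linarith)
  -- The third-order remainder in `Real.exp_bound` is |x|³ · 4/(3! · 3) = (2/9)|x|³, and one factor
  -- |x| is bounded by ρ.
  have hexp : ∀ i, 1 + x i + x i ^ 2 * (1 / 2 - 2 / 9 * ρ) ≤ Real.exp (x i) := fun i => by
    have h := (abs_le.mp (Real.exp_bound ((hx i).trans hρ1) (n := 3) (by norm_num))).1
    simp only [Finset.sum_range_succ, Finset.sum_range_zero, Nat.factorial] at h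
    have h3 : |x i| ^ 3 = x i ^ 2 * |x i| := by rw [pow_succ, sq_abs]
    rw [h3] at h
    have h4 := mul_le_mul_of_nonneg_left (hx i) (sq_nonneg (x i))
    norm_num at h
    nlinarith
  have hsum : 1 + v ≤ ∑ i, w i * Real.exp (x i) := by
    calc 1 + v = ∑ i, w i * (1 + x i + x i ^ 2 * (1 / 2 - 2 / 9 * ρ)) := by
          simp_rw [mul_add, Finset.sum_add_distrib, mul_one, h0, h1, ← mul_assoc,
            ← Finset.sum_mul]
          ring
      _ ≤ _ := Finset.sum_le_sum fun i _ => mul_le_mul_of_nonneg_left (hexp i) (hw i)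
  have hlog : v / (1 + v) ≤ Real.log (1 + v) := by
    have := Real.one_sub_inv_le_log_of_pos (show 0 < 1 + v by linarith)
    convert this using 1
    field_simp
    ring
  refine le_trans ?_ (hlog.trans (Real.log_le_log (by linarith) hsum))
  have hvρ : v ≤ ρ / 2 := by nlinarith
  have h5 : v * (1 - v) ≤ v / (1 + v) := by
    rw [le_div_iff₀ (by linarith)]
    nlinarith [pow_nonneg hv0 3]
  refine le_trans ?_ h5
  have h6 : v * (1 - ρ / 2) ≤ v * (1 - v) := by gcongr
  refine le_trans ?_ h6
  rw [hv]
  nlinarith [mul_nonneg hs0 hρ0, mul_nonneg hs0 (sq_nonneg ρ)]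

/-- Jensen's inequality for the power 1/t. This is convexity along the ray through 0, where the
cumulant vanishes. -/
lemma cumulant_smul_le (hw : ∀ i, 0 ≤ w i) (h1 : ∑ i, w i = 1) {t : ℝ} (ht0 : 0 < t)
    (ht1 : t ≤ 1) :
    Real.log (∑ i, w i * Real.exp (t * x i)) ≤ t * Real.log (∑ i, w i * Real.exp (x i)) := by
  have h := Real.rpow_arith_mean_le_arith_mean_rpow Finset.univ w
    (fun i => Real.exp (t * x i)) (fun i _ => hw i) h1 (fun i _ => (Real.exp_pos _).le)
    (p := 1 / t) (by rw [le_div_iff₀ ht0]; linarith)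
  simp_rw [← Real.exp_mul] at h
  have h2 : ∀ i, t * x i * (1 / t) = x i := fun i => by field_simp
  simp_rw [h2] at h
  have hp := sum_mul_exp_pos hw h1 fun i => t * x i
  have h3 := Real.log_le_log (Real.rpow_pos_of_pos hp _) h
  rw [Real.log_rpow hp, one_div, inv_mul_le_iff₀ ht0] at h3
  exact h3

end Cumulant

/-! ### Product probabilities and random signs -/

section Product

variable {ι κ : Type*} [Fintype ι] [DecidableEq ι] [Fintype κ] {w : ι → κ → ℝ}

lemma sum_prod_mul_prod (w g : ι → κ → ℝ) :
    ∑ z : ι → κ, (∏ i, w i (z i)) * ∏ i, g i (z i) = ∏ i, ∑ c, w i c * g i c := by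
  rw [Finset.prod_univ_sum, Fintype.piFinset_univ]
  exact Finset.sum_congr rfl fun z _ => Finset.prod_mul_distrib.symm

lemma sum_prod_mul_apply (hw : ∀ i, ∑ c, w i c = 1) (i : ι) (h : κ → ℝ) :
    ∑ z : ι → κ, (∏ i, w i (z i)) * h (z i) = ∑ c, w i c * h c := by
  have := sum_prod_mul_prod w fun i' c => if i' = i then h c else 1
  simp only [Finset.prod_ite_eq', Finset.mem_univ, if_true] at this
  rw [this, Finset.prod_eq_single i (fun b _ hb => by simp [hb, hw]) (by simp)]
  simp

/-- The variance of a sum of independent centred variables. -/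
lemma sum_prod_mul_sq (hw : ∀ i, ∑ c, w i c = 1) (a : ι → κ → ℝ)
    (ha : ∀ i, ∑ c, w i c * a i c = 0) :
    ∑ z : ι → κ, (∏ i, w i (z i)) * (∑ i, a i (z i)) ^ 2 = ∑ i, ∑ c, w i c * a i c ^ 2 := by
  have hcross : ∀ i k : ι, i ≠ k →
      ∑ z : ι → κ, (∏ i, w i (z i)) * (a i (z i) * a k (z k)) = 0 := by
    intro i k hik
    have := sum_prod_mul_prod w fun i' c =>
      (if i' = i then a i c else 1) * (if i' = k then a k c else 1)
    simp only [Finset.prod_mul_distrib, Finset.prod_ite_eq', Finset.mem_univ, if_true] at this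
    rw [this]
    refine Finset.prod_eq_zero (Finset.mem_univ i) ?_
    simp [hik, ha]
  simp_rw [sq, Finset.sum_mul_sum, Finset.mul_sum]
  rw [Finset.sum_comm]
  refine Finset.sum_congr rfl fun i _ => ?_
  rw [Finset.sum_comm, Finset.sum_eq_single i (fun k _ hk => hcross i k hk.symm) (by simp)]
  exact sum_prod_mul_apply hw i fun c => a i c * a i c

/-- The sign `±1` encoded by a Boolean. -/
def sgn (b : Bool) : ℝ := if b then 1 else -1

lemma abs_sgn (b : Bool) : |sgn b| = 1 := by cases b <;> simp [sgn]

lemma sum_signs_linear (a : ι → ℝ) :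
    ∑ σ : ι → Bool, (∏ _i : ι, (1 / 2 : ℝ)) * ∑ j, sgn (σ j) * a j = 0 := by
  simp_rw [Finset.mul_sum]
  rw [Finset.sum_comm]
  refine Finset.sum_eq_zero fun j _ => ?_
  rw [sum_prod_mul_apply (w := fun _ (_ : Bool) => (1 / 2 : ℝ)) (by simp) j
    fun c => sgn c * a j]
  simp [sgn]

lemma sum_signs_sq (a : ι → ℝ) :
    ∑ σ : ι → Bool, (∏ _i : ι, (1 / 2 : ℝ)) * (∑ j, sgn (σ j) * a j) ^ 2 = ∑ j, a j ^ 2 := by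
  rw [sum_prod_mul_sq (w := fun _ (_ : Bool) => (1 / 2 : ℝ)) (by simp)
    (fun j c => sgn c * a j) (by simp [sgn])]
  refine Finset.sum_congr rfl fun j _ => ?_
  simp [sgn]

lemma sum_signs_one : ∑ _σ : ι → Bool, (∏ _i : ι, (1 / 2 : ℝ)) = 1 := by
  simp

/-- Random signs make the vectors orthogonal on average, so the squared norm of the sum costs
Σ‖v_j‖² and not (Σ‖v_j‖)². -/
lemma sum_signs_l2_sq {ρ : Type*} [Fintype ρ] (v : ι → ρ → ℝ) :
    ∑ σ : ι → Bool, (∏ _i : ι, (1 / 2 : ℝ)) * l2 (∑ j, sgn (σ j) • v j) ^ 2 =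
      ∑ j, l2 (v j) ^ 2 := by
  simp_rw [l2_sq, Finset.mul_sum]
  rw [Finset.sum_comm, Finset.sum_comm (s := (Finset.univ : Finset ι))]
  refine Finset.sum_congr rfl fun r _ => ?_
  simp only [Finset.sum_apply, Pi.smul_apply, smul_eq_mul]
  exact sum_signs_sq fun j => v j r

end Product

/-! ### Group norms -/

section GroupNorms

variable {d p : ℕ} (grp : Fin d → Fin p)

lemma sub_add (a b : Fin d → ℝ) (j : Fin p) : sub grp (a + b) j = sub grp a j + sub grp b j := rfl

lemma sub_smul (c : ℝ) (b : Fin d → ℝ) (j : Fin p) : sub grp (c • b) j = c • sub grp b j := rfl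

lemma l21On_nonneg (S : Finset (Fin p)) (b : Fin d → ℝ) : 0 ≤ l21On grp S b :=
  Finset.sum_nonneg fun _ _ => l2_nonneg _

lemma l21_nonneg (b : Fin d → ℝ) : 0 ≤ l21 grp b := l21On_nonneg grp _ b

@[simp] lemma l21_zero : l21 grp (0 : Fin d → ℝ) = 0 := by
  unfold l21 l21On
  exact Finset.sum_eq_zero fun j _ => by
    have : sub grp (0 : Fin d → ℝ) j = 0 := rfl
    rw [this, l2_zero]

lemma l21On_add_compl (S : Finset (Fin p)) (b : Fin d → ℝ) :
    l21On grp S b + l21On grp Sᶜ b = l21 grp b :=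
  Finset.sum_add_sum_compl S _

lemma l21On_add_le (S : Finset (Fin p)) (a b : Fin d → ℝ) :
    l21On grp S (a + b) ≤ l21On grp S a + l21On grp S b := by
  unfold l21On
  rw [← Finset.sum_add_distrib]
  exact Finset.sum_le_sum fun j _ => by rw [sub_add]; exact l2_add_le _ _

lemma l21On_smul (S : Finset (Fin p)) (c : ℝ) (b : Fin d → ℝ) :
    l21On grp S (c • b) = |c| * l21On grp S b := by
  unfold l21On
  rw [Finset.mul_sum]
  exact Finset.sum_congr rfl fun j _ => by rw [sub_smul, l2_smul]

lemma l21On_neg (S : Finset (Fin p)) (b : Fin d → ℝ) : l21On grp S (-b) = l21On grp S b := by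
  have := l21On_smul grp S (-1) b
  simpa using this

lemma sum_groups {M : Type*} [AddCommMonoid M] (f : Fin d → M) :
    ∑ j : Fin p, ∑ k : Group grp j, f k.1 = ∑ k, f k := by
  rw [← Finset.sum_fiberwise Finset.univ grp f]
  refine Finset.sum_congr rfl fun j _ => ?_
  exact (Finset.sum_subtype (Finset.univ.filter fun k => grp k = j) (by simp) f).symm

lemma sum_sq_groups (b : Fin d → ℝ) : ∑ j, l2 (sub grp b j) ^ 2 = l2 b ^ 2 := by
  simp_rw [l2_sq]
  exact sum_groups grp fun k => b k ^ 2

lemma mem_supp {b : Fin d → ℝ} {j : Fin p} : j ∈ supp grp b ↔ sub grp b j ≠ 0 := by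
  simp [supp]

lemma l21On_eq_l21_of_supp_subset {S : Finset (Fin p)} {b : Fin d → ℝ} (h : supp grp b ⊆ S) :
    l21On grp S b = l21 grp b := by
  refine Finset.sum_subset (Finset.subset_univ S) fun j _ hj => ?_
  have : sub grp b j = 0 := by
    by_contra h'
    exact hj (h ((mem_supp grp).2 h'))
  rw [this, l2_zero]

lemma l21On_compl_supp (b : Fin d → ℝ) : l21On grp (supp grp b)ᶜ b = 0 := by
  have h1 := l21On_add_compl grp (supp grp b) b
  rw [l21On_eq_l21_of_supp_subset grp subset_rfl] at h1
  linarith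

lemma suppCard_add_le (a b : Fin d → ℝ) :
    suppCard grp (a + b) ≤ suppCard grp a + suppCard grp b := by
  classical
  refine (Finset.card_le_card fun j hj => ?_).trans (Finset.card_union_le _ _)
  rw [mem_supp, sub_add] at hj
  rw [Finset.mem_union, mem_supp, mem_supp]
  by_contra! h
  exact hj (by rw [h.1, h.2, add_zero])

lemma suppCard_neg (b : Fin d → ℝ) : suppCard grp (-b) = suppCard grp b := by
  unfold suppCard supp
  congr 1
  ext j
  have : sub grp (-b) j = -sub grp b j := rfl
  simp [this]

lemma suppCard_le (b : Fin d → ℝ) : suppCard grp b ≤ p :=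
  (supp grp b).card_le_univ.trans_eq (Fintype.card_fin p)

lemma suppCard_eq_zero {b : Fin d → ℝ} : suppCard grp b = 0 ↔ b = 0 := by
  unfold suppCard
  rw [Finset.card_eq_zero, Finset.eq_empty_iff_forall_notMem]
  simp only [mem_supp, not_not]
  constructor
  · intro h
    ext k
    exact congrFun (h (grp k)) ⟨k, rfl⟩
  · rintro rfl j
    rfl

lemma l2_le_l21 (b : Fin d → ℝ) : l2 b ≤ l21 grp b := by
  refine le_of_sq_le_sq ?_ (l21_nonneg grp b)
  rw [← sum_sq_groups grp]
  exact Finset.sum_sq_le_sq_sum_of_nonneg fun j _ => l2_nonneg _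

lemma l21_pos {b : Fin d → ℝ} (hb : b ≠ 0) : 0 < l21 grp b :=
  ((l2_nonneg b).lt_of_ne' (by rwa [Ne, l2_eq_zero])).trans_le (l2_le_l21 grp b)

/-! ### Column blocks and the norm `‖A‖_*` -/

section StarNorm

variable {ρ : Type*} [Fintype ρ] (A : Matrix ρ (Fin d) ℝ)

lemma spNorm_le_starNorm (j : Fin p) :
    spNorm (A.submatrix id (Subtype.val : Group grp j → Fin d)) ≤ starNorm grp A :=
  le_ciSup (f := fun j : Fin p => spNorm (A.submatrix id (Subtype.val : Group grp j → Fin d)))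
    (Set.finite_range _).bddAbove j

lemma starNorm_nonneg : 0 ≤ starNorm grp A := Real.iSup_nonneg fun _ => spNorm_nonneg _

omit [Fintype ρ] in
lemma mulVec_eq_sum_groups (b : Fin d → ℝ) :
    A.mulVec b =
      ∑ j, (A.submatrix id (Subtype.val : Group grp j → Fin d)).mulVec (sub grp b j) := by
  ext r
  rw [Finset.sum_apply]
  exact (sum_groups grp fun k => A r k * b k).symm

lemma l2_mulVec_sub_le (b : Fin d → ℝ) (j : Fin p) :
    l2 ((A.submatrix id (Subtype.val : Group grp j → Fin d)).mulVec (sub grp b j)) ≤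
      starNorm grp A * l2 (sub grp b j) :=
  (l2_mulVec_le _ _).trans
    (mul_le_mul_of_nonneg_right (spNorm_le_starNorm grp A j) (l2_nonneg _))

lemma l2_mulVec_le_l21 (b : Fin d → ℝ) : l2 (A.mulVec b) ≤ starNorm grp A * l21 grp b := by
  rw [mulVec_eq_sum_groups grp, l21, l21On, Finset.mul_sum]
  exact (l2_sum_le _ _).trans (Finset.sum_le_sum fun j _ => l2_mulVec_sub_le grp A b j)

lemma starNorm_pos {A : Matrix ρ (Fin d) ℝ} (hA : A ≠ 0) : 0 < starNorm grp A := by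
  refine (starNorm_nonneg grp A).lt_of_ne' fun h => hA ?_
  ext r k
  have h1 := l2_mulVec_le_l21 grp A (Pi.single k 1)
  rw [h, zero_mul] at h1
  have h2 := l2_eq_zero.1 (h1.antisymm (l2_nonneg _))
  simpa using congrFun h2 r

end StarNorm

end GroupNorms

/-! ### The likelihood ratio -/

section Likelihood

variable {n q d : ℕ} (X : Matrix (Fin n × Fin q) (Fin d) ℝ) (β₀ : Fin d → ℝ)

lemma linPred_add (a b : Fin d → ℝ) (i : Fin n) (c : Fin (q + 1)) :
    linPred X (a + b) i c = linPred X a i c + linPred X b i c := by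
  refine Fin.cases ?_ (fun ℓ => ?_) c <;> simp [linPred, Matrix.mulVec_add]

lemma linPred_smul (t : ℝ) (b : Fin d → ℝ) (i : Fin n) (c : Fin (q + 1)) :
    linPred X (t • b) i c = t * linPred X b i c := by
  refine Fin.cases ?_ (fun ℓ => ?_) c <;> simp [linPred, Matrix.mulVec_smul]

/-- The linear predictors in the direction `b`, centred at their means under `β₀`. -/
def centred (b : Fin d → ℝ) (i : Fin n) (c : Fin (q + 1)) : ℝ :=
  linPred X b i c - ∑ c', catProb X β₀ i c' * linPred X b i c'

/-- The directional derivative at `β₀` of the log-likelihood. -/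
def score (z : Fin n → Fin (q + 1)) (b : Fin d → ℝ) : ℝ := ∑ i, centred X β₀ b i (z i)

/-- The remainder of the first-order expansion of minus the log-likelihood at `β₀`; it does not
depend on the responses. -/
def excess (b : Fin d → ℝ) : ℝ :=
  ∑ i, Real.log (∑ c, catProb X β₀ i c * Real.exp (centred X β₀ b i c))

/-- The gradient at `β₀` of the log-likelihood. -/
def scoreVec (z : Fin n → Fin (q + 1)) (k : Fin d) : ℝ := score X β₀ z (Pi.single k 1)

lemma catProb_nonneg (i : Fin n) (c : Fin (q + 1)) : 0 ≤ catProb X β₀ i c :=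
  (catProb_pos X β₀ i c).le

lemma centred_add (a b : Fin d → ℝ) (i : Fin n) (c : Fin (q + 1)) :
    centred X β₀ (a + b) i c = centred X β₀ a i c + centred X β₀ b i c := by
  simp only [centred, linPred_add, mul_add, Finset.sum_add_distrib]
  ring

lemma centred_smul (t : ℝ) (b : Fin d → ℝ) (i : Fin n) (c : Fin (q + 1)) :
    centred X β₀ (t • b) i c = t * centred X β₀ b i c := by
  simp only [centred, linPred_smul, mul_sub, Finset.mul_sum]
  congr 1
  exact Finset.sum_congr rfl fun _ _ => by ring

lemma sum_catProb_mul_centred (b : Fin d → ℝ) (i : Fin n) :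
    ∑ c, catProb X β₀ i c * centred X β₀ b i c = 0 := by
  simp only [centred, mul_sub, Finset.sum_sub_distrib, ← Finset.sum_mul, sum_catProb, one_mul,
    sub_self]

lemma score_add (z : Fin n → Fin (q + 1)) (a b : Fin d → ℝ) :
    score X β₀ z (a + b) = score X β₀ z a + score X β₀ z b := by
  simp only [score, centred_add, Finset.sum_add_distrib]

lemma score_smul (z : Fin n → Fin (q + 1)) (t : ℝ) (b : Fin d → ℝ) :
    score X β₀ z (t • b) = t * score X β₀ z b := by
  simp only [score, centred_smul, Finset.mul_sum]

lemma score_eq_sum (z : Fin n → Fin (q + 1)) (b : Fin d → ℝ) :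
    score X β₀ z b = ∑ k, scoreVec X β₀ z k * b k := by
  let φ : (Fin d → ℝ) →ₗ[ℝ] ℝ :=
    { toFun := score X β₀ z
      map_add' := score_add X β₀ z
      map_smul' := fun t b => by simp [score_smul] }
  have := LinearMap.pi_apply_eq_sum_univ φ b
  have h2 : ∀ k : Fin d, (fun j => if k = j then (1 : ℝ) else 0) = Pi.single k 1 := fun k => by
    ext j; simp [Pi.single_apply, eq_comm]
  simp only [h2, smul_eq_mul] at this
  calc score X β₀ z b = φ b := rfl
    _ = _ := by rw [this]; exact Finset.sum_congr rfl fun k _ => mul_comm _ _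

/-- The ratio of the normalizing sums of an observation is the moment generating function of its
linear predictor under β₀; centring the predictor in both terms changes nothing in the difference.
-/
lemma density_eq_mul_exp (β : Fin d → ℝ) (z : Fin n → Fin (q + 1)) :
    density X β z =
      density X β₀ z * Real.exp (score X β₀ z (β - β₀) - excess X β₀ (β - β₀)) := by
  unfold density score excess
  rw [← Finset.sum_sub_distrib, Real.exp_sum, ← Finset.prod_mul_distrib]
  refine Finset.prod_congr rfl fun i _ => ?_
  have hlin : ∀ c, linPred X β i c = linPred X β₀ i c + linPred X (β - β₀) i c := fun c => by
    rw [← linPred_add]; congr 1; abel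
  set m := ∑ c', catProb X β₀ i c' * linPred X (β - β₀) i c' with hm
  have hpos := sum_mul_exp_pos (catProb_nonneg X β₀ i) (sum_catProb X β₀ i)
    (centred X β₀ (β - β₀) i)
  rw [Real.exp_sub, Real.exp_log hpos]
  have hZ : (0 : ℝ) < ∑ c', Real.exp (linPred X β₀ i c') :=
    Finset.sum_pos (fun _ _ => Real.exp_pos _) ⟨0, Finset.mem_univ _⟩
  have hsum : ∑ c, catProb X β₀ i c * Real.exp (centred X β₀ (β - β₀) i c) =
      (∑ c, Real.exp (linPred X β i c)) / (∑ c', Real.exp (linPred X β₀ i c')) *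
        Real.exp (-m) := by
    rw [Finset.sum_div, Finset.sum_mul]
    refine Finset.sum_congr rfl fun c _ => ?_
    rw [centred, ← hm, sub_eq_add_neg, Real.exp_add, hlin, Real.exp_add, catProb]
    ring
  have hZ2 : (0 : ℝ) < ∑ c', Real.exp (linPred X β i c') :=
    Finset.sum_pos (fun _ _ => Real.exp_pos _) ⟨0, Finset.mem_univ _⟩
  rw [hsum, centred, ← hm, sub_eq_add_neg (linPred X (β - β₀) i (z i)), Real.exp_add]
  unfold catProb
  rw [hlin (z i), Real.exp_add]
  have := Real.exp_pos (-m)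
  field_simp

lemma sum_density_mul_prod (g : Fin n → Fin (q + 1) → ℝ) :
    ∑ z, density X β₀ z * ∏ i, g i (z i) = ∏ i, ∑ c, catProb X β₀ i c * g i c :=
  sum_prod_mul_prod _ g

lemma sum_density_mul_apply (i : Fin n) (h : Fin (q + 1) → ℝ) :
    ∑ z, density X β₀ z * h (z i) = ∑ c, catProb X β₀ i c * h c :=
  sum_prod_mul_apply (sum_catProb X β₀) i h

lemma sum_density_mul_sq (a : Fin n → Fin (q + 1) → ℝ)
    (ha : ∀ i, ∑ c, catProb X β₀ i c * a i c = 0) :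
    ∑ z, density X β₀ z * (∑ i, a i (z i)) ^ 2 = ∑ i, ∑ c, catProb X β₀ i c * a i c ^ 2 :=
  sum_prod_mul_sq (sum_catProb X β₀) a ha

/-- By independence the excess is the logarithmic moment generating function of the score, so upper
bounds for the excess are sub-Gaussian bounds for the score. -/
lemma sum_density_mul_exp_score (b : Fin d → ℝ) :
    ∑ z, density X β₀ z * Real.exp (score X β₀ z b) = Real.exp (excess X β₀ b) := by
  simp_rw [score, Real.exp_sum]
  rw [sum_density_mul_prod X β₀ fun i c => Real.exp (centred X β₀ b i c), excess, Real.exp_sum]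
  exact Finset.prod_congr rfl fun i _ => (Real.exp_log
    (sum_mul_exp_pos (catProb_nonneg X β₀ i) (sum_catProb X β₀ i) _)).symm

lemma abs_linPred_le (b : Fin d → ℝ) (i : Fin n) (c : Fin (q + 1)) :
    |linPred X b i c| ≤ l2 ((block X i).mulVec b) := by
  refine Fin.cases ?_ (fun ℓ => ?_) c
  · simpa [linPred] using l2_nonneg _
  · exact abs_apply_le_l2 ((block X i).mulVec b) ℓ

lemma sum_sq_block (b : Fin d → ℝ) :
    ∑ i, l2 ((block X i).mulVec b) ^ 2 = l2 (X.mulVec b) ^ 2 := by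
  simp_rw [l2_sq]
  rw [Fintype.sum_prod_type]
  rfl

lemma excess_nonneg (b : Fin d → ℝ) : 0 ≤ excess X β₀ b :=
  Finset.sum_nonneg fun i _ => cumulant_nonneg (catProb_nonneg X β₀ i) (sum_catProb X β₀ i)
    (sum_catProb_mul_centred X β₀ b i)

/-- Hoeffding's lemma for each observation: its predictors, including the 0 of the reference
category, lie within ±‖X_i b‖₂. -/
lemma excess_le (b : Fin d → ℝ) : excess X β₀ b ≤ l2 (X.mulVec b) ^ 2 / 2 := by
  rw [← sum_sq_block, Finset.sum_div]
  refine Finset.sum_le_sum fun i _ => ?_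
  rw [Real.log_le_iff_le_exp
    (sum_mul_exp_pos (catProb_nonneg X β₀ i) (sum_catProb X β₀ i) _)]
  exact sum_mul_exp_sub_mean_le (catProb_nonneg X β₀ i) (sum_catProb X β₀ i)
    (abs_linPred_le X b i)

lemma excess_smul_le {t : ℝ} (ht0 : 0 < t) (ht1 : t ≤ 1) (b : Fin d → ℝ) :
    excess X β₀ (t • b) ≤ t * excess X β₀ b := by
  unfold excess
  rw [Finset.mul_sum]
  refine Finset.sum_le_sum fun i _ => ?_
  simp_rw [centred_smul]
  exact cumulant_smul_le (catProb_nonneg X β₀ i) (sum_catProb X β₀ i) ht0 ht1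

lemma abs_centred_le {r : ℝ} {b : Fin d → ℝ} {i : Fin n} (h : ∀ c, |linPred X b i c| ≤ r)
    (c : Fin (q + 1)) : |centred X β₀ b i c| ≤ 2 * r := by
  have h2 : |∑ c', catProb X β₀ i c' * linPred X b i c'| ≤ r := by
    calc _ ≤ ∑ c', |catProb X β₀ i c' * linPred X b i c'| := Finset.abs_sum_le_sum_abs _ _
      _ ≤ ∑ c', catProb X β₀ i c' * r := Finset.sum_le_sum fun c' _ => by
          rw [abs_mul, abs_of_nonneg (catProb_nonneg X β₀ i c')]
          exact mul_le_mul_of_nonneg_left (h c') (catProb_nonneg X β₀ i c')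
      _ = r := by rw [← Finset.sum_mul, sum_catProb, one_mul]
  rw [centred, two_mul]
  exact (abs_sub _ _).trans (add_le_add (h c) h2)

lemma sum_resp_mul (b : Fin d → ℝ) (z : Fin n → Fin (q + 1)) :
    ∑ r, resp z r * X.mulVec b r = ∑ i, linPred X b i (z i) := by
  rw [Fintype.sum_prod_type]
  refine Finset.sum_congr rfl fun i _ => ?_
  simp only [resp, ite_mul, one_mul, zero_mul]
  refine Fin.cases (motive := fun c => (∑ ℓ : Fin q, if c = ℓ.succ then X.mulVec b (i, ℓ) else 0)
    = linPred X b i c) ?_ (fun ℓ => ?_) (z i)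
  · simp [linPred, (Fin.succ_ne_zero _).symm]
  · simp [linPred]

lemma score_eq_sum_resp (b : Fin d → ℝ) (z : Fin n → Fin (q + 1)) :
    score X β₀ z b = ∑ r, (resp z r - meanVec X β₀ r) * X.mulVec b r := by
  simp_rw [sub_mul, Finset.sum_sub_distrib]
  have h : ∑ r, meanVec X β₀ r * X.mulVec b r =
      ∑ i, ∑ c', catProb X β₀ i c' * linPred X b i c' := by
    simp_rw [meanVec, Finset.sum_mul]
    rw [Finset.sum_comm]
    simp_rw [mul_assoc, ← Finset.mul_sum, sum_resp_mul]
    simp_rw [Finset.mul_sum]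
    rw [Finset.sum_comm]
    exact Finset.sum_congr rfl fun i _ => sum_density_mul_apply X β₀ i (linPred X b i)
  rw [h, sum_resp_mul, score, ← Finset.sum_sub_distrib]
  rfl

open scoped MatrixOrder in
lemma predNorm_sq_eq_quadratic (b : Fin d → ℝ) :
    predNorm X β₀ b ^ 2 = X.mulVec b ⬝ᵥ (covMat X β₀).mulVec (X.mulVec b) := by
  have hW : 0 ≤ covMat X β₀ := (covMat_posSemidef X β₀).nonneg
  have hs : (CFC.sqrt (covMat X β₀)).IsHermitian :=
    (Matrix.nonneg_iff_posSemidef.1 (CFC.sqrt_nonneg (covMat X β₀))).isHermitian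
  have hsT : (CFC.sqrt (covMat X β₀)).transpose = CFC.sqrt (covMat X β₀) := by
    simpa [Matrix.IsHermitian, Matrix.conjTranspose_eq_transpose_of_trivial] using hs
  set R := CFC.sqrt (covMat X β₀) with hR
  have hRR : R * R = covMat X β₀ := CFC.sqrt_mul_sqrt_self _ hW
  rw [predNorm, l2_sq, ← hR, ← hRR, ← Matrix.mulVec_mulVec, Matrix.dotProduct_mulVec,
    ← Matrix.mulVec_transpose, hsT]
  exact Finset.sum_congr rfl fun r _ => sq _

/-- Both sides are the variance of the score in direction b: the left in terms of the covariance of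
Y, the right as a sum of the variances of independent terms. -/
lemma predNorm_sq (b : Fin d → ℝ) :
    predNorm X β₀ b ^ 2 = ∑ i, ∑ c, catProb X β₀ i c * centred X β₀ b i c ^ 2 := by
  rw [predNorm_sq_eq_quadratic,
    ← sum_density_mul_sq X β₀ _ (sum_catProb_mul_centred X β₀ b)]
  have h : ∀ z, (∑ i, centred X β₀ b i (z i)) ^ 2 =
      ∑ r, ∑ r', (resp z r - meanVec X β₀ r) * (resp z r' - meanVec X β₀ r') *
        (X.mulVec b r * X.mulVec b r') := fun z => by
    change score X β₀ z b ^ 2 = _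
    rw [score_eq_sum_resp, sq, Finset.sum_mul_sum]
    exact Finset.sum_congr rfl fun r _ => Finset.sum_congr rfl fun r' _ => by ring
  have hW : ∀ v : Fin n × Fin q → ℝ, v ⬝ᵥ (covMat X β₀).mulVec v = ∑ r, ∑ r', ∑ z,
      density X β₀ z * ((resp z r - meanVec X β₀ r) * (resp z r' - meanVec X β₀ r') *
        (v r * v r')) := fun v => by
    refine Finset.sum_congr rfl fun r _ => ?_
    rw [Matrix.mulVec, dotProduct, Finset.mul_sum]
    refine Finset.sum_congr rfl fun r' _ => ?_
    rw [covMat, Matrix.of_apply, Finset.sum_mul, Finset.mul_sum]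
    exact Finset.sum_congr rfl fun z _ => by ring
  simp_rw [hW, h, Finset.mul_sum]
  symm
  rw [Finset.sum_comm]
  exact Finset.sum_congr rfl fun r _ => Finset.sum_comm

lemma predNorm_nonneg (b : Fin d → ℝ) : 0 ≤ predNorm X β₀ b := l2_nonneg _

lemma predNorm_le (b : Fin d → ℝ) : predNorm X β₀ b ≤ l2 (X.mulVec b) := by
  refine le_of_sq_le_sq ?_ (l2_nonneg _)
  rw [predNorm_sq, ← sum_sq_block]
  refine Finset.sum_le_sum fun i _ => ?_
  set m := ∑ c', catProb X β₀ i c' * linPred X b i c' with hm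
  calc ∑ c, catProb X β₀ i c * centred X β₀ b i c ^ 2
      = ∑ c, catProb X β₀ i c * linPred X b i c ^ 2 - m ^ 2 := by
        have : ∀ c, catProb X β₀ i c * centred X β₀ b i c ^ 2 =
            catProb X β₀ i c * linPred X b i c ^ 2
              - 2 * m * (catProb X β₀ i c * linPred X b i c) + m ^ 2 * catProb X β₀ i c :=
          fun c => by rw [centred]; ring
        simp_rw [this, Finset.sum_add_distrib, Finset.sum_sub_distrib, ← Finset.mul_sum,
          sum_catProb, ← hm]
        ring
    _ ≤ ∑ c, catProb X β₀ i c * linPred X b i c ^ 2 := by linarith [sq_nonneg m]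
    _ ≤ ∑ c, catProb X β₀ i c * l2 ((block X i).mulVec b) ^ 2 :=
        Finset.sum_le_sum fun c _ => mul_le_mul_of_nonneg_left
          (sq_le_sq.2 ((abs_linPred_le X b i c).trans (le_abs_self _))) (catProb_nonneg X β₀ i c)
    _ = l2 ((block X i).mulVec b) ^ 2 := by rw [← Finset.sum_mul, sum_catProb, one_mul]

lemma predNorm_smul (t : ℝ) (b : Fin d → ℝ) :
    predNorm X β₀ (t • b) = |t| * predNorm X β₀ b := by
  unfold predNorm
  rw [Matrix.mulVec_smul, Matrix.mulVec_smul, l2_smul]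

lemma continuous_predNorm : Continuous (predNorm X β₀) :=
  continuous_l2.comp
    ((Continuous.matrix_mulVec continuous_const (Continuous.matrix_mulVec continuous_const
      continuous_id)))

lemma excess_ge_of_small {ρ : ℝ} (hρ : ρ ≤ 1) {b : Fin d → ℝ}
    (h : ∀ i, 2 * l2 ((block X i).mulVec b) ≤ ρ) :
    (1 - ρ) / 2 * predNorm X β₀ b ^ 2 ≤ excess X β₀ b := by
  rw [predNorm_sq, excess, Finset.mul_sum]
  exact Finset.sum_le_sum fun i _ => cumulant_ge (catProb_nonneg X β₀ i) (sum_catProb X β₀ i)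
    (sum_catProb_mul_centred X β₀ b i) hρ fun c =>
      (abs_centred_le X β₀ (abs_linPred_le X b i) c).trans (h i)

/-- The largest block norm `max_i ‖X_i‖_*`. -/
def blockNorm {p : ℕ} (grp : Fin d → Fin p) : ℝ := ⨆ i : Fin n, starNorm grp (block X i)

variable {p : ℕ} (grp : Fin d → Fin p)

lemma blockNorm_nonneg : 0 ≤ blockNorm X grp := Real.iSup_nonneg fun _ => starNorm_nonneg grp _

lemma l2_block_le (b : Fin d → ℝ) (i : Fin n) :
    l2 ((block X i).mulVec b) ≤ blockNorm X grp * l21 grp b :=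
  (l2_mulVec_le_l21 grp _ b).trans (mul_le_mul_of_nonneg_right
    (le_ciSup (f := fun i : Fin n => starNorm grp (block X i)) (Set.finite_range _).bddAbove i)
    (l21_nonneg grp b))

lemma blockNorm_pos {X : Matrix (Fin n × Fin q) (Fin d) ℝ} (hX : X ≠ 0) :
    0 < blockNorm X grp := by
  refine (blockNorm_nonneg X grp).lt_of_ne' fun h => hX ?_
  ext ⟨i, ℓ⟩ k
  have h1 := l2_block_le X grp (Pi.single k 1) i
  rw [h, zero_mul] at h1
  have h2 := l2_eq_zero.1 (h1.antisymm (l2_nonneg _))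
  simpa [block] using congrFun h2 ℓ

/-- `excess_ge_of_small` with ρ = 1/100, so 0.495 = (1 - ρ)/2. The factor 2 in the hypothesis comes
from centring, which can double the bound on the predictors. -/
lemma excess_ge_quadratic {b : Fin d → ℝ} (h : 2 * (blockNorm X grp * l21 grp b) ≤ 1 / 100) :
    0.495 * predNorm X β₀ b ^ 2 ≤ excess X β₀ b := by
  have := excess_ge_of_small X β₀ (ρ := 1 / 100) (by norm_num)
    fun i => (mul_le_mul_of_nonneg_left (l2_block_le X grp b i) zero_le_two).trans h
  norm_num at this ⊢
  exact this

/-- Far from the truth the remainder grows at least linearly, by convexity. -/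
lemma excess_ge_linear {b : Fin d → ℝ} (h : 1 / 100 < 2 * (blockNorm X grp * l21 grp b)) :
    0.002475 * predNorm X β₀ b ^ 2 ≤ blockNorm X grp * l21 grp b * excess X β₀ b := by
  set a := blockNorm X grp * l21 grp b with ha
  have ha0 : 0 < a := by linarith
  -- This t scales b back to the boundary of the quadratic range, 2ta = 1/100. There 0.495 t²P² is
  -- at most the excess of tb, hence at most t times the excess of b; and 0.495/200 = 0.002475.
  set t := 1 / (200 * a) with ht
  have ht0 : 0 < t := by positivity
  have ht1 : t ≤ 1 := by rw [ht, div_le_one (by positivity)]; linarith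
  have hta : t * a = 1 / 200 := by rw [ht]; field_simp
  have h1 := excess_ge_quadratic X β₀ grp (b := t • b) (by
    have : l21 grp (t • b) = t * l21 grp b := by
      have := l21On_smul grp Finset.univ t b
      rwa [abs_of_pos ht0] at this
    rw [this, show blockNorm X grp * (t * l21 grp b) = t * a by rw [ha]; ring, hta]
    norm_num)
  have h2 := h1.trans (excess_smul_le X β₀ ht0 ht1 b)
  rw [predNorm_smul, abs_of_pos ht0] at h2
  have h3 : 0.495 * t * predNorm X β₀ b ^ 2 ≤ excess X β₀ b := by
    refine le_of_mul_le_mul_left ?_ ht0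
    calc _ = 0.495 * (t * predNorm X β₀ b) ^ 2 := by ring
      _ ≤ _ := h2
  calc _ = a * (0.495 * t * predNorm X β₀ b ^ 2) := by
        rw [show a * (0.495 * t * predNorm X β₀ b ^ 2) = 0.495 * (t * a) * predNorm X β₀ b ^ 2 by
          ring, hta]
        norm_num
    _ ≤ _ := mul_le_mul_of_nonneg_left h3 ha0.le

lemma score_le_of_scoreVec_le {z : Fin n → Fin (q + 1)} {t : ℝ}
    (h : ∀ j, l2 (sub grp (scoreVec X β₀ z) j) ≤ t) (b : Fin d → ℝ) :
    score X β₀ z b ≤ t * l21 grp b := by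
  rw [score_eq_sum, ← sum_groups grp, l21, l21On, Finset.mul_sum]
  exact Finset.sum_le_sum fun j _ =>
    (sum_mul_le_l2 (sub grp (scoreVec X β₀ z) j) (sub grp b j)).trans
      (mul_le_mul_of_nonneg_right (h j) (l2_nonneg _))

end Likelihood

/-! ### Prior integrals over groups and the numerator of the posterior -/

section PriorIntegrals

variable {n q d p : ℕ} (grp : Fin d → Fin p) (X : Matrix (Fin n × Fin q) (Fin d) ℝ)
  (β₀ : Fin d → ℝ) (π : ℕ → ℝ)

/-! ### Integration over groups -/

/-- The coordinates in the groups of `S`, sorted by groups. -/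
def sigmaGroupEquiv (S : Finset (Fin p)) :
    (Σ j : S, Group grp j.1) ≃ {k : Fin d // grp k ∈ S} where
  toFun x := ⟨x.2.1, by rw [x.2.2]; exact x.1.2⟩
  invFun k := ⟨⟨grp k.1, k.2⟩, ⟨k.1, rfl⟩⟩
  left_inv := by
    rintro ⟨⟨j, hj⟩, ⟨k, hk⟩⟩
    have hk' : grp k = j := hk
    subst hk'
    rfl
  right_inv _ := rfl

/-- The vector with given subvectors. -/
def assemble (S : Finset (Fin p)) (x : ∀ j : S, Group grp j.1 → ℝ) :
    {k : Fin d // grp k ∈ S} → ℝ :=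
  fun k => x ⟨grp k.1, k.2⟩ ⟨k.1, rfl⟩

/-- Regrouping the coordinates identifies Lebesgue measure on ℝ^{d_S} with the product of Lebesgue
measures over the groups, so integrals of products over groups factorize. -/
lemma measurePreserving_assemble (S : Finset (Fin p)) :
    MeasurePreserving (assemble grp S) volume volume := by
  have hm : Measurable (assemble grp S) := measurable_pi_lambda _ fun k =>
    (measurable_pi_apply (⟨k.1, rfl⟩ : Group grp (grp k.1))).comp
      (measurable_pi_apply (⟨grp k.1, k.2⟩ : S))
  refine ⟨hm, ?_⟩
  rw [volume_pi (ι := {k : Fin d // grp k ∈ S})]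
  refine (Measure.pi_eq fun s hs => ?_).symm
  rw [Measure.map_apply hm (MeasurableSet.univ_pi hs)]
  have hpre : assemble grp S ⁻¹' Set.univ.pi s =
      Set.univ.pi fun j : S => Set.univ.pi fun k : Group grp j.1 =>
        s (sigmaGroupEquiv grp S ⟨j, k⟩) := by
    ext x
    simp only [Set.mem_preimage, Set.mem_univ_pi, assemble]
    constructor
    · rintro h ⟨j, hj⟩ ⟨k, hk⟩
      have hk' : grp k = j := hk
      subst hk'
      exact h ⟨k, hj⟩
    · intro h k
      exact h ⟨grp k.1, k.2⟩ ⟨k.1, rfl⟩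
  rw [hpre, volume_pi_pi]
  simp_rw [volume_pi_pi]
  rw [← Fintype.prod_sigma' (f := fun (j : S) (k : Group grp j.1) =>
    volume (s (sigmaGroupEquiv grp S ⟨j, k⟩)))]
  exact Fintype.prod_equiv (sigmaGroupEquiv grp S) _ _ fun _ => rfl

lemma sub_embed_assemble (S : Finset (Fin p)) (x : ∀ j : S, Group grp j.1 → ℝ) (j : S) :
    sub grp (embed grp S (assemble grp S x)) j.1 = x j := by
  obtain ⟨j, hj⟩ := j
  ext ⟨k, hk⟩
  have hk' : grp k = j := hk
  subst hk'
  simp [sub, embed, hj, assemble]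

lemma measurable_sub (j : Fin p) : Measurable fun b : Fin d → ℝ => sub grp b j :=
  measurable_pi_lambda _ fun k => measurable_pi_apply k.1

lemma lintegral_prod_groups (S : Finset (Fin p)) (F : ∀ j : Fin p, (Group grp j → ℝ) → ℝ)
    (h0 : ∀ j x, 0 ≤ F j x) (hm : ∀ j, Measurable (F j)) (hi : ∀ j, Integrable (F j)) :
    ∫⁻ b : {k : Fin d // grp k ∈ S} → ℝ,
        ENNReal.ofReal (∏ j ∈ S, F j (sub grp (embed grp S b) j)) =
      ENNReal.ofReal (∏ j ∈ S, ∫ x, F j x) := by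
  have hmeas : Measurable fun b : {k : Fin d // grp k ∈ S} → ℝ =>
      ENNReal.ofReal (∏ j ∈ S, F j (sub grp (embed grp S b) j)) :=
    (Finset.measurable_prod S fun j _ =>
      (hm j).comp ((measurable_sub grp j).comp (measurable_embed grp S))).ennreal_ofReal
  rw [← (measurePreserving_assemble grp S).lintegral_comp hmeas]
  have h : ∀ x : ∀ j : S, Group grp j.1 → ℝ,
      ∏ j ∈ S, F j (sub grp (embed grp S (assemble grp S x)) j) = ∏ j : S, F j.1 (x j) :=
    fun x => by
      rw [← Finset.prod_coe_sort S]
      exact Finset.prod_congr rfl fun j _ => by rw [sub_embed_assemble]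
  simp_rw [h]
  have hint : Integrable fun x : ∀ j : S, Group grp j.1 → ℝ => ∏ j : S, F j.1 (x j) :=
    Integrable.fintype_prod_dep (f := fun (j : S) => F j.1) fun j => hi j.1
  rw [← ofReal_integral_eq_lintegral_ofReal hint
    (Eventually.of_forall fun x => Finset.prod_nonneg fun j _ => h0 _ _),
    integral_fintype_prod_volume_eq_prod (fun (j : S) => F j.1), ← Finset.prod_coe_sort S]

lemma slabDensity_eq_prod (S : Finset (Fin p)) (b : {k : Fin d // grp k ∈ S} → ℝ) :
    slabDensity grp X S b = ∏ j ∈ S, laplaceConst (lam grp X) (Fintype.card (Group grp j)) *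
      Real.exp (-lam grp X * l2 (sub grp (embed grp S b) j)) := by
  unfold slabDensity laplaceConst l21On dimOn
  rw [Finset.prod_mul_distrib, Finset.prod_mul_distrib, ← Real.exp_sum, ← Finset.mul_sum,
    Finset.prod_div_distrib, Finset.prod_mul_distrib, Finset.prod_const,
    Finset.prod_pow_eq_pow_sum]
  rfl

/-- Halving the rate of the Laplace law costs a factor 2 per coordinate; this is the origin of
2^{d_S} in the numerator bound. -/
lemma laplaceConst_eq_two_pow (κ : ℝ) (g : ℕ) :
    laplaceConst κ g = 2 ^ g * laplaceConst (κ / 2) g := by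
  unfold laplaceConst
  rw [← mul_assoc, ← mul_pow]
  congr 3
  ring

/-- The restriction of a vector to the coordinates in the groups of `S`. -/
def restr (S : Finset (Fin p)) (b : Fin d → ℝ) : {k : Fin d // grp k ∈ S} → ℝ := fun k => b k.1

lemma sub_embed_sub_restr {S : Finset (Fin p)} (b : {k : Fin d // grp k ∈ S} → ℝ)
    {j : Fin p} (hj : j ∈ S) :
    sub grp (embed grp S (b - restr grp S β₀)) j = sub grp (embed grp S b - β₀) j := by
  ext ⟨k, rfl⟩
  simp [sub, embed, hj, restr]

lemma embed_add_restr_supp (b : {k : Fin d // grp k ∈ supp grp β₀} → ℝ) :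
    embed grp (supp grp β₀) (b + restr grp (supp grp β₀) β₀) =
      embed grp (supp grp β₀) b + β₀ := by
  ext k
  by_cases hk : grp k ∈ supp grp β₀
  · simp [embed, hk, restr]
  · have : sub grp β₀ (grp k) = 0 := by
      by_contra h
      exact hk ((mem_supp grp).2 h)
    have h2 : β₀ k = 0 := congrFun this ⟨k, rfl⟩
    simp [embed, hk, h2]

lemma supp_embed_subset (S : Finset (Fin p)) (b : {k : Fin d // grp k ∈ S} → ℝ) :
    supp grp (embed grp S b) ⊆ S := by
  intro j hj
  rw [mem_supp] at hj
  by_contra h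
  refine hj ?_
  ext ⟨k, rfl⟩
  simp [sub, embed, h]

variable {grp}

/-- The factor e^{λ‖β‖} cancels the exponential of the slab. Dropping the groups outside S from ‖β -
β₀‖, what remains is a product of Laplace densities of rate λ/2 centred at the restriction of β₀ to
S, up to 2^{d_S}. -/
lemma lintegral_slab_mul_exp_le (hg : Function.Surjective grp) (hlam : 0 < lam grp X)
    (S : Finset (Fin p)) :
    ∫⁻ b : {k : Fin d // grp k ∈ S} → ℝ, ENNReal.ofReal (slabDensity grp X S b *
        Real.exp (lam grp X * l21 grp (embed grp S b) -
          lam grp X / 2 * l21 grp (embed grp S b - β₀))) ≤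
      ENNReal.ofReal (2 ^ dimOn grp S) := by
  have hne : ∀ j, Nonempty (Group grp j) := fun j => ⟨⟨(hg j).choose, (hg j).choose_spec⟩⟩
  set lm := lam grp X with hlm
  let F : ∀ j : Fin p, (Group grp j → ℝ) → ℝ := fun j x =>
    2 ^ Fintype.card (Group grp j) * (laplaceConst (lm / 2) (Fintype.card (Group grp j)) *
      Real.exp (-(lm / 2) * l2 x))
  have hF0 : ∀ j x, 0 ≤ F j x := fun j x => by
    have := laplaceConst_pos (half_pos hlam) (Fintype.card_pos (α := Group grp j))
    positivity
  have hFm : ∀ j, Measurable (F j) := fun j => by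
    have := measurable_l2 (ι := Group grp j)
    fun_prop
  have hFi : ∀ j, Integrable (F j) := fun j => (integrable_laplace (half_pos hlam)).const_mul _
  have hFv : ∀ j, ∫ x, F j x = 2 ^ Fintype.card (Group grp j) := fun j => by
    rw [integral_const_mul, integral_laplace (half_pos hlam), mul_one]
  calc _ ≤ ∫⁻ b : {k : Fin d // grp k ∈ S} → ℝ,
        ENNReal.ofReal (∏ j ∈ S, F j (sub grp (embed grp S (b - restr grp S β₀)) j)) := by
        refine lintegral_mono fun b => ENNReal.ofReal_le_ofReal ?_
        rw [slabDensity_eq_prod, Finset.prod_mul_distrib, ← Real.exp_sum, ← Finset.mul_sum,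
          mul_assoc, ← Real.exp_add]
        have h1 : l21 grp (embed grp S b) = ∑ j ∈ S, l2 (sub grp (embed grp S b) j) :=
          (l21On_eq_l21_of_supp_subset grp (supp_embed_subset grp S b)).symm
        have h2 : ∑ j ∈ S, l2 (sub grp (embed grp S b - β₀) j) ≤ l21 grp (embed grp S b - β₀) :=
          Finset.sum_le_sum_of_subset_of_nonneg (Finset.subset_univ _) fun _ _ _ => l2_nonneg _
        have h3 : ∏ j ∈ S, F j (sub grp (embed grp S (b - restr grp S β₀)) j) =
            (∏ j ∈ S, laplaceConst lm (Fintype.card (Group grp j))) *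
              Real.exp (-(lm / 2) * ∑ j ∈ S, l2 (sub grp (embed grp S b - β₀) j)) := by
          rw [Finset.mul_sum, Real.exp_sum, ← Finset.prod_mul_distrib]
          refine Finset.prod_congr rfl fun j hj => ?_
          rw [sub_embed_sub_restr grp β₀ b hj, laplaceConst_eq_two_pow lm]
          ring
        rw [h3, h1]
        refine mul_le_mul_of_nonneg_left (Real.exp_le_exp.2 ?_) (Finset.prod_nonneg fun j _ =>
          (laplaceConst_pos hlam Fintype.card_pos).le)
        have := mul_le_mul_of_nonneg_left h2 (half_pos hlam).le
        linarith
    _ = ∫⁻ b : {k : Fin d // grp k ∈ S} → ℝ,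
        ENNReal.ofReal (∏ j ∈ S, F j (sub grp (embed grp S b) j)) :=
        lintegral_sub_right_eq_self (fun b : {k : Fin d // grp k ∈ S} → ℝ =>
          ENNReal.ofReal (∏ j ∈ S, F j (sub grp (embed grp S b) j))) (restr grp S β₀)
    _ = ENNReal.ofReal (2 ^ dimOn grp S) := by
        rw [lintegral_prod_groups grp S F hF0 hFm hFi]
        simp_rw [hFv, Finset.prod_pow_eq_pow_sum]
        rfl
    _ ≤ _ := le_rfl

/-! ### Measurability -/

lemma continuous_linPred (i : Fin n) (c : Fin (q + 1)) :
    Continuous fun β : Fin d → ℝ => linPred X β i c := by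
  refine Fin.cases ?_ (fun ℓ => ?_) c
  · simpa [linPred] using continuous_const
  · simp only [linPred, Fin.cons_succ]
    exact (continuous_apply (i, ℓ)).comp (continuous_const.matrix_mulVec continuous_id)

lemma continuous_density (z : Fin n → Fin (q + 1)) :
    Continuous fun β : Fin d → ℝ => density X β z := by
  unfold density catProb
  refine continuous_finsetProd _ fun i _ => Continuous.div ?_ ?_ fun β =>
    (Finset.sum_pos (fun _ _ => Real.exp_pos _) ⟨0, Finset.mem_univ _⟩).ne'
  · exact Real.continuous_exp.comp (continuous_linPred X i _)
  · exact continuous_finsetSum _ fun c _ => Real.continuous_exp.comp (continuous_linPred X i c)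

lemma measurable_ofReal_density (z : Fin n → Fin (q + 1)) :
    Measurable fun β : Fin d → ℝ => ENNReal.ofReal (density X β z) :=
  (continuous_density X z).measurable.ennreal_ofReal

lemma measurable_l21On (S : Finset (Fin p)) : Measurable (l21On grp S) :=
  Finset.measurable_sum S fun j _ => measurable_l2.comp (measurable_sub grp j)

lemma measurable_slabDensity (S : Finset (Fin p)) : Measurable (slabDensity grp X S) := by
  unfold slabDensity
  have := (measurable_l21On (grp := grp) S).comp (measurable_embed grp S)
  simp only [Function.comp_def] at this
  fun_prop

lemma measurable_suppCard : Measurable (suppCard grp) := by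
  classical
  have : suppCard grp = fun b => ∑ j, if sub grp b j = 0 then 0 else 1 := by
    ext b
    rw [suppCard, supp, Finset.card_filter]
    refine Finset.sum_congr rfl fun j _ => ?_
    by_cases h : sub grp b j = 0 <;> simp [h]
  rw [this]
  refine Finset.measurable_sum _ fun j _ => Measurable.ite ?_ measurable_const measurable_const
  exact measurable_sub grp j (measurableSet_singleton (0 : Group grp j → ℝ))

lemma lintegral_prior {F : (Fin d → ℝ) → ℝ≥0∞} (hF : Measurable F) :
    ∫⁻ β, F β ∂(prior grp X π) =
      ∑ S : Finset (Fin p), ENNReal.ofReal (π S.card / (p.choose S.card : ℝ)) *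
        ∫⁻ b : {k : Fin d // grp k ∈ S} → ℝ,
          ENNReal.ofReal (slabDensity grp X S b) * F (embed grp S b) := by
  rw [prior, lintegral_finsetSum_measure]
  refine Finset.sum_congr rfl fun S _ => ?_
  rw [lintegral_smul_measure, lintegral_map hF (measurable_embed grp S),
    smul_eq_mul]
  exact congrArg _ (lintegral_withDensity_eq_lintegral_mul _
    (measurable_slabDensity X S).ennreal_ofReal (hF.comp (measurable_embed grp S)))

/-! ### Bounds for the numerator and the denominator of the posterior -/

lemma dimOn_le (S : Finset (Fin p)) : dimOn grp S ≤ S.card * gbar grp := by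
  rw [dimOn, ← smul_eq_mul]
  exact Finset.sum_le_card_nsmul _ _ _ fun j _ =>
    Finset.le_sup (f := gsize grp) (Finset.mem_univ j)

lemma slabDensity_nonneg (hg : Function.Surjective grp) (hlam : 0 < lam grp X)
    (S : Finset (Fin p)) (b : {k : Fin d // grp k ∈ S} → ℝ) : 0 ≤ slabDensity grp X S b := by
  rw [slabDensity_eq_prod]
  refine Finset.prod_nonneg fun j _ => mul_nonneg ?_ (Real.exp_pos _).le
  have : Nonempty (Group grp j) := ⟨⟨(hg j).choose, (hg j).choose_spec⟩⟩
  exact (laplaceConst_pos hlam Fintype.card_pos).le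

/-- The domination h is shaped so that the slab absorbs it uniformly in S; only the prior weights of
the sizes then remain, with 2^{ḡ} for each group. -/
lemma lintegral_density_le (hg : Function.Surjective grp) (hlam : 0 < lam grp X)
    (hπ : ∀ s ≤ p, 0 ≤ π s) (z : Fin n → Fin (q + 1)) {B : Set (Fin d → ℝ)}
    (hB : MeasurableSet B) {k : ℕ} (hk : ∀ β ∈ B, k ≤ suppCard grp β) {E : ℝ} (hE : 0 ≤ E)
    (h : ∀ β ∈ B, density X β z ≤
      E * Real.exp (lam grp X * l21 grp β - lam grp X / 2 * l21 grp (β - β₀))) :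
    ∫⁻ β in B, ENNReal.ofReal (density X β z) ∂(prior grp X π) ≤
      ENNReal.ofReal (E * ∑ s ∈ Finset.range (p + 1),
        if k ≤ s then π s * 2 ^ (s * gbar grp) else 0) := by
  classical
  rw [← lintegral_indicator hB, lintegral_prior X π ((measurable_ofReal_density X z).indicator hB)]
  have hterm : ∀ S : Finset (Fin p), ENNReal.ofReal (π S.card / (p.choose S.card : ℝ)) *
        ∫⁻ b : {k : Fin d // grp k ∈ S} → ℝ, ENNReal.ofReal (slabDensity grp X S b) *
          B.indicator (fun β => ENNReal.ofReal (density X β z)) (embed grp S b) ≤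
      ENNReal.ofReal (if k ≤ S.card then
        E * (π S.card * 2 ^ (S.card * gbar grp)) / (p.choose S.card : ℝ) else 0) := by
    intro S
    have hcard : S.card ≤ p := by simpa using S.card_le_univ
    have hch : (0 : ℝ) < p.choose S.card := by exact_mod_cast Nat.choose_pos hcard
    by_cases hkS : k ≤ S.card
    · rw [if_pos hkS]
      calc _ ≤ ENNReal.ofReal (π S.card / (p.choose S.card : ℝ)) *
            ∫⁻ b : {k : Fin d // grp k ∈ S} → ℝ, ENNReal.ofReal E *
              ENNReal.ofReal (slabDensity grp X S b *
                Real.exp (lam grp X * l21 grp (embed grp S b) -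
                  lam grp X / 2 * l21 grp (embed grp S b - β₀))) := by
            refine mul_le_mul' le_rfl (lintegral_mono fun b => ?_)
            by_cases hb : embed grp S b ∈ B
            · rw [Set.indicator_of_mem hb, ← ENNReal.ofReal_mul hE,
                ← ENNReal.ofReal_mul' (density_pos X _ z).le]
              refine ENNReal.ofReal_le_ofReal ?_
              calc _ ≤ _ := mul_le_mul_of_nonneg_left (h _ hb) (slabDensity_nonneg X hg hlam S b)
                _ = _ := by ring
            · rw [Set.indicator_of_notMem hb, mul_zero]
              exact zero_le
        _ ≤ ENNReal.ofReal (π S.card / (p.choose S.card : ℝ)) *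
            (ENNReal.ofReal E * ENNReal.ofReal (2 ^ dimOn grp S)) := by
            rw [lintegral_const_mul' _ _ ENNReal.ofReal_ne_top]
            gcongr
            exact lintegral_slab_mul_exp_le X β₀ hg hlam S
        _ ≤ _ := by
            rw [← ENNReal.ofReal_mul hE, ← ENNReal.ofReal_mul
              (div_nonneg (hπ _ hcard) hch.le)]
            refine ENNReal.ofReal_le_ofReal ?_
            have h2 : (2 : ℝ) ^ dimOn grp S ≤ 2 ^ (S.card * gbar grp) :=
              pow_le_pow_right₀ one_le_two (dimOn_le S)
            calc π S.card / (p.choose S.card : ℝ) * (E * 2 ^ dimOn grp S)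
                ≤ π S.card / (p.choose S.card : ℝ) * (E * 2 ^ (S.card * gbar grp)) :=
                  mul_le_mul_of_nonneg_left (mul_le_mul_of_nonneg_left h2 hE)
                    (div_nonneg (hπ _ hcard) hch.le)
              _ = _ := by ring
    -- A model with fewer than k groups contains no vector with k active groups, so it does not
    -- charge B.
    · have h0 : ∀ b : {k : Fin d // grp k ∈ S} → ℝ, ENNReal.ofReal (slabDensity grp X S b) *
          B.indicator (fun β => ENNReal.ofReal (density X β z)) (embed grp S b) = 0 := by
        intro b
        rw [Set.indicator_of_notMem, mul_zero]
        intro hb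
        exact hkS ((hk _ hb).trans (Finset.card_le_card (supp_embed_subset grp S b)))
      simp_rw [h0]
      simp
  refine (Finset.sum_le_sum fun S _ => hterm S).trans ?_
  have hnn : ∀ s ≤ p, 0 ≤ if k ≤ s then
      E * (π s * 2 ^ (s * gbar grp)) / (p.choose s : ℝ) else 0 := fun s hs => by
    have := hπ s hs
    split_ifs <;> positivity
  rw [← ENNReal.ofReal_sum_of_nonneg fun S _ => hnn _ (by simpa using S.card_le_univ)]
  refine ENNReal.ofReal_le_ofReal (le_of_eq ?_)
  -- The number of models of size s cancels the binomial coefficient in the prior.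
  have := Finset.sum_powerset_apply_card (fun s => if k ≤ s then
      E * (π s * 2 ^ (s * gbar grp)) / (p.choose s : ℝ) else 0) (x := (Finset.univ : Finset (Fin p)))
  rw [Finset.powerset_univ, Finset.card_univ, Fintype.card_fin] at this
  rw [this, Finset.mul_sum]
  refine Finset.sum_congr rfl fun s hs => ?_
  have hch : (0 : ℝ) < p.choose s := by
    exact_mod_cast Nat.choose_pos (Nat.lt_succ_iff.1 (Finset.mem_range.1 hs))
  split_ifs
  · rw [nsmul_eq_mul]
    field_simp
  · simp

end PriorIntegrals

/-! ### Lower bound for the evidence, the posterior, and control of the score -/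

section Denominator

variable {n q d p : ℕ} (grp : Fin d → Fin p) (X : Matrix (Fin n × Fin q) (Fin d) ℝ)
  (β₀ : Fin d → ℝ) (π : ℕ → ℝ)

/-! ### Random sign changes of the groups -/

/-- Multiply the `j`-th subvector by the sign `σ j`. -/
def signFlip (σ : Fin p → Bool) (b : Fin d → ℝ) : Fin d → ℝ := fun k => sgn (σ (grp k)) * b k

lemma sub_signFlip (σ : Fin p → Bool) (b : Fin d → ℝ) (j : Fin p) :
    sub grp (signFlip grp σ b) j = sgn (σ j) • sub grp b j := by
  ext ⟨k, hk⟩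
  have hk' : grp k = j := hk
  simp [sub, signFlip, hk']

lemma l2_sub_signFlip (σ : Fin p → Bool) (b : Fin d → ℝ) (j : Fin p) :
    l2 (sub grp (signFlip grp σ b) j) = l2 (sub grp b j) := by
  rw [sub_signFlip, l2_smul, abs_sgn, one_mul]

lemma mulVec_signFlip {ρ : Type*} (A : Matrix ρ (Fin d) ℝ) (σ : Fin p → Bool) (b : Fin d → ℝ) :
    A.mulVec (signFlip grp σ b) = ∑ j, sgn (σ j) •
      (A.submatrix id (Subtype.val : Group grp j → Fin d)).mulVec (sub grp b j) := by
  rw [mulVec_eq_sum_groups grp]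
  exact Finset.sum_congr rfl fun j _ => by rw [sub_signFlip, Matrix.mulVec_smul]

lemma score_signFlip (z : Fin n → Fin (q + 1)) (σ : Fin p → Bool) (b : Fin d → ℝ) :
    score X β₀ z (signFlip grp σ b) =
      ∑ j, sgn (σ j) * ∑ k : Group grp j, scoreVec X β₀ z k.1 * b k.1 := by
  rw [score_eq_sum, ← sum_groups grp]
  refine Finset.sum_congr rfl fun j _ => ?_
  rw [Finset.mul_sum]
  refine Finset.sum_congr rfl fun k _ => ?_
  rw [signFlip, k.2]
  ring

/-- Jensen's inequality over the signs: the linear score averages to 0, and the blocks of Xb become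
orthogonal on average. The bound is thus free of the data and additive over groups. -/
lemma le_sum_signs_exp (z : Fin n → Fin (q + 1)) (b : Fin d → ℝ) :
    Real.exp (-(starNorm grp X ^ 2 / 2) * ∑ j, l2 (sub grp b j) ^ 2) ≤
      ∑ σ : Fin p → Bool, (∏ _i : Fin p, (1 / 2 : ℝ)) *
        Real.exp (score X β₀ z (signFlip grp σ b) -
          l2 (X.mulVec (signFlip grp σ b)) ^ 2 / 2) := by
  have hJ := convexOn_exp.map_sum_le (t := (Finset.univ : Finset (Fin p → Bool)))
    (w := fun _ => ∏ _i : Fin p, (1 / 2 : ℝ))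
    (p := fun σ => score X β₀ z (signFlip grp σ b) -
      l2 (X.mulVec (signFlip grp σ b)) ^ 2 / 2)
    (fun _ _ => by positivity) sum_signs_one (fun _ _ => Set.mem_univ _)
  simp only [smul_eq_mul] at hJ
  refine le_trans (Real.exp_le_exp.2 ?_) hJ
  simp_rw [mul_sub, Finset.sum_sub_distrib, mulVec_signFlip, score_signFlip, ← mul_div_assoc]
  rw [sum_signs_linear, ← Finset.sum_div, sum_signs_l2_sq, zero_sub, neg_mul, neg_le_neg_iff,
    div_mul_eq_mul_div, Finset.mul_sum]
  refine div_le_div_of_nonneg_right (Finset.sum_le_sum fun j _ => ?_) zero_le_two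
  rw [← mul_pow]
  exact pow_le_pow_left₀ (l2_nonneg _) (l2_mulVec_sub_le grp X b j) 2

/-- Multiply the coordinates in the groups of `S` by the signs of their groups. -/
def signFlipOn (S : Finset (Fin p)) (σ : Fin p → Bool) (b : {k : Fin d // grp k ∈ S} → ℝ) :
    {k : Fin d // grp k ∈ S} → ℝ := fun k => sgn (σ (grp k.1)) * b k

lemma measurePreserving_signFlipOn (S : Finset (Fin p)) (σ : Fin p → Bool) :
    MeasurePreserving (signFlipOn grp S σ) volume volume := by
  refine volume_preserving_pi (f := fun (k : {k : Fin d // grp k ∈ S}) (t : ℝ) =>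
    sgn (σ (grp k.1)) * t) fun k => ?_
  cases σ (grp k.1)
  · simpa [sgn] using Measure.measurePreserving_neg (volume : Measure ℝ)
  · simp only [sgn, if_true, one_mul]
    exact MeasurePreserving.id volume

lemma embed_signFlipOn (S : Finset (Fin p)) (σ : Fin p → Bool)
    (b : {k : Fin d // grp k ∈ S} → ℝ) :
    embed grp S (signFlipOn grp S σ b) = signFlip grp σ (embed grp S b) := by
  ext k
  by_cases h : grp k ∈ S <;> simp [embed, signFlip, signFlipOn, h]

lemma slabDensity_signFlipOn (S : Finset (Fin p)) (σ : Fin p → Bool)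
    (b : {k : Fin d // grp k ∈ S} → ℝ) :
    slabDensity grp X S (signFlipOn grp S σ b) = slabDensity grp X S b := by
  simp_rw [slabDensity_eq_prod, embed_signFlipOn, l2_sub_signFlip]

variable {grp}

/-- The slab law is invariant under sign changes of the groups, so the integrand may be replaced by
its average over signs. The resulting lower bound factorizes over groups, and
`le_integral_laplace_gauss` treats each factor. -/
lemma le_lintegral_slab_mul_exp (hg : Function.Surjective grp) (hlam : 0 < lam grp X)
    (z : Fin n → Fin (q + 1)) (S : Finset (Fin p)) :
    ENNReal.ofReal (Real.exp (-∑ j ∈ S, starNorm grp X ^ 2 / 2 *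
        ((gsize grp j : ℝ) * (gsize grp j + 1) / lam grp X ^ 2))) ≤
      ∫⁻ b : {k : Fin d // grp k ∈ S} → ℝ, ENNReal.ofReal (slabDensity grp X S b *
        Real.exp (score X β₀ z (embed grp S b) - l2 (X.mulVec (embed grp S b)) ^ 2 / 2)) := by
  have hne : ∀ j, Nonempty (Group grp j) := fun j => ⟨⟨(hg j).choose, (hg j).choose_spec⟩⟩
  set G : ({k : Fin d // grp k ∈ S} → ℝ) → ℝ := fun b => slabDensity grp X S b *
    Real.exp (score X β₀ z (embed grp S b) - l2 (X.mulVec (embed grp S b)) ^ 2 / 2) with hG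
  have hGm : Measurable fun b => ENNReal.ofReal (G b) := by
    refine Measurable.ennreal_ofReal ((measurable_slabDensity X S).mul
      (Real.measurable_exp.comp (Measurable.sub ?_ ((Measurable.pow_const ?_ 2).div_const 2))))
    · simp_rw [score_eq_sum]
      exact Finset.measurable_sum _ fun k _ =>
        ((measurable_pi_apply k).comp (measurable_embed grp S)).const_mul _
    · exact measurable_l2.comp
        ((continuous_const.matrix_mulVec continuous_id).measurable.comp (measurable_embed grp S))
  set c : ℝ := ∏ _i : Fin p, (1 / 2 : ℝ) with hc
  have hc0 : 0 ≤ c := by positivity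
  set a := starNorm grp X ^ 2 / 2 with ha
  have ha0 : 0 ≤ a := by positivity
  let F : ∀ j : Fin p, (Group grp j → ℝ) → ℝ := fun j x =>
    laplaceConst (lam grp X) (Fintype.card (Group grp j)) * Real.exp (-lam grp X * l2 x) *
      Real.exp (-a * l2 x ^ 2)
  have hFm : ∀ j, Measurable (F j) := fun j => by
    have := measurable_l2 (ι := Group grp j)
    fun_prop
  have hF0 : ∀ j x, 0 ≤ F j x := fun j x => by
    have := laplaceConst_pos hlam (Fintype.card_pos (α := Group grp j))
    positivity
  have hpt : ∀ b : {k : Fin d // grp k ∈ S} → ℝ,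
      ∏ j ∈ S, F j (sub grp (embed grp S b) j) ≤ ∑ σ, c * G (signFlipOn grp S σ b) := fun b => by
    have h1 : ∏ j ∈ S, F j (sub grp (embed grp S b) j) =
        slabDensity grp X S b * Real.exp (-a * ∑ j, l2 (sub grp (embed grp S b) j) ^ 2) := by
      have h2 : ∑ j, l2 (sub grp (embed grp S b) j) ^ 2 =
          ∑ j ∈ S, l2 (sub grp (embed grp S b) j) ^ 2 := by
        refine (Finset.sum_subset (Finset.subset_univ S) fun j _ hj => ?_).symm
        have : sub grp (embed grp S b) j = 0 := by
          by_contra h'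
          exact hj (supp_embed_subset grp S b ((mem_supp grp).2 h'))
        rw [this, l2_zero, zero_pow two_ne_zero]
      rw [h2, slabDensity_eq_prod, Finset.mul_sum, Real.exp_sum, ← Finset.prod_mul_distrib]
    rw [h1]
    calc _ ≤ slabDensity grp X S b * ∑ σ : Fin p → Bool, c *
          Real.exp (score X β₀ z (signFlip grp σ (embed grp S b)) -
            l2 (X.mulVec (signFlip grp σ (embed grp S b))) ^ 2 / 2) :=
          mul_le_mul_of_nonneg_left (le_sum_signs_exp grp X β₀ z _)
            (slabDensity_nonneg X hg hlam S b)
      _ = _ := by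
          rw [Finset.mul_sum]
          refine Finset.sum_congr rfl fun σ _ => ?_
          rw [hG]
          simp only
          rw [slabDensity_signFlipOn, embed_signFlipOn]
          ring
  calc _ ≤ ENNReal.ofReal (∏ j ∈ S, ∫ x, F j x) := by
        refine ENNReal.ofReal_le_ofReal ?_
        rw [← Finset.sum_neg_distrib, Real.exp_sum]
        refine Finset.prod_le_prod (fun _ _ => (Real.exp_pos _).le) fun j _ => ?_
        have := le_integral_laplace_gauss (ι := Group grp j) hlam ha0
        rwa [neg_mul] at this
    _ = ∫⁻ b : {k : Fin d // grp k ∈ S} → ℝ,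
          ENNReal.ofReal (∏ j ∈ S, F j (sub grp (embed grp S b) j)) :=
        (lintegral_prod_groups grp S F hF0 hFm fun j => integrable_laplace_gauss hlam ha0).symm
    _ ≤ ∫⁻ b : {k : Fin d // grp k ∈ S} → ℝ,
          ∑ σ, ENNReal.ofReal c * ENNReal.ofReal (G (signFlipOn grp S σ b)) := by
        refine lintegral_mono fun b => (ENNReal.ofReal_le_ofReal (hpt b)).trans ?_
        have hG0 : ∀ b, 0 ≤ G b := fun b =>
          mul_nonneg (slabDensity_nonneg X hg hlam S b) (Real.exp_pos _).le
        rw [ENNReal.ofReal_sum_of_nonneg fun σ _ => mul_nonneg hc0 (hG0 _)]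
        simp_rw [ENNReal.ofReal_mul hc0]
        exact le_rfl
    _ = ∑ σ : Fin p → Bool, ENNReal.ofReal c *
          ∫⁻ b : {k : Fin d // grp k ∈ S} → ℝ, ENNReal.ofReal (G (signFlipOn grp S σ b)) := by
        have hm : ∀ σ : Fin p → Bool, Measurable fun b =>
            ENNReal.ofReal c * ENNReal.ofReal (G (signFlipOn grp S σ b)) := fun σ =>
          (hGm.comp (measurePreserving_signFlipOn grp S σ).measurable).const_mul _
        rw [lintegral_finsetSum _ fun σ _ => hm σ]
        exact Finset.sum_congr rfl fun σ _ => lintegral_const_mul' _ _ ENNReal.ofReal_ne_top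
    _ = ∑ σ : Fin p → Bool, ENNReal.ofReal c * ∫⁻ b, ENNReal.ofReal (G b) :=
        Finset.sum_congr rfl fun σ _ => by
          rw [(measurePreserving_signFlipOn grp S σ).lintegral_comp hGm]
    _ = ∫⁻ b, ENNReal.ofReal (G b) := by
        rw [← Finset.sum_mul, ← ENNReal.ofReal_sum_of_nonneg fun _ _ => hc0, sum_signs_one,
          ENNReal.ofReal_one, one_mul]

/-- Only the model S₀ is kept. Translating by β₀ costs e^{-λ‖β₀‖} in the slab, by the triangle
inequality, and the likelihood ratio is bounded below through `excess_le`. -/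
lemma le_lintegral_density (hg : Function.Surjective grp) (hlam : 0 < lam grp X)
    (hπ : ∀ s ≤ p, 0 ≤ π s) (z : Fin n → Fin (q + 1)) :
    ENNReal.ofReal (π (suppCard grp β₀) / (p.choose (suppCard grp β₀) : ℝ) *
        (density X β₀ z * Real.exp (-lam grp X * l21 grp β₀ -
          ∑ j ∈ supp grp β₀, starNorm grp X ^ 2 / 2 *
            ((gsize grp j : ℝ) * (gsize grp j + 1) / lam grp X ^ 2)))) ≤
      ∫⁻ β, ENNReal.ofReal (density X β z) ∂(prior grp X π) := by
  set S := supp grp β₀ with hS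
  set Q := ∑ j ∈ S, starNorm grp X ^ 2 / 2 *
    ((gsize grp j : ℝ) * (gsize grp j + 1) / lam grp X ^ 2) with hQ
  have hcard : S.card ≤ p := by simpa using S.card_le_univ
  have hw : 0 ≤ π S.card / (p.choose S.card : ℝ) :=
    div_nonneg (hπ _ hcard) (Nat.cast_nonneg _)
  have he : 0 ≤ density X β₀ z * Real.exp (-lam grp X * l21 grp β₀) :=
    mul_nonneg (density_pos X β₀ z).le (Real.exp_pos _).le
  have hcard2 : suppCard grp β₀ = S.card := rfl
  rw [lintegral_prior X π (measurable_ofReal_density X z), hcard2]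
  refine le_trans ?_ (Finset.single_le_sum (f := fun S : Finset (Fin p) =>
    ENNReal.ofReal (π S.card / (p.choose S.card : ℝ)) *
        ∫⁻ b : {k : Fin d // grp k ∈ S} → ℝ, ENNReal.ofReal (slabDensity grp X S b) *
          ENNReal.ofReal (density X (embed grp S b) z)) (fun _ _ => zero_le) (Finset.mem_univ S))
  rw [ENNReal.ofReal_mul hw]
  refine mul_le_mul' le_rfl ?_
  rw [sub_eq_add_neg, Real.exp_add, ← mul_assoc, ENNReal.ofReal_mul he]
  calc _ ≤ ENNReal.ofReal (density X β₀ z * Real.exp (-lam grp X * l21 grp β₀)) *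
        ∫⁻ b : {k : Fin d // grp k ∈ S} → ℝ, ENNReal.ofReal (slabDensity grp X S b *
          Real.exp (score X β₀ z (embed grp S b) - l2 (X.mulVec (embed grp S b)) ^ 2 / 2)) :=
        mul_le_mul' le_rfl (le_lintegral_slab_mul_exp X β₀ hg hlam z S)
    _ ≤ ∫⁻ b : {k : Fin d // grp k ∈ S} → ℝ,
        ENNReal.ofReal (slabDensity grp X S (b + restr grp S β₀)) *
          ENNReal.ofReal (density X (embed grp S (b + restr grp S β₀)) z) := by
        rw [← lintegral_const_mul' _ _ ENNReal.ofReal_ne_top]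
        refine lintegral_mono fun b => ?_
        rw [← ENNReal.ofReal_mul he, ← ENNReal.ofReal_mul (slabDensity_nonneg X hg hlam S _)]
        refine ENNReal.ofReal_le_ofReal ?_
        have hslab : slabDensity grp X S b * Real.exp (-lam grp X * l21 grp β₀) ≤
            slabDensity grp X S (b + restr grp S β₀) := by
          rw [slabDensity, slabDensity, embed_add_restr_supp, mul_assoc _ (Real.exp _),
            ← Real.exp_add]
          refine mul_le_mul_of_nonneg_left (Real.exp_le_exp.2 ?_) ?_
          · have h1 := l21On_add_le grp S (embed grp S b) β₀
            have h2 : l21On grp S β₀ = l21 grp β₀ := l21On_eq_l21_of_supp_subset grp subset_rfl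
            rw [h2] at h1
            have h3 := mul_le_mul_of_nonneg_left h1 hlam.le
            have h4 : -lam grp X * l21On grp S (embed grp S b) + -lam grp X * l21 grp β₀ ≤
                -lam grp X * l21On grp S (embed grp S b + β₀) := by linarith
            exact h4
          · have hpos := slabDensity_nonneg X hg hlam S b
            rw [slabDensity] at hpos
            exact nonneg_of_mul_nonneg_left hpos (Real.exp_pos _)
        have hdens : density X β₀ z * Real.exp (score X β₀ z (embed grp S b) -
              l2 (X.mulVec (embed grp S b)) ^ 2 / 2) ≤
            density X (embed grp S (b + restr grp S β₀)) z := by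
          rw [embed_add_restr_supp, density_eq_mul_exp X β₀ (embed grp S b + β₀),
            add_sub_cancel_right]
          exact mul_le_mul_of_nonneg_left (Real.exp_le_exp.2
            (by linarith [excess_le X β₀ (embed grp S b)])) (density_pos X β₀ z).le
        calc _ = (slabDensity grp X S b * Real.exp (-lam grp X * l21 grp β₀)) *
            (density X β₀ z * Real.exp (score X β₀ z (embed grp S b) -
              l2 (X.mulVec (embed grp S b)) ^ 2 / 2)) := by ring
          _ ≤ _ := mul_le_mul hslab hdens
            (mul_nonneg (density_pos X β₀ z).le (Real.exp_pos _).le)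
            (slabDensity_nonneg X hg hlam S _)
    _ = _ := lintegral_add_right_eq_self (fun b : {k : Fin d // grp k ∈ S} → ℝ =>
        ENNReal.ofReal (slabDensity grp X S b) *
          ENNReal.ofReal (density X (embed grp S b) z)) (restr grp S β₀)

/-! ### The posterior -/

omit grp in
-- S-finiteness gives the formula for `withDensity` on arbitrary sets, so no measurability is needed
-- in `posterior_apply`.
instance sFinite_prior (grp : Fin d → Fin p) : SFinite (prior grp X π) := by
  unfold prior
  have : ∀ s : Finset (Finset (Fin p)), SFinite (∑ S ∈ s,
      ENNReal.ofReal (π S.card / (p.choose S.card : ℝ)) • Measure.map (embed grp S)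
        ((volume : Measure ({k : Fin d // grp k ∈ S} → ℝ)).withDensity fun b =>
          ENNReal.ofReal (slabDensity grp X S b))) := by
    classical
    intro s
    induction s using Finset.induction_on with
    | empty => simpa using (inferInstance : SFinite (0 : Measure (Fin d → ℝ)))
    | insert a s ha ih =>
      rw [Finset.sum_insert ha]
      infer_instance
  exact this _

lemma posterior_apply (z : Fin n → Fin (q + 1)) (B : Set (Fin d → ℝ)) :
    posterior grp X π z B = (∫⁻ β, ENNReal.ofReal (density X β z) ∂(prior grp X π))⁻¹ *
      ∫⁻ β in B, ENNReal.ofReal (density X β z) ∂(prior grp X π) := by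
  rw [posterior, Measure.smul_apply, withDensity_apply', smul_eq_mul]

/-- Since x⁻¹ * x ≤ 1 in `ℝ≥0∞` for every x, an evidence equal to 0 or ∞ needs no separate
treatment. -/
lemma posterior_le {z : Fin n → Fin (q + 1)} {B : Set (Fin d → ℝ)} {ε : ℝ≥0∞}
    (h : ∫⁻ β in B, ENNReal.ofReal (density X β z) ∂(prior grp X π) ≤
      ε * ∫⁻ β, ENNReal.ofReal (density X β z) ∂(prior grp X π)) :
    posterior grp X π z B ≤ ε := by
  rw [posterior_apply]
  calc _ ≤ (∫⁻ β, ENNReal.ofReal (density X β z) ∂(prior grp X π))⁻¹ *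
        (ε * ∫⁻ β, ENNReal.ofReal (density X β z) ∂(prior grp X π)) := mul_le_mul' le_rfl h
    _ = ε * ((∫⁻ β, ENNReal.ofReal (density X β z) ∂(prior grp X π))⁻¹ *
        ∫⁻ β, ENNReal.ofReal (density X β z) ∂(prior grp X π)) := by ring
    _ ≤ ε * 1 := mul_le_mul' le_rfl (ENNReal.inv_mul_le_one _)
    _ = ε := mul_one _

lemma posterior_le_one (z : Fin n → Fin (q + 1)) (B : Set (Fin d → ℝ)) :
    posterior grp X π z B ≤ 1 :=
  posterior_le X π (by rw [one_mul]; exact setLIntegral_le_lintegral _ _)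

lemma expPosterior_mono {A B : Set (Fin d → ℝ)} (h : A ⊆ B) :
    expPosterior grp X π β₀ A ≤ expPosterior grp X π β₀ B :=
  Finset.sum_le_sum fun _ _ => mul_le_mul' le_rfl (measure_mono h)

lemma expPosterior_union_le (A B : Set (Fin d → ℝ)) :
    expPosterior grp X π β₀ (A ∪ B) ≤
      expPosterior grp X π β₀ A + expPosterior grp X π β₀ B := by
  unfold expPosterior
  rw [← Finset.sum_add_distrib]
  exact Finset.sum_le_sum fun _ _ => (mul_le_mul' le_rfl (measure_union_le _ _)).trans_eq
    (mul_add _ _ _)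

/-- The event on which the score is dominated by the prior penalty. -/
def scoreEvent (grp : Fin d → Fin p) (z : Fin n → Fin (q + 1)) : Prop :=
  ∀ j, l2 (sub grp (scoreVec X β₀ z) j) ≤ lam grp X / 4

open Classical in
lemma expPosterior_le {B : Set (Fin d → ℝ)} {ε : ℝ≥0∞}
    (h : ∀ z, scoreEvent X β₀ grp z → posterior grp X π z B ≤ ε) :
    expPosterior grp X π β₀ B ≤
      ENNReal.ofReal (∑ z with ¬ scoreEvent X β₀ grp z, density X β₀ z) + ε := by
  have h1 : ∀ z, ENNReal.ofReal (density X β₀ z) * posterior grp X π z B ≤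
      ENNReal.ofReal (if ¬ scoreEvent X β₀ grp z then density X β₀ z else 0) +
        ENNReal.ofReal (density X β₀ z) * ε := by
    intro z
    by_cases hz : scoreEvent X β₀ grp z
    · simp only [hz, not_true_eq_false, if_false, ENNReal.ofReal_zero, zero_add]
      exact mul_le_mul' le_rfl (h z hz)
    · simp only [hz, not_false_eq_true, if_true]
      exact ((mul_le_mul' le_rfl (posterior_le_one X π z B)).trans_eq (mul_one _)).trans
        le_self_add
  refine (Finset.sum_le_sum fun z _ => h1 z).trans_eq ?_
  rw [Finset.sum_add_distrib, ← Finset.sum_mul,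
    ← ENNReal.ofReal_sum_of_nonneg fun z _ => (density_pos X β₀ z).le, sum_density,
    ENNReal.ofReal_one, one_mul, ← ENNReal.ofReal_sum_of_nonneg, Finset.sum_filter]
  intro z _
  split_ifs
  · exact le_rfl
  · exact (density_pos X β₀ z).le

/-! ### Concentration of the score -/

/-- In a direction supported on one group the score has moment generating function exp(`excess`) ≤
exp(K²‖x‖²/2), so Gaussian mixing applies to the block. -/
lemma sum_density_exp_scoreVec_le (hg : Function.Surjective grp) (hX : X ≠ 0) (j : Fin p) :
    ∑ z, density X β₀ z * Real.exp (3 * l2 (sub grp (scoreVec X β₀ z) j) ^ 2 /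
      (8 * starNorm grp X ^ 2)) ≤ 2 ^ gsize grp j := by
  have hne : Nonempty (Group grp j) := ⟨⟨(hg j).choose, (hg j).choose_spec⟩⟩
  refine sum_exp_sq_le_of_subgaussian (density X β₀) (fun z => sub grp (scoreVec X β₀ z) j)
    (starNorm_pos grp hX) fun x => ?_
  let b : Fin d → ℝ := fun k => if h : grp k = j then x ⟨k, h⟩ else 0
  have hbj : sub grp b j = x := by
    ext ⟨k, hk⟩
    have hk' : grp k = j := hk
    simp [sub, b, hk']
  have hbi : ∀ i, i ≠ j → sub grp b i = 0 := by
    intro i hi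
    ext ⟨k, hk⟩
    have hk' : grp k = i := hk
    have : grp k ≠ j := by rw [hk']; exact hi
    simp [sub, b, this]
  have hl21 : l21 grp b = l2 x := by
    rw [l21, l21On, Finset.sum_eq_single j (fun i _ hi => by rw [hbi i hi, l2_zero]) (by simp), hbj]
  have hscore : ∀ z, ∑ i, sub grp (scoreVec X β₀ z) j i * x i = score X β₀ z b := by
    intro z
    rw [score_eq_sum, ← sum_groups grp, Finset.sum_eq_single j _ (by simp)]
    · rw [← hbj]
      rfl
    · intro i _ hi
      refine Finset.sum_eq_zero fun k _ => ?_
      have : b k.1 = 0 := congrFun (hbi i hi) k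
      rw [this, mul_zero]
  simp_rw [hscore]
  rw [sum_density_mul_exp_score]
  refine Real.exp_le_exp.2 ((excess_le X β₀ b).trans ?_)
  rw [← hl21, div_mul_eq_mul_div, ← mul_pow]
  exact div_le_div_of_nonneg_right
    (pow_le_pow_left₀ (l2_nonneg _) (l2_mulVec_le_l21 grp X b) 2) zero_le_two

open Classical in
-- Exponential Markov inequality and a union bound over the groups. At the threshold λ/4 = 2K√L the
-- exponent is 3(2K√L)²/(8K²) = 3L/2.
lemma sum_density_not_scoreEvent_le (hg : Function.Surjective grp) (hX : X ≠ 0)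
    (hL : 0 ≤ logTerm grp n) :
    ∑ z with ¬ scoreEvent X β₀ grp z, density X β₀ z ≤
      p * (2 ^ gbar grp * Real.exp (-(3 / 2) * logTerm grp n)) := by
  set K := starNorm grp X with hK
  set L := logTerm grp n with hLdef
  have hK0 : 0 < K := starNorm_pos grp hX
  have hlam : lam grp X / 4 = 2 * K * √L := by rw [lam]; ring
  have hpt : ∀ z, (if ¬ scoreEvent X β₀ grp z then density X β₀ z else 0) ≤
      ∑ j, density X β₀ z * Real.exp (3 * l2 (sub grp (scoreVec X β₀ z) j) ^ 2 /
        (8 * K ^ 2)) * Real.exp (-(3 / 2) * L) := by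
    intro z
    have hterm : ∀ j, 0 ≤ density X β₀ z * Real.exp (3 * l2 (sub grp (scoreVec X β₀ z) j) ^ 2 /
        (8 * K ^ 2)) * Real.exp (-(3 / 2) * L) := fun j => by
      have := density_pos X β₀ z
      positivity
    by_cases hz : scoreEvent X β₀ grp z
    · rw [if_neg (not_not.2 hz)]
      exact Finset.sum_nonneg fun j _ => hterm j
    · rw [if_pos hz]
      rw [scoreEvent] at hz
      push Not at hz
      obtain ⟨j, hj⟩ := hz
      refine le_trans ?_ (Finset.single_le_sum (f := fun j => density X β₀ z *
        Real.exp (3 * l2 (sub grp (scoreVec X β₀ z) j) ^ 2 / (8 * K ^ 2)) *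
          Real.exp (-(3 / 2) * L)) (fun j _ => hterm j) (Finset.mem_univ j))
      rw [mul_assoc, ← Real.exp_add]
      refine le_mul_of_one_le_right (density_pos X β₀ z).le (Real.one_le_exp ?_)
      rw [hlam] at hj
      have h2 : (2 * K * √L) ^ 2 ≤ l2 (sub grp (scoreVec X β₀ z) j) ^ 2 :=
        pow_le_pow_left₀ (by positivity) hj.le 2
      rw [mul_pow, Real.sq_sqrt hL] at h2
      have h3 : 3 / 2 * L ≤ 3 * l2 (sub grp (scoreVec X β₀ z) j) ^ 2 / (8 * K ^ 2) := by
        rw [le_div_iff₀ (by positivity)]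
        nlinarith
      linarith
  rw [Finset.sum_filter]
  refine (Finset.sum_le_sum fun z _ => hpt z).trans ?_
  rw [Finset.sum_comm]
  calc _ ≤ ∑ _j : Fin p, (2 ^ gbar grp * Real.exp (-(3 / 2) * L)) := by
        refine Finset.sum_le_sum fun j _ => ?_
        rw [← Finset.sum_mul]
        refine mul_le_mul_of_nonneg_right ?_ (Real.exp_pos _).le
        exact (sum_density_exp_scoreVec_le X β₀ hg hX j).trans
          (pow_le_pow_right₀ one_le_two (Finset.le_sup (f := gsize grp) (Finset.mem_univ j)))
    _ = _ := by simp

end Denominator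

/-! ### Elementary inequalities for the exponent -/

/-- On the compatibility cone the remainder dominates the penalty up to a multiple of
`s L / φ²`. -/
lemma penalty_le_of_compat {K L s φ N P D b M : ℝ} (hK : 0 < K) (hL : 0 < L) (hs : 1 ≤ s)
    (hφ : 0 < φ) (hN : 0 < N) (hM : 0 < M) (hM1 : M ≤ 1 / 40000)
    (hb : s * √L * b ≤ M * φ ^ 2 * K) (hD : 0 ≤ D)
    (hsmall : 2 * (b * N) ≤ 1 / 100 → 0.495 * P ^ 2 ≤ D)
    (hlarge : 1 / 100 < 2 * (b * N) → 0.002475 * P ^ 2 ≤ b * N * D)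
    (hcomp : φ * (K * N) ≤ P * √s) :
    14 * K * √L * N ≤ D + 99 * s * L / φ ^ 2 := by
  have hs0 : 0 < s := by linarith
  have hsL : 0 < √L := Real.sqrt_pos.2 hL
  have hss : 0 < √s := Real.sqrt_pos.2 hs0
  have hL2 : √L ^ 2 = L := Real.sq_sqrt hL.le
  have hs2 : √s ^ 2 = s := Real.sq_sqrt hs0.le
  rcases le_or_gt (2 * (b * N)) (1 / 100) with h | h
  · have hD := hsmall h
    set u := √L * √s / φ with hu
    have hu2 : 99 * s * L / φ ^ 2 = 99 * u ^ 2 := by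
      rw [hu, div_pow, mul_pow, hL2, hs2]; ring
    have hKN : K * N ≤ P * √s / φ := by
      rw [le_div_iff₀ hφ]; linarith
    have h1 : 14 * K * √L * N ≤ 14 * u * P := by
      calc 14 * K * √L * N = 14 * √L * (K * N) := by ring
        _ ≤ 14 * √L * (P * √s / φ) := by gcongr
        _ = 14 * u * P := by rw [hu]; ring
    rw [hu2]
    -- The quadratic form 0.495 P² - 14uP + 99u² is nonnegative since 14² = 196 ≤ 4 · 0.495 · 99 =
    -- 196.02.
    nlinarith [sq_nonneg (14 * u - 0.99 * P), sq_nonneg u, sq_nonneg P]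
  · have hD2 := hlarge h
    have hsq : φ ^ 2 * K ^ 2 * N ^ 2 ≤ P ^ 2 * s := by
      have := pow_le_pow_left₀ (by positivity) hcomp 2
      rw [mul_pow, mul_pow, mul_pow, hs2] at this
      linarith
    have h1 : 0.002475 * (φ ^ 2 * K ^ 2 * N ^ 2) * √L ≤ M * φ ^ 2 * K * N * D := by
      calc _ ≤ 0.002475 * (P ^ 2 * s) * √L := by gcongr
        _ = (0.002475 * P ^ 2) * (s * √L) := by ring
        _ ≤ b * N * D * (s * √L) := mul_le_mul_of_nonneg_right hD2 (by positivity)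
        _ = (s * √L * b) * (N * D) := by ring
        _ ≤ (M * φ ^ 2 * K) * (N * D) := mul_le_mul_of_nonneg_right hb (by positivity)
        _ = _ := by ring
    have h2 : 0.002475 * (K * √L * N) ≤ M * D := by
      refine le_of_mul_le_mul_left ?_ (show 0 < φ ^ 2 * K * N by positivity)
      linarith
    -- Outside the quadratic range D alone dominates the penalty, because 14/(0.002475 · 40000) < 1.
    have h3 : M * D ≤ 1 / 40000 * D := mul_le_mul_of_nonneg_right hM1 hD
    have h4 : 0 ≤ 99 * s * L / φ ^ 2 := by positivity
    have h5 : 0 ≤ K * √L * N := by positivity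
    norm_num at h2 h3 ⊢
    linarith

/-- Away from the truth the remainder dominates the penalty. -/
lemma penalty_add_le_of_far {K L s φ ψ N P D b M C A : ℝ} (hK : 0 < K) (hL : 0 < L)
    (hs : 1 ≤ s) (hφ : 0 < φ) (hφ1 : φ ≤ 1) (hψ : 0 < ψ) (hψ1 : ψ ≤ 1) (hN : 0 < N)
    (hC : 1 ≤ C) (hMC : M * C = 1 / 20000) (hA : 0 < A)
    (hb : s * √L * b ≤ M * ψ ^ 2 * φ ^ 2 * K) (hD : 0 ≤ D)
    (hsmall : 2 * (b * N) ≤ 1 / 100 → 0.495 * P ^ 2 ≤ D)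
    (hlarge : 1 / 100 < 2 * (b * N) → 0.002475 * P ^ 2 ≤ b * N * D)
    (hcomp : ψ * φ * (K * N) ≤ P * √(C * s))
    (hfar : (100 + A) * √C * √(s * L) / (ψ * φ) < P) :
    14 * K * √L * N + (A + 4) * (s * L) ≤ D := by
  have hs0 : 0 < s := by linarith
  have hC0 : 0 < C := by linarith
  have hsL : 0 < √L := Real.sqrt_pos.2 hL
  have hL2 : √L ^ 2 = L := Real.sq_sqrt hL.le
  have hψφ : 0 < ψ * φ := mul_pos hψ hφ
  -- In units of u the assumption is P > (100 + A)u, and compatibility reads K√L N ≤ uP.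
  set u := √C * √(s * L) / (ψ * φ) with hu
  have hu0 : 0 < u := by positivity
  have hfar' : (100 + A) * u < P := by
    rw [hu]; convert hfar using 1; ring
  have hP : 0 < P := lt_of_le_of_lt (by positivity) hfar'
  have hu2 : u ^ 2 * (ψ * φ) ^ 2 = C * (s * L) := by
    rw [hu, div_pow, mul_pow, Real.sq_sqrt hC0.le, Real.sq_sqrt (by positivity)]
    field_simp
  have hψφ1 : (ψ * φ) ^ 2 ≤ 1 := pow_le_one₀ hψφ.le (mul_le_one₀ hψ1 hφ.le hφ1)
  have husL : s * L ≤ u ^ 2 := by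
    have h1 : s * L ≤ C * (s * L) := le_mul_of_one_le_left (by positivity) hC
    have h2 : u ^ 2 * (ψ * φ) ^ 2 ≤ u ^ 2 := mul_le_of_le_one_right (sq_nonneg u) hψφ1
    linarith
  have hsqrt : √(C * s) * √L = √C * √(s * L) := by
    rw [← Real.sqrt_mul (by positivity), ← Real.sqrt_mul (by positivity), mul_assoc]
  have hKN : K * √L * N ≤ u * P := by
    have h1 : ψ * φ * (K * √L * N) ≤ √C * √(s * L) * P := by
      calc ψ * φ * (K * √L * N) = ψ * φ * (K * N) * √L := by ring
        _ ≤ P * √(C * s) * √L := by gcongr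
        _ = _ := by rw [mul_assoc, hsqrt]; ring
    rw [hu, div_mul_eq_mul_div, le_div_iff₀ hψφ]
    linarith
  have hAsL : (A + 4) * (s * L) ≤ (A + 4) * u ^ 2 := by gcongr
  have huP : (100 + A) * u ^ 2 ≤ u * P := by nlinarith
  -- Both ranges give D ≥ 49.5 uP, from P ≥ 100u in the first and M C = 1/20000 in the second. The
  -- left side is at most 14uP + (A + 4)u² ≤ 15uP.
  rcases le_or_gt (2 * (b * N)) (1 / 100) with h | h
  · have hD := hsmall h
    have h1 : u * P * 100 ≤ P * P := by nlinarith [mul_pos hA (mul_pos hu0 hP)]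
    have h2 : 0 ≤ u * P := by positivity
    nlinarith
  · have hD2 := hlarge h
    have hKLN : 0 < K * √L * N := by positivity
    have h1 : 0.002475 * P ^ 2 * u * (s * L * K) ≤ 1 / 20000 * P * D * (s * L * K) := by
      calc 0.002475 * P ^ 2 * u * (s * L * K)
          ≤ b * N * D * u * (s * L * K) := by
            refine mul_le_mul_of_nonneg_right (mul_le_mul_of_nonneg_right hD2 hu0.le)
              (by positivity)
        _ = (s * √L * b) * (K * √L * N) * (D * u) := by
            rw [show s * L * K = s * √L ^ 2 * K by rw [hL2]]; ring
        _ ≤ (M * ψ ^ 2 * φ ^ 2 * K) * (K * √L * N) * (D * u) := by gcongr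
        _ ≤ (M * ψ ^ 2 * φ ^ 2 * K) * (u * P) * (D * u) := by
            have hM : 0 < M := by
              by_contra! hM
              nlinarith
            gcongr
        _ = M * (u ^ 2 * (ψ * φ) ^ 2) * (P * D * K) := by ring
        _ = M * C * (P * D) * (s * L * K) := by rw [hu2]; ring
        _ = _ := by rw [hMC]; ring
    have h2 : 0.002475 * P ^ 2 * u ≤ 1 / 20000 * P * D :=
      le_of_mul_le_mul_right h1 (by positivity)
    have h3 : 0.002475 * (u * P) ≤ 1 / 20000 * D := by
      refine le_of_mul_le_mul_left ?_ hP
      linarith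
    have h4 : 0 < u * P := by positivity
    have h5 : (A + 4) * u ^ 2 ≤ u * P := by linarith [sq_nonneg u]
    linarith

/-! ### From compatibility to bounds for the log-likelihood ratio -/

section Exponent

variable {n q d p : ℕ} (grp : Fin d → Fin p) (X : Matrix (Fin n × Fin q) (Fin d) ℝ)
  (β₀ : Fin d → ℝ)

/-! ### Compatibility numbers -/

lemma phi_nonneg (S : Finset (Fin p)) : 0 ≤ phi grp X β₀ S := by
  refine Real.sInf_nonneg ?_
  rintro r ⟨β, -, -, rfl⟩
  exact div_nonneg (mul_nonneg (predNorm_nonneg X β₀ β) (Real.sqrt_nonneg _))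
    (mul_nonneg (starNorm_nonneg grp X) (l21_nonneg grp β))

lemma psi1_nonneg (t : ℝ) : 0 ≤ psi1 grp X β₀ t := by
  refine Real.sInf_nonneg ?_
  rintro r ⟨β, -, -, rfl⟩
  exact div_nonneg (mul_nonneg (predNorm_nonneg X β₀ β) (Real.sqrt_nonneg _))
    (mul_nonneg (starNorm_nonneg grp X) (l21_nonneg grp β))

variable {X}

lemma phi_mul_le (hX : X ≠ 0) {S : Finset (Fin p)} {β : Fin d → ℝ}
    (h1 : l21On grp Sᶜ β ≤ 7 * l21On grp S β) (h2 : ∃ j ∈ S, sub grp β j ≠ 0) :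
    phi grp X β₀ S * (starNorm grp X * l21 grp β) ≤ predNorm X β₀ β * √(S.card : ℝ) := by
  have hβ : β ≠ 0 := by
    rintro rfl
    obtain ⟨j, -, hj⟩ := h2
    exact hj rfl
  rw [← le_div_iff₀ (mul_pos (starNorm_pos grp hX) (l21_pos grp hβ))]
  refine csInf_le ⟨0, ?_⟩ ⟨β, h1, h2, rfl⟩
  rintro r ⟨β, -, -, rfl⟩
  exact div_nonneg (mul_nonneg (predNorm_nonneg X β₀ β) (Real.sqrt_nonneg _))
    (mul_nonneg (starNorm_nonneg grp X) (l21_nonneg grp β))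

lemma psi1_mul_le (hX : X ≠ 0) {t : ℝ} {β : Fin d → ℝ} (h1 : 1 ≤ suppCard grp β)
    (h2 : (suppCard grp β : ℝ) ≤ t) :
    psi1 grp X β₀ t * (starNorm grp X * l21 grp β) ≤
      predNorm X β₀ β * √(suppCard grp β : ℝ) := by
  have hβ : β ≠ 0 := fun h => by
    rw [(suppCard_eq_zero grp).2 h] at h1
    omega
  rw [← le_div_iff₀ (mul_pos (starNorm_pos grp hX) (l21_pos grp hβ))]
  refine csInf_le ⟨0, ?_⟩ ⟨β, h1, h2, rfl⟩
  rintro r ⟨β, -, -, rfl⟩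
  exact div_nonneg (mul_nonneg (predNorm_nonneg X β₀ β) (Real.sqrt_nonneg _))
    (mul_nonneg (starNorm_nonneg grp X) (l21_nonneg grp β))

lemma psi2_mul_le (hX : X ≠ 0) {t : ℝ} {β : Fin d → ℝ} (h1 : 1 ≤ suppCard grp β)
    (h2 : (suppCard grp β : ℝ) ≤ t) :
    psi2 grp X β₀ t * (starNorm grp X * l2 β) ≤ predNorm X β₀ β := by
  have hβ : 0 < l2 β := (l2_nonneg β).lt_of_ne' fun h => by
    rw [(suppCard_eq_zero grp).2 (l2_eq_zero.1 h)] at h1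
    omega
  rw [← le_div_iff₀ (mul_pos (starNorm_pos grp hX) hβ)]
  refine csInf_le ⟨0, ?_⟩ ⟨β, h1, h2, rfl⟩
  rintro r ⟨β, -, -, rfl⟩
  exact div_nonneg (predNorm_nonneg X β₀ β)
    (mul_nonneg (starNorm_nonneg grp X) (l2_nonneg β))

/-- `ψ₂` is positive as soon as `ψ₁` is. -/
lemma psi2_pos (hX : X ≠ 0) {t : ℝ} (hs : 1 ≤ suppCard grp β₀) (ht : (suppCard grp β₀ : ℝ) ≤ t)
    (h : 0 < psi1 grp X β₀ t) : 0 < psi2 grp X β₀ t := by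
  have ht0 : 0 < t := lt_of_lt_of_le (by exact_mod_cast hs) ht
  have hK := starNorm_pos grp hX
  refine (div_pos h (Real.sqrt_pos.2 ht0)).trans_le (le_csInf ⟨_, β₀, hs, ht, rfl⟩ ?_)
  rintro r ⟨β, h1, h2, rfl⟩
  have hβ : 0 < l2 β := (l2_nonneg β).lt_of_ne' fun h => by
    rw [(suppCard_eq_zero grp).2 (l2_eq_zero.1 h)] at h1
    omega
  rw [div_le_div_iff₀ (Real.sqrt_pos.2 ht0) (mul_pos hK hβ)]
  calc psi1 grp X β₀ t * (starNorm grp X * l2 β)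
      ≤ psi1 grp X β₀ t * (starNorm grp X * l21 grp β) := by
        gcongr
        exact l2_le_l21 grp β
    _ ≤ predNorm X β₀ β * √(suppCard grp β : ℝ) := psi1_mul_le grp β₀ hX h1 h2
    _ ≤ predNorm X β₀ β * √t :=
        mul_le_mul_of_nonneg_left (Real.sqrt_le_sqrt h2) (predNorm_nonneg X β₀ β)

/-- The subvectors of `b` scaled to length one. -/
def normalized (b : Fin d → ℝ) : Fin d → ℝ := fun k => (l2 (sub grp b (grp k)))⁻¹ * b k

lemma sub_normalized (b : Fin d → ℝ) (j : Fin p) :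
    sub grp (normalized grp b) j = (l2 (sub grp b j))⁻¹ • sub grp b j := by
  ext ⟨k, hk⟩
  have hk' : grp k = j := hk
  subst hk'
  rfl

lemma l2_sub_normalized (b : Fin d → ℝ) (j : Fin p) :
    l2 (sub grp (normalized grp b) j) = if j ∈ supp grp b then 1 else 0 := by
  rw [sub_normalized, l2_smul, abs_of_nonneg (inv_nonneg.2 (l2_nonneg _))]
  split_ifs with h
  · rw [mem_supp, Ne, ← l2_eq_zero] at h
    exact inv_mul_cancel₀ h
  · rw [mem_supp, not_not] at h
    rw [h, l2_zero, mul_zero]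

/-- The average of the left side over all signs satisfies the bound, by `sum_signs_l2_sq`. -/
lemma exists_signs_l2_mulVec_le (b : Fin d → ℝ) : ∃ σ : Fin p → Bool,
    l2 (X.mulVec (signFlip grp σ b)) ^ 2 ≤ starNorm grp X ^ 2 * ∑ j, l2 (sub grp b j) ^ 2 := by
  by_contra! h
  have h1 := sum_signs_l2_sq (ι := Fin p) fun j =>
    (X.submatrix id (Subtype.val : Group grp j → Fin d)).mulVec (sub grp b j)
  simp_rw [← mulVec_signFlip] at h1
  have h2 : ∑ σ : Fin p → Bool, (∏ _i : Fin p, (1 / 2 : ℝ)) *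
      (starNorm grp X ^ 2 * ∑ j, l2 (sub grp b j) ^ 2) <
      ∑ σ : Fin p → Bool, (∏ _i : Fin p, (1 / 2 : ℝ)) *
        l2 (X.mulVec (signFlip grp σ b)) ^ 2 :=
    Finset.sum_lt_sum_of_nonempty Finset.univ_nonempty fun σ _ =>
      mul_lt_mul_of_pos_left (h σ) (by positivity)
  rw [← Finset.sum_mul, sum_signs_one, one_mul, h1, Finset.mul_sum] at h2
  refine absurd h2 (not_lt.2 (Finset.sum_le_sum fun j _ => ?_))
  rw [← mul_pow]
  exact pow_le_pow_left₀ (l2_nonneg _) (l2_mulVec_sub_le grp X b j) 2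

/-- Test vector: blocks of length one on S₀, zero elsewhere, with signs such that ‖Xb‖₂² ≤ K²s₀. Its
ratio is at most K√s₀ · √s₀/(K s₀) = 1. -/
lemma phi0_le_one (hX : X ≠ 0) : phi0 grp X β₀ ≤ 1 := by
  rcases (supp grp β₀).eq_empty_or_nonempty with hS | ⟨j₀, hj₀⟩
  -- For β₀ = 0 the infimum is over the empty set and equals 0.
  · rw [phi0, hS, phi]
    simp
  obtain ⟨σ, hσ⟩ := exists_signs_l2_mulVec_le grp (X := X) (normalized grp β₀)
  set b := signFlip grp σ (normalized grp β₀) with hb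
  have hl2 : ∀ j, l2 (sub grp b j) = if j ∈ supp grp β₀ then 1 else 0 := fun j => by
    rw [hb, l2_sub_signFlip, l2_sub_normalized]
  have hcard : (0 : ℝ) < (supp grp β₀).card := by
    exact_mod_cast Finset.card_pos.2 ⟨j₀, hj₀⟩
  have hl21 : l21 grp b = (supp grp β₀).card := by
    simp [l21, l21On, hl2]
  have hc : l21On grp (supp grp β₀)ᶜ b = 0 :=
    Finset.sum_eq_zero fun j hj => by rw [hl2, if_neg (Finset.mem_compl.1 hj)]
  have h1 := phi_mul_le grp β₀ hX (S := supp grp β₀) (β := b)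
    (by rw [hc]; exact mul_nonneg (by norm_num) (l21On_nonneg grp _ b))
    ⟨j₀, hj₀, fun h => by
      have := hl2 j₀
      rw [h, l2_zero, if_pos hj₀] at this
      exact zero_ne_one this⟩
  have hK := starNorm_pos grp hX
  have h2 : predNorm X β₀ b ≤ starNorm grp X * √((supp grp β₀).card : ℝ) := by
    refine (predNorm_le X β₀ b).trans
      (le_of_sq_le_sq (hσ.trans_eq ?_) (mul_nonneg hK.le (Real.sqrt_nonneg _)))
    rw [mul_pow, Real.sq_sqrt hcard.le]
    simp [l2_sub_normalized]
  have h3 : phi0 grp X β₀ * (starNorm grp X * (supp grp β₀).card) ≤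
      1 * (starNorm grp X * (supp grp β₀).card) := by
    rw [hl21] at h1
    refine h1.trans ((mul_le_mul_of_nonneg_right h2 (Real.sqrt_nonneg _)).trans_eq ?_)
    rw [mul_assoc, Real.mul_self_sqrt hcard.le, one_mul]
  exact le_of_mul_le_mul_right h3 (mul_pos hK hcard)

lemma psi1_le_one (hX : X ≠ 0) {t : ℝ} (ht : 1 ≤ t) : psi1 grp X β₀ t ≤ 1 := by
  obtain ⟨r, k, -⟩ : ∃ r k, X r k ≠ 0 := by
    by_contra! h
    exact hX (Matrix.ext h)
  set b : Fin d → ℝ := Pi.single k 1 with hb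
  have hb0 : b ≠ 0 := by simp [hb]
  have hcard : suppCard grp b = 1 := by
    rw [suppCard, Finset.card_eq_one]
    refine ⟨grp k, ?_⟩
    ext j
    rw [mem_supp, Finset.mem_singleton]
    constructor
    · intro h
      by_contra hj
      refine h ?_
      ext ⟨i, hi⟩
      have : i ≠ k := by
        rintro rfl
        exact hj hi.symm
      simp [sub, hb, this]
    · rintro rfl h
      have : b k = 0 := congrFun h ⟨k, rfl⟩
      simp [hb] at this
  have h1 := psi1_mul_le grp β₀ hX (t := t) (β := b) hcard.ge (by rw [hcard]; exact_mod_cast ht)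
  rw [hcard, Nat.cast_one, Real.sqrt_one, mul_one] at h1
  have h2 := h1.trans ((predNorm_le X β₀ b).trans (l2_mulVec_le_l21 grp X b))
  rw [mul_le_iff_le_one_left (mul_pos (starNorm_pos grp hX) (l21_pos grp hb0))] at h2
  exact h2

/-! ### Bounds for the exponent -/

lemma l21_sub_le (β : Fin d → ℝ) :
    l21 grp β₀ - l21 grp β ≤ l21On grp (supp grp β₀) (β - β₀) -
      l21On grp (supp grp β₀)ᶜ (β - β₀) := by
  have h1 := l21On_add_compl grp (supp grp β₀) β
  have h2 : l21On grp (supp grp β₀) β₀ = l21 grp β₀ := l21On_eq_l21_of_supp_subset grp subset_rfl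
  have h3 := l21On_add_le grp (supp grp β₀) β (-(β - β₀))
  rw [l21On_neg, show β + -(β - β₀) = β₀ by abel, h2] at h3
  have h4 := l21On_add_le grp (supp grp β₀)ᶜ β (-β₀)
  rw [l21On_neg, l21On_compl_supp, ← sub_eq_add_neg] at h4
  linarith

lemma s0_eq_zero_or_one_le : s0 grp β₀ = 0 ∨ 1 ≤ s0 grp β₀ := by
  unfold s0
  rcases Nat.eq_zero_or_pos (suppCard grp β₀) with h | h
  · left; simp [h]
  · right; exact_mod_cast h

lemma s0_nonneg : 0 ≤ s0 grp β₀ := Nat.cast_nonneg _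

variable {A₄ M : ℝ}

lemma xi0_nonneg (hA₄ : 0 < A₄) : 0 ≤ xi0 grp X β₀ A₄ := by
  have := s0_nonneg grp β₀
  unfold xi0
  positivity

/-- For s₀ ≥ 1 and X ≠ 0 the left side of the class condition is strictly positive, so no factor on
its right can vanish. -/
lemma compat_pos_of_mem_truthClass (hX : X ≠ 0) (hL : 0 < logTerm grp n)
    (hβ : β₀ ∈ truthClass grp X A₄ M) (hs : 1 ≤ s0 grp β₀) :
    0 < phi0 grp X β₀ ∧ 0 < psi1 grp X β₀ (xi0 grp X β₀ A₄ + s0 grp β₀) := by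
  have h : s0 grp β₀ * √(logTerm grp n) * blockNorm X grp ≤ M *
      psi1 grp X β₀ (xi0 grp X β₀ A₄ + s0 grp β₀) ^ 2 * phi0 grp X β₀ ^ 2 * starNorm grp X := hβ
  have hpos : 0 < s0 grp β₀ * √(logTerm grp n) * blockNorm X grp :=
    mul_pos (mul_pos (by linarith) (Real.sqrt_pos.2 hL)) (blockNorm_pos grp hX)
  refine ⟨(phi_nonneg grp X β₀ _).lt_of_ne' fun h0 => ?_,
    (psi1_nonneg grp X β₀ _).lt_of_ne' fun h0 => ?_⟩
  · have h0' : phi0 grp X β₀ = 0 := h0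
    rw [h0'] at h
    simp at h
    linarith
  · rw [h0] at h
    simp at h
    linarith

/-- Let x and y be the parts of N on S₀ and off S₀. Noise, difference of penalties and λN/2 sum to
at most λ((1/4 + 1/2)(x + y) + x - y) = λ(7x - y)/4. This is nonpositive if y ≥ 7x; otherwise b lies
in the cone defining φ, and `penalty_le_of_compat` applies to 7λN/4 = 14K√L N. -/
lemma exponent_le (hX : X ≠ 0) (hA₄ : 0 < A₄) (hM : 0 < M) (hM1 : M ≤ 1 / 40000)
    (hL : 0 < logTerm grp n) (hβ : β₀ ∈ truthClass grp X A₄ M) {z : Fin n → Fin (q + 1)}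
    (hz : scoreEvent X β₀ grp z) (β : Fin d → ℝ) :
    score X β₀ z (β - β₀) - excess X β₀ (β - β₀) ≤
      99 * s0 grp β₀ * logTerm grp n / phi0 grp X β₀ ^ 2 - lam grp X * l21 grp β₀ +
        (lam grp X * l21 grp β - lam grp X / 2 * l21 grp (β - β₀)) := by
  set L := logTerm grp n with hLdef
  set K := starNorm grp X with hKdef
  have hK : 0 < K := starNorm_pos grp hX
  have hsL : 0 < √L := Real.sqrt_pos.2 hL
  have hlam : lam grp X = 8 * K * √L := rfl
  have hlam0 : 0 < lam grp X := by rw [hlam]; positivity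
  set b := β - β₀ with hb
  set x := l21On grp (supp grp β₀) b with hx
  set y := l21On grp (supp grp β₀)ᶜ b with hy
  have hx0 : 0 ≤ x := l21On_nonneg grp _ b
  have hy0 : 0 ≤ y := l21On_nonneg grp _ b
  have hxy : x + y = l21 grp b := l21On_add_compl grp _ b
  have h1 := score_le_of_scoreVec_le X β₀ grp hz b
  have h2 := mul_le_mul_of_nonneg_left (l21_sub_le grp β₀ β) hlam0.le
  rw [← hb, ← hx, ← hy] at h2
  have hD := excess_nonneg X β₀ b
  have hs0 := s0_nonneg grp β₀
  have hE : 0 ≤ 99 * s0 grp β₀ * L / phi0 grp X β₀ ^ 2 := by positivity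
  rw [← hxy] at h1 ⊢
  rcases le_or_gt (7 * x) y with hcase | hcase
  · have := mul_le_mul_of_nonneg_left hcase hlam0.le
    nlinarith
  · have hxpos : 0 < x := by linarith
    obtain ⟨j, hj, hbj⟩ : ∃ j ∈ supp grp β₀, sub grp b j ≠ 0 := by
      by_contra! h
      have : x = 0 := Finset.sum_eq_zero fun j hj => by rw [h j hj, l2_zero]
      linarith
    have hs1 : 1 ≤ s0 grp β₀ := by
      have : 0 < suppCard grp β₀ := Finset.card_pos.2 ⟨j, hj⟩
      unfold s0
      exact_mod_cast this
    obtain ⟨hφ, hψ⟩ := compat_pos_of_mem_truthClass grp β₀ hX hL hβ hs1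
    have hcomp := phi_mul_le grp β₀ hX (S := supp grp β₀) (β := b) hcase.le ⟨j, hj, hbj⟩
    have hψ1 : psi1 grp X β₀ (xi0 grp X β₀ A₄ + s0 grp β₀) ≤ 1 :=
      psi1_le_one grp β₀ hX (by linarith [xi0_nonneg grp (X := X) β₀ hA₄])
    have hclass : s0 grp β₀ * √L * blockNorm X grp ≤ M * phi0 grp X β₀ ^ 2 * K := by
      refine (show _ ≤ _ from hβ).trans ?_
      have : psi1 grp X β₀ (xi0 grp X β₀ A₄ + s0 grp β₀) ^ 2 ≤ 1 := pow_le_one₀ hψ.le hψ1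
      calc _ ≤ M * 1 * phi0 grp X β₀ ^ 2 * K := by gcongr
        _ = _ := by ring
    have := penalty_le_of_compat hK hL hs1 hφ (N := l21 grp b) (by linarith)
      hM hM1 hclass hD (excess_ge_quadratic X β₀ grp)
      (excess_ge_linear X β₀ grp) hcomp
    rw [← hxy] at this
    have h3 : 0 ≤ lam grp X * y := by positivity
    have h4 : 14 * K * √L * (x + y) = lam grp X * (7 / 4 * (x + y)) := by rw [hlam]; ring
    rw [h4] at this
    linarith

lemma suppCard_sub_le (β : Fin d → ℝ) :
    suppCard grp (β - β₀) ≤ suppCard grp β + suppCard grp β₀ := by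
  rw [sub_eq_add_neg, ← suppCard_neg grp β₀]
  exact suppCard_add_le grp β (-β₀)

/-- The constant `C` such that `ξ₀ + s₀ ≤ C s₀ / φ²`. -/
def dimConst (A₄ : ℝ) : ℝ := 2 + 104 / A₄

lemma one_le_dimConst (hA₄ : 0 < A₄) : 1 ≤ dimConst A₄ := by
  have : 0 < 104 / A₄ := by positivity
  unfold dimConst
  linarith

lemma xi0_add_le (hX : X ≠ 0) (hA₄ : 0 < A₄) (hφ : 0 < phi0 grp X β₀) :
    xi0 grp X β₀ A₄ + s0 grp β₀ ≤ dimConst A₄ * s0 grp β₀ / phi0 grp X β₀ ^ 2 := by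
  have hφ1 : phi0 grp X β₀ ^ 2 ≤ 1 := pow_le_one₀ hφ.le (phi0_le_one grp β₀ hX)
  have hs := s0_nonneg grp β₀
  rw [le_div_iff₀ (by positivity)]
  have : (xi0 grp X β₀ A₄ + s0 grp β₀) * phi0 grp X β₀ ^ 2 =
      s0 grp β₀ * ((2 + 4 / A₄) * phi0 grp X β₀ ^ 2 + 100 / A₄) := by
    unfold xi0
    field_simp
    ring
  rw [this, mul_comm (dimConst A₄)]
  refine mul_le_mul_of_nonneg_left ?_ hs
  have h2 : (2 + 4 / A₄) * phi0 grp X β₀ ^ 2 ≤ 2 + 4 / A₄ :=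
    mul_le_of_le_one_right (by positivity) hφ1
  have h3 : dimConst A₄ = 2 + 4 / A₄ + 100 / A₄ := by unfold dimConst; ring
  linarith

/-- For sparse `β` the `ℓ_{2,1}` distance to the truth is controlled by the prediction norm. -/
lemma compat_mul_l21_le (hX : X ≠ 0) (hA₄ : 0 < A₄) (hφ : 0 < phi0 grp X β₀)
    {β : Fin d → ℝ} (hξ : (suppCard grp β : ℝ) ≤ xi0 grp X β₀ A₄) :
    psi1 grp X β₀ (xi0 grp X β₀ A₄ + s0 grp β₀) * phi0 grp X β₀ *
        (starNorm grp X * l21 grp (β - β₀)) ≤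
      predNorm X β₀ (β - β₀) * √(dimConst A₄ * s0 grp β₀) := by
  have hP := predNorm_nonneg X β₀ (β - β₀)
  by_cases hb : β - β₀ = 0
  · rw [hb] at hP ⊢
    rw [l21_zero, mul_zero, mul_zero]
    exact mul_nonneg hP (Real.sqrt_nonneg _)
  have h1 : 1 ≤ suppCard grp (β - β₀) :=
    Nat.one_le_iff_ne_zero.2 fun h => hb ((suppCard_eq_zero grp).1 h)
  have h2 : (suppCard grp (β - β₀) : ℝ) ≤ xi0 grp X β₀ A₄ + s0 grp β₀ := by
    have : (suppCard grp (β - β₀) : ℝ) ≤ suppCard grp β + suppCard grp β₀ := by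
      exact_mod_cast suppCard_sub_le grp β₀ β
    unfold s0
    linarith
  have h3 := psi1_mul_le grp β₀ hX h1 h2
  have h4 : phi0 grp X β₀ * √(suppCard grp (β - β₀) : ℝ) ≤ √(dimConst A₄ * s0 grp β₀) := by
    refine Real.le_sqrt_of_sq_le ?_
    rw [mul_pow, Real.sq_sqrt (Nat.cast_nonneg _)]
    have := h2.trans (xi0_add_le grp β₀ hX hA₄ hφ)
    rw [le_div_iff₀ (by positivity)] at this
    linarith
  calc _ = phi0 grp X β₀ * (psi1 grp X β₀ (xi0 grp X β₀ A₄ + s0 grp β₀) *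
        (starNorm grp X * l21 grp (β - β₀))) := by ring
    _ ≤ phi0 grp X β₀ * (predNorm X β₀ (β - β₀) * √(suppCard grp (β - β₀) : ℝ)) := by gcongr
    _ = predNorm X β₀ (β - β₀) * (phi0 grp X β₀ * √(suppCard grp (β - β₀) : ℝ)) := by ring
    _ ≤ _ := by gcongr

/-- No cone condition is needed: β is sparse, so ψ₁ controls all of N, and D pays for the crude
bound 7λN/4 of noise and penalty together. -/
lemma exponent_le_of_far (hX : X ≠ 0) {A₃ : ℝ} (hA₃ : 0 < A₃) (hA₄ : 0 < A₄)
    (hM : M * dimConst A₄ = 1 / 20000) (hL : 0 < logTerm grp n)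
    (hβ : β₀ ∈ truthClass grp X A₄ M) (hs : 1 ≤ s0 grp β₀) {z : Fin n → Fin (q + 1)}
    (hz : scoreEvent X β₀ grp z) {β : Fin d → ℝ}
    (hξ : (suppCard grp β : ℝ) ≤ xi0 grp X β₀ A₄)
    (hfar : (100 + A₃) * √(dimConst A₄) * √(s0 grp β₀ * logTerm grp n) /
      (psi1 grp X β₀ (xi0 grp X β₀ A₄ + s0 grp β₀) * phi0 grp X β₀) <
        predNorm X β₀ (β - β₀)) :
    score X β₀ z (β - β₀) - excess X β₀ (β - β₀) ≤
      -((A₃ + 4) * (s0 grp β₀ * logTerm grp n)) - lam grp X * l21 grp β₀ +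
        (lam grp X * l21 grp β - lam grp X / 2 * l21 grp (β - β₀)) := by
  obtain ⟨hφ, hψ⟩ := compat_pos_of_mem_truthClass grp β₀ hX hL hβ hs
  have hK : 0 < starNorm grp X := starNorm_pos grp hX
  have hb : β - β₀ ≠ 0 := fun h => by
    have h0 : predNorm X β₀ (β - β₀) = 0 := by
      rw [h]
      simpa using predNorm_smul X β₀ 0 0
    rw [h0] at hfar
    refine absurd hfar (not_lt.2 ?_)
    positivity
  have hlam : lam grp X = 8 * starNorm grp X * √(logTerm grp n) := rfl
  have hlam0 : 0 < lam grp X := by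
    rw [hlam]
    exact mul_pos (by positivity) (Real.sqrt_pos.2 hL)
  have h1 := score_le_of_scoreVec_le X β₀ grp hz (β - β₀)
  have h2 := mul_le_mul_of_nonneg_left (l21_sub_le grp β₀ β) hlam0.le
  have h3 := l21On_add_compl grp (supp grp β₀) (β - β₀)
  have h4 := mul_nonneg hlam0.le (l21On_nonneg grp (supp grp β₀)ᶜ (β - β₀))
  have h5 := penalty_add_le_of_far hK hL hs hφ (phi0_le_one grp β₀ hX) hψ
    (psi1_le_one grp β₀ hX (by linarith [xi0_nonneg grp (X := X) β₀ hA₄])) (l21_pos grp hb)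
    (one_le_dimConst hA₄) hM hA₃ hβ (excess_nonneg X β₀ (β - β₀)) (excess_ge_quadratic X β₀ grp)
    (excess_ge_linear X β₀ grp) (compat_mul_l21_le grp β₀ hX hA₄ hφ hξ) hfar
  have h6 : 14 * starNorm grp X * √(logTerm grp n) * l21 grp (β - β₀) =
      lam grp X * (7 / 4 * l21 grp (β - β₀)) := by rw [hlam]; ring
  rw [h6] at h5
  have h7 : l21On grp (supp grp β₀) (β - β₀) - l21On grp (supp grp β₀)ᶜ (β - β₀) ≤
      l21 grp (β - β₀) := by linarith [l21On_nonneg grp (supp grp β₀)ᶜ (β - β₀)]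
  have h8 := mul_le_mul_of_nonneg_left h7 hlam0.le
  linarith

end Exponent

/-! ### The prior on the model size -/

lemma geom_sum_le_two {θ : ℝ} (h0 : 0 ≤ θ) (h1 : θ ≤ 1 / 2) (N : ℕ) :
    ∑ i ∈ Finset.range N, θ ^ i ≤ 2 := by
  have : ∑ i ∈ Finset.range N, θ ^ i ≤ 2 - 2 * θ ^ N := by
    induction N with
    | zero => simp
    | succ N ih =>
      rw [Finset.sum_range_succ, pow_succ]
      have := pow_nonneg h0 N
      nlinarith
  have h2 := pow_nonneg h0 N
  linarith

lemma sum_tail_le {a : ℕ → ℝ} {p k s₁ : ℕ} {θ : ℝ} (h0 : 0 ≤ θ) (h1 : θ ≤ 1 / 2)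
    (ha : 0 ≤ a s₁) (hstep : ∀ s, s₁ ≤ s → s < p → a (s + 1) ≤ θ * a s) (hk : s₁ ≤ k) :
    ∑ s ∈ Finset.range (p + 1), (if k ≤ s then a s else 0) ≤ 2 * θ ^ (k - s₁) * a s₁ := by
  have hdecay : ∀ i, s₁ + i ≤ p → a (s₁ + i) ≤ θ ^ i * a s₁ := by
    intro i
    induction i with
    | zero => simp
    | succ i ih =>
      intro hi
      have hi' : s₁ + i < p := by omega
      calc a (s₁ + (i + 1)) ≤ θ * a (s₁ + i) := hstep (s₁ + i) (Nat.le_add_right _ _) hi'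
        _ ≤ θ * (θ ^ i * a s₁) := mul_le_mul_of_nonneg_left (ih (by omega)) h0
        _ = _ := by ring
  rw [← Finset.sum_filter]
  have : (Finset.range (p + 1)).filter (fun s => k ≤ s) = Finset.Ico k (p + 1) := by
    ext s
    simp only [Finset.mem_filter, Finset.mem_range, Finset.mem_Ico]
    omega
  rw [this, Finset.sum_Ico_eq_sum_range]
  calc _ ≤ ∑ i ∈ Finset.range (p + 1 - k), θ ^ i * (θ ^ (k - s₁) * a s₁) := by
        refine Finset.sum_le_sum fun i hi => ?_
        have hi' := Finset.mem_range.1 hi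
        have := hdecay (k - s₁ + i) (by omega)
        rw [show s₁ + (k - s₁ + i) = k + i by omega, pow_add] at this
        linarith
    _ ≤ 2 * (θ ^ (k - s₁) * a s₁) := by
        rw [← Finset.sum_mul]
        exact mul_le_mul_of_nonneg_right (geom_sum_le_two h0 h1 _)
          (mul_nonneg (pow_nonneg h0 _) ha)
    _ = _ := by ring

lemma zero_le_pow_mul {a : ℕ → ℝ} {p : ℕ} {E : ℝ} (hE : 0 ≤ E) (hstep : ∀ s < p, a s ≤ E * a (s + 1)) {s : ℕ}
    (hs : s ≤ p) : a 0 ≤ E ^ s * a s := by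
  induction s with
  | zero => simp
  | succ s ih =>
    refine (ih (by omega)).trans ?_
    calc E ^ s * a s ≤ E ^ s * (E * a (s + 1)) :=
          mul_le_mul_of_nonneg_left (hstep s (by omega)) (pow_nonneg hE s)
      _ = _ := by ring

section Prior

variable {n d p : ℕ} {grp : Fin d → Fin p} {A₁ A₂ A₃ A₄ : ℝ} {π : ℕ → ℝ}

lemma one_le_gbar (hg : Function.Surjective grp) (hp : 0 < p) : 1 ≤ gbar grp := by
  obtain ⟨k, hk⟩ := hg ⟨0, hp⟩
  refine le_trans ?_ (Finset.le_sup (f := gsize grp) (Finset.mem_univ (⟨0, hp⟩ : Fin p)))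
  exact Fintype.card_pos_iff.2 ⟨⟨k, hk⟩⟩

lemma max_rpow_eq_exp (hn : 0 < n) (hp : 0 < p) (A : ℝ) :
    (max (p : ℝ) ((n : ℝ) ^ gbar grp)) ^ A = Real.exp (A * logTerm grp n) := by
  have hp' : (0 : ℝ) < p := by exact_mod_cast hp
  have hn' : (0 : ℝ) < n := by exact_mod_cast hn
  have h : logTerm grp n = Real.log (max (p : ℝ) ((n : ℝ) ^ gbar grp)) := by
    rw [logTerm, ← Real.log_pow]
    rcases le_total (p : ℝ) ((n : ℝ) ^ gbar grp) with h | h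
    · rw [max_eq_right h, max_eq_right (Real.log_le_log hp' h)]
    · rw [max_eq_left h, max_eq_left (Real.log_le_log (by positivity) h)]
  rw [h, mul_comm, Real.rpow_def_of_pos (lt_max_of_lt_left hp')]

lemma gbar_mul_log_le : (gbar grp : ℝ) * Real.log n ≤ logTerm grp n := le_max_right _ _

lemma natCast_le_exp_logTerm (hp : 0 < p) : (p : ℝ) ≤ Real.exp (logTerm grp n) := by
  have hp' : (0 : ℝ) < p := by exact_mod_cast hp
  rw [← Real.log_le_iff_le_exp hp']
  exact le_max_left _ _

lemma two_pow_le_exp (g : ℕ) : (2 : ℝ) ^ g ≤ Real.exp g := by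
  rw [← mul_one (g : ℝ), Real.exp_nat_mul]
  refine pow_le_pow_left₀ zero_le_two ?_ _
  have := Real.add_one_le_exp 1
  linarith

namespace IsSizePrior

variable (h : IsSizePrior n grp A₁ A₂ A₃ A₄ π) (hA₁ : 0 < A₁) (hn : 0 < n) (hp : 0 < p)

include h hA₁ hn hp

omit hn in
-- The ratio bounds force positivity: a vanishing π(s), s ≥ 1, makes π(s)/π(s - 1) zero, and π(0) =
-- 0 makes π(1)/π(0) zero by the convention for division.
lemma pos {s : ℕ} (hs : s ≤ p) : 0 < π s := by
  have key : ∀ s, 1 ≤ s → s ≤ p → 0 < π s / π (s - 1) := fun s h1 h2 =>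
    lt_of_lt_of_le (by
      have : (0 : ℝ) < p := by exact_mod_cast hp
      have : (0 : ℝ) < max (p : ℝ) ((n : ℝ) ^ gbar grp) := lt_max_of_lt_left this
      positivity) (h.ratio_lower s h1 h2)
  refine (h.nonneg s hs).lt_of_ne' fun h0 => ?_
  rcases Nat.eq_zero_or_pos s with rfl | hs0
  · have := key 1 le_rfl hp
    simp [h0] at this
  · have := key s hs0 hs
    simp [h0] at this

lemma succ_le {s : ℕ} (hs : s < p) :
    π (s + 1) ≤ A₂ * Real.exp (-(A₄ * logTerm grp n)) * π s := by
  have h1 := h.ratio_upper (s + 1) (by omega) (by omega)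
  rw [max_rpow_eq_exp hn hp, Nat.add_sub_cancel,
    div_le_iff₀ (h.pos hA₁ hp (by omega))] at h1
  rwa [Real.exp_neg, ← div_eq_mul_inv]

lemma le_succ {s : ℕ} (hs : s < p) :
    π s ≤ Real.exp (A₃ * logTerm grp n) / A₁ * π (s + 1) := by
  have h1 := h.ratio_lower (s + 1) (by omega) (by omega)
  rw [max_rpow_eq_exp hn hp, Nat.add_sub_cancel,
    le_div_iff₀ (h.pos hA₁ hp (by omega)), div_mul_eq_mul_div,
    div_le_iff₀ (Real.exp_pos _)] at h1
  rw [div_mul_eq_mul_div, le_div_iff₀ hA₁]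
  linarith

end IsSizePrior

/-- The sample size is large in terms of the constants of the prior. -/
structure IsLarge (A₁ A₂ A₄ : ℝ) (n : ℕ) : Prop where
  two_le : 2 ≤ Real.log n
  upper : 200 * (max (Real.log A₂) 0 + 1) ≤ A₄ * Real.log n
  lower : -Real.log A₁ ≤ Real.log n

lemma eventually_isLarge (A₁ A₂ : ℝ) {A₄ : ℝ} (hA₄ : 0 < A₄) :
    ∀ᶠ n : ℕ in atTop, IsLarge A₁ A₂ A₄ n := by
  have h : Tendsto (fun n : ℕ => Real.log n) atTop atTop :=
    Real.tendsto_log_atTop.comp tendsto_natCast_atTop_atTop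
  filter_upwards [h.eventually_ge_atTop 2,
    (h.const_mul_atTop hA₄).eventually_ge_atTop (200 * (max (Real.log A₂) 0 + 1)),
    h.eventually_ge_atTop (-Real.log A₁)] with n h1 h2 h3
  exact ⟨h1, h2, h3⟩

namespace IsLarge

variable (hl : IsLarge A₁ A₂ A₄ n) (hg : Function.Surjective grp) (hp : 0 < p)

include hl

lemma pos : 0 < n := by
  rcases Nat.eq_zero_or_pos n with rfl | h
  · have := hl.two_le
    norm_num at this
  · exact h

include hg hp

lemma log_le : Real.log n ≤ logTerm grp n := by
  refine le_trans ?_ (gbar_mul_log_le (grp := grp) (n := n))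
  have h1 : (1 : ℝ) ≤ gbar grp := by exact_mod_cast one_le_gbar hg hp
  have h2 := hl.two_le
  nlinarith

omit hg hp in
lemma gbar_le : (gbar grp : ℝ) ≤ logTerm grp n := by
  refine le_trans ?_ (gbar_mul_log_le (grp := grp) (n := n))
  have h1 : (0 : ℝ) ≤ gbar grp := Nat.cast_nonneg _
  have h2 := hl.two_le
  nlinarith

lemma logTerm_pos : 0 < logTerm grp n := by
  have h1 := hl.log_le hg hp
  have h2 := hl.two_le
  linarith

omit hg hp in
lemma two_pow_le_exp_logTerm : (2 : ℝ) ^ gbar grp ≤ Real.exp (logTerm grp n) :=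
  (two_pow_le_exp _).trans (Real.exp_le_exp.2 (hl.gbar_le))

/-- Since ḡ ≥ 1, log A₂ + ḡ ≤ ḡ(max (log A₂) 0 + 1) ≤ A₄ ḡ log n/200 ≤ 0.005 A₄ L; the loss from A₂
and the dimension factor is half a percent of the exponent. -/
lemma ratio_le (hA₂ : 0 < A₂) (hA₄ : 0 < A₄) :
    A₂ * Real.exp (-(A₄ * logTerm grp n)) * 2 ^ gbar grp ≤
      Real.exp (-(0.995 * A₄ * logTerm grp n)) := by
  set a := max (Real.log A₂) 0 with ha
  have ha0 : 0 ≤ a := le_max_right _ _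
  have h1 : A₂ ≤ Real.exp a := by
    rw [← Real.log_le_iff_le_exp hA₂]
    exact le_max_left _ _
  have hg1 : (1 : ℝ) ≤ gbar grp := by exact_mod_cast one_le_gbar hg hp
  calc _ ≤ Real.exp a * Real.exp (-(A₄ * logTerm grp n)) * Real.exp (gbar grp : ℝ) := by
        gcongr
        exact two_pow_le_exp _
    _ = Real.exp (a - A₄ * logTerm grp n + gbar grp) := by
        rw [← Real.exp_add, ← Real.exp_add]; congr 1
    _ ≤ _ := by
        refine Real.exp_le_exp.2 ?_
        have h2 := hl.upper
        have h3 := mul_le_mul_of_nonneg_left (gbar_mul_log_le (grp := grp) (n := n)) hA₄.le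
        have h4 := mul_le_mul_of_nonneg_left h2 (Nat.cast_nonneg (α := ℝ) (gbar grp))
        have h5 : a ≤ gbar grp * a := le_mul_of_one_le_left ha0 hg1
        norm_num
        linarith

lemma theta_le_half : Real.exp (-(0.995 * A₄ * logTerm grp n)) ≤ 1 / 2 := by
  have hL := hl.log_le hg hp
  have h2 := hl.upper
  have h3 : 0 ≤ max (Real.log A₂) 0 := le_max_right _ _
  have hlog : 0 < Real.log n := by linarith [hl.two_le]
  have hA : 0 < A₄ := by
    by_contra! hA
    nlinarith
  have h4 := mul_le_mul_of_nonneg_left hL hA.le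
  have h5 := Real.add_one_le_exp (0.995 * A₄ * logTerm grp n)
  rw [Real.exp_neg, one_div]
  refine inv_anti₀ zero_lt_two ?_
  norm_num at h5 ⊢
  linarith

/-- With p ≤ e^L and 2^{ḡ} ≤ e^{ḡ} the exponent is ḡ - L/2 ≤ ḡ(1 - log n/2), largest at ḡ = 1
because log n ≥ 2. The 3 bounds e. -/
lemma tail_not_scoreEvent :
    (p : ℝ) * (2 ^ gbar grp * Real.exp (-(3 / 2) * logTerm grp n)) ≤
      3 * Real.exp (-(Real.log n / 2)) := by
  have hG1 : (1 : ℝ) ≤ gbar grp := by exact_mod_cast one_le_gbar hg hp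
  calc _ ≤ Real.exp (logTerm grp n) * (Real.exp (gbar grp : ℝ) *
        Real.exp (-(3 / 2) * logTerm grp n)) := by
        gcongr
        · exact natCast_le_exp_logTerm hp
        · exact two_pow_le_exp _
    _ = Real.exp (gbar grp - logTerm grp n / 2) := by
        rw [← Real.exp_add, ← Real.exp_add]; congr 1; ring
    _ ≤ Real.exp (1 - Real.log n / 2) := by
        refine Real.exp_le_exp.2 ?_
        have h1 := gbar_mul_log_le (grp := grp) (n := n)
        have h2 := hl.two_le
        nlinarith
    _ = Real.exp 1 * Real.exp (-(Real.log n / 2)) := by rw [← Real.exp_add]; congr 1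
    _ ≤ _ := by
        gcongr
        linarith [Real.exp_one_lt_d9]

end IsLarge

end Prior

/-! ### Posterior bounds -/

section Posterior

variable {n q d p : ℕ} {grp : Fin d → Fin p} {X : Matrix (Fin n × Fin q) (Fin d) ℝ}
  {β₀ : Fin d → ℝ} {π : ℕ → ℝ} {A₁ A₂ A₃ A₄ : ℝ}

lemma choose_le_exp (hp : 0 < p) (s : ℕ) : (p.choose s : ℝ) ≤ Real.exp (s * logTerm grp n) := by
  rw [Real.exp_nat_mul]
  have h1 : (p.choose s : ℝ) ≤ (p : ℝ) ^ s := by exact_mod_cast Nat.choose_le_pow p s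
  exact h1.trans (pow_le_pow_left₀ (Nat.cast_nonneg _) (natCast_le_exp_logTerm hp) s)

/-- Here λ² = 64K²L turns each term into g_j(g_j + 1)/(128L), and g_j ≤ ḡ ≤ L with L ≥ 1. -/
lemma sum_quadratic_le (hl : IsLarge A₁ A₂ A₄ n) (hg : Function.Surjective grp) (hp : 0 < p)
    (hX : X ≠ 0) (S : Finset (Fin p)) :
    ∑ j ∈ S, starNorm grp X ^ 2 / 2 *
      ((gsize grp j : ℝ) * (gsize grp j + 1) / lam grp X ^ 2) ≤ S.card * logTerm grp n := by
  have hL := hl.logTerm_pos hg hp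
  have hK := starNorm_pos grp hX
  rw [← nsmul_eq_mul]
  refine Finset.sum_le_card_nsmul _ _ _ fun j _ => ?_
  have hlam : lam grp X ^ 2 = 64 * starNorm grp X ^ 2 * logTerm grp n := by
    rw [lam, mul_pow, mul_pow, Real.sq_sqrt hL.le]; norm_num
  have hgL : (gsize grp j : ℝ) ≤ logTerm grp n :=
    le_trans (by exact_mod_cast Finset.le_sup (f := gsize grp) (Finset.mem_univ j))
      (hl.gbar_le)
  have h1 : (1 : ℝ) ≤ logTerm grp n := by linarith [hl.log_le hg hp, hl.two_le]
  have h0 : (0 : ℝ) ≤ gsize grp j := Nat.cast_nonneg _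
  rw [hlam, show starNorm grp X ^ 2 / 2 * ((gsize grp j : ℝ) * (gsize grp j + 1) /
    (64 * starNorm grp X ^ 2 * logTerm grp n)) =
      (gsize grp j : ℝ) * (gsize grp j + 1) / (128 * logTerm grp n) by field_simp; ring,
    div_le_iff₀ (by positivity)]
  nlinarith

/-- If the likelihood is dominated on `B` and all members of `B` have at least `k` active groups,
the posterior mass of `B` is governed by the prior mass of the models of size at least `k`. -/
lemma posterior_le_of_exponent_le (hl : IsLarge A₁ A₂ A₄ n) (hg : Function.Surjective grp)
    (hX : X ≠ 0) (hp : 0 < p) (hπ : IsSizePrior n grp A₁ A₂ A₃ A₄ π) (hA₁ : 0 < A₁)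
    (hA₂ : 0 < A₂) (hA₄ : 0 < A₄) {z : Fin n → Fin (q + 1)} {B : Set (Fin d → ℝ)}
    (hB : MeasurableSet B) {k s₁ : ℕ} (hk : ∀ β ∈ B, k ≤ suppCard grp β) (hs₁ : s₁ ≤ k)
    (hs₁p : s₁ ≤ p) {e ε : ℝ} (h : ∀ β ∈ B, score X β₀ z (β - β₀) - excess X β₀ (β - β₀) ≤
      e - lam grp X * l21 grp β₀ +
        (lam grp X * l21 grp β - lam grp X / 2 * l21 grp (β - β₀)))
    (hε : Real.exp e * (2 * Real.exp (-(0.995 * A₄ * logTerm grp n)) ^ (k - s₁) *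
        (π s₁ * 2 ^ (s₁ * gbar grp))) * Real.exp (2 * s0 grp β₀ * logTerm grp n) ≤
      ε * π (suppCard grp β₀)) :
    posterior grp X π z B ≤ ENNReal.ofReal ε := by
  have hn := hl.pos
  have hL := hl.logTerm_pos hg hp
  have hlam0 : 0 < lam grp X := by
    rw [lam]
    exact mul_pos (mul_pos (by norm_num) (starNorm_pos grp hX)) (Real.sqrt_pos.2 hL)
  have hf := density_pos X β₀ z
  set θ := Real.exp (-(0.995 * A₄ * logTerm grp n)) with hθ
  set Q := ∑ j ∈ supp grp β₀, starNorm grp X ^ 2 / 2 *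
    ((gsize grp j : ℝ) * (gsize grp j + 1) / lam grp X ^ 2) with hQ
  have hcard : suppCard grp β₀ ≤ p := suppCard_le grp β₀
  have hπ0 : 0 < π (suppCard grp β₀) := hπ.pos hA₁ hp hcard
  have hπ1 : 0 < π s₁ := hπ.pos hA₁ hp hs₁p
  have hε0 : 0 ≤ ε := by
    refine nonneg_of_mul_nonneg_left (le_trans ?_ hε) hπ0
    positivity
  have hnum := lintegral_density_le X β₀ π hg hlam0 hπ.nonneg z hB hk
    (E := density X β₀ z * Real.exp (e - lam grp X * l21 grp β₀)) (by positivity)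
    fun β hβ => by
      rw [density_eq_mul_exp X β₀ β z, mul_assoc, ← Real.exp_add]
      exact mul_le_mul_of_nonneg_left (Real.exp_le_exp.2 (h β hβ)) hf.le
  have hden := le_lintegral_density X β₀ π hg hlam0 hπ.nonneg z
  rw [← hQ] at hden
  have htail : ∑ s ∈ Finset.range (p + 1), (if k ≤ s then π s * 2 ^ (s * gbar grp) else 0) ≤
      2 * θ ^ (k - s₁) * (π s₁ * 2 ^ (s₁ * gbar grp)) := by
    refine sum_tail_le (a := fun s => π s * 2 ^ (s * gbar grp)) (Real.exp_pos _).le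
      (hl.theta_le_half hg hp) (by positivity) (fun s _ hs => ?_) hs₁
    have h1 := hπ.succ_le hA₁ hn hp hs
    have h2 := hl.ratio_le hg hp hA₂ hA₄
    have h3 := (hπ.pos hA₁ hp hs.le).le
    calc π (s + 1) * 2 ^ ((s + 1) * gbar grp)
        ≤ (A₂ * Real.exp (-(A₄ * logTerm grp n)) * π s) * 2 ^ ((s + 1) * gbar grp) := by gcongr
      _ = (A₂ * Real.exp (-(A₄ * logTerm grp n)) * 2 ^ gbar grp) *
          (π s * 2 ^ (s * gbar grp)) := by rw [add_mul, one_mul, pow_add]; ring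
      _ ≤ _ := by gcongr
  refine posterior_le X π (hnum.trans ?_)
  refine le_trans ?_ (mul_le_mul' le_rfl hden)
  rw [← ENNReal.ofReal_mul hε0]
  refine ENNReal.ofReal_le_ofReal ?_
  have hch : (0 : ℝ) < p.choose (suppCard grp β₀) := by exact_mod_cast Nat.choose_pos hcard
  -- The factor e^{2s₀L} in hε consists of one e^{s₀L} for the quadratic loss Q and one for the
  -- binomial coefficient.
  have hQle : Real.exp (-(s0 grp β₀ * logTerm grp n)) ≤ Real.exp (-Q) :=
    Real.exp_le_exp.2 (neg_le_neg (sum_quadratic_le hl hg hp hX (supp grp β₀)))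
  have hchle : (p.choose (suppCard grp β₀) : ℝ) ≤ Real.exp (s0 grp β₀ * logTerm grp n) :=
    choose_le_exp hp _
  have hsplit : Real.exp (2 * s0 grp β₀ * logTerm grp n) =
      Real.exp (s0 grp β₀ * logTerm grp n) / Real.exp (-(s0 grp β₀ * logTerm grp n)) := by
    rw [← Real.exp_sub]; congr 1; ring
  set T := 2 * θ ^ (k - s₁) * (π s₁ * 2 ^ (s₁ * gbar grp)) with hT
  have hT0 : 0 ≤ T := by positivity
  set w := density X β₀ z * Real.exp (-lam grp X * l21 grp β₀) with hw
  have hw0 : 0 < w := by positivity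
  have hmain : Real.exp e * T ≤
      ε * (π (suppCard grp β₀) / (p.choose (suppCard grp β₀) : ℝ) * Real.exp (-Q)) := by
    calc Real.exp e * T = Real.exp e * T * Real.exp (2 * s0 grp β₀ * logTerm grp n) /
          Real.exp (2 * s0 grp β₀ * logTerm grp n) := by
          rw [mul_div_cancel_right₀ _ (Real.exp_pos _).ne']
      _ ≤ ε * π (suppCard grp β₀) / Real.exp (2 * s0 grp β₀ * logTerm grp n) := by gcongr
      _ = ε * (π (suppCard grp β₀) / Real.exp (s0 grp β₀ * logTerm grp n) *
          Real.exp (-(s0 grp β₀ * logTerm grp n))) := by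
          rw [hsplit]; field_simp
      _ ≤ _ := by gcongr
  calc _ ≤ density X β₀ z * Real.exp (e - lam grp X * l21 grp β₀) * T := by gcongr
    _ = w * (Real.exp e * T) := by
        rw [hw, show e - lam grp X * l21 grp β₀ = -lam grp X * l21 grp β₀ + e by ring,
          Real.exp_add]
        ring
    _ ≤ w * (ε * (π (suppCard grp β₀) / (p.choose (suppCard grp β₀) : ℝ) * Real.exp (-Q))) := by
        gcongr
    _ = _ := by
        rw [hw, sub_eq_add_neg (-lam grp X * l21 grp β₀), Real.exp_add]
        ring

/-- The posterior does not overshoot the true model size. -/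
lemma posterior_dimension_le (hl : IsLarge A₁ A₂ A₄ n) (hg : Function.Surjective grp)
    (hX : X ≠ 0) (hp : 0 < p) (hπ : IsSizePrior n grp A₁ A₂ A₃ A₄ π) (hA₁ : 0 < A₁)
    (hA₂ : 0 < A₂) (hA₄ : 0 < A₄) {M : ℝ} (hM : 0 < M) (hM1 : M ≤ 1 / 40000)
    (hβ : β₀ ∈ truthClass grp X A₄ M) {z : Fin n → Fin (q + 1)} (hz : scoreEvent X β₀ grp z) :
    posterior grp X π z {β | xi0 grp X β₀ A₄ < suppCard grp β} ≤
      ENNReal.ofReal (2 * Real.exp (-(Real.log n / 2)) + 2 * Real.exp (-(0.995 * A₄ * Real.log n))) := by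
  have hL := hl.logTerm_pos hg hp
  have hξ := xi0_nonneg grp (X := X) β₀ hA₄
  have hcard : suppCard grp β₀ ≤ p := suppCard_le grp β₀
  have hs0ξ : s0 grp β₀ ≤ xi0 grp X β₀ A₄ := by
    have := s0_nonneg grp β₀
    unfold xi0
    have : 0 ≤ A₄⁻¹ * (4 + 100 / phi0 grp X β₀ ^ 2) * s0 grp β₀ := by positivity
    linarith
  have hkfl : suppCard grp β₀ ≤ ⌊xi0 grp X β₀ A₄⌋₊ := Nat.le_floor hs0ξ
  have hπ0 := hπ.pos hA₁ hp hcard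
  -- A size above ξ₀ is at least ⌊ξ₀⌋ + 1. Starting the tail at s₁ = s₀ makes π(s₀) cancel.
  refine posterior_le_of_exponent_le hl hg hX hp hπ hA₁ hA₂ hA₄
    (k := ⌊xi0 grp X β₀ A₄⌋₊ + 1) (s₁ := suppCard grp β₀)
    (e := 99 * s0 grp β₀ * logTerm grp n / phi0 grp X β₀ ^ 2)
    (measurableSet_lt measurable_const
      ((measurable_from_top (f := fun s : ℕ => (s : ℝ))).comp measurable_suppCard))
    (fun β hβ => Nat.succ_le_of_lt ((Nat.floor_lt hξ).2 hβ)) (by omega) hcard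
    (fun β _ => exponent_le grp β₀ hX hA₄ hM hM1 hL hβ hz β) ?_
  set m := ⌊xi0 grp X β₀ A₄⌋₊ + 1 - suppCard grp β₀ with hm
  rw [show ∀ a b c f : ℝ, a * (2 * b * (π (suppCard grp β₀) * c)) * f =
    2 * (a * b * c * f) * π (suppCard grp β₀) by intros; ring]
  refine mul_le_mul_of_nonneg_right ?_ hπ0.le
  have h2 : (2 : ℝ) ^ (suppCard grp β₀ * gbar grp) ≤ Real.exp (s0 grp β₀ * logTerm grp n) := by
    rw [s0, Real.exp_nat_mul, mul_comm, pow_mul]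
    exact pow_le_pow_left₀ (by positivity) (hl.two_pow_le_exp_logTerm) _
  have hlogL := hl.log_le hg hp
  -- For β₀ = 0 there is exactly one surplus group, and its prior cost gives the second term of the
  -- bound.
  rcases s0_eq_zero_or_one_le grp β₀ with hs | hs
  · have hs' : suppCard grp β₀ = 0 := by
      unfold s0 at hs
      exact_mod_cast hs
    have hm1 : m = 1 := by
      have : xi0 grp X β₀ A₄ = 0 := by simp [xi0, hs]
      rw [hm, this, hs', Nat.floor_zero]
    rw [hm1, hs, hs']
    have h3 : Real.exp (-(0.995 * A₄ * logTerm grp n)) ≤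
        Real.exp (-(0.995 * A₄ * Real.log n)) := Real.exp_le_exp.2 (by gcongr)
    have h4 := Real.exp_pos (-(Real.log n / 2))
    simp only [mul_zero, zero_mul, zero_div, Real.exp_zero, pow_one, pow_zero, one_mul, mul_one]
    linarith
  · have hφ := (compat_pos_of_mem_truthClass grp β₀ hX hL hβ hs).1
    have hmreal : A₄⁻¹ * (4 + 100 / phi0 grp X β₀ ^ 2) * s0 grp β₀ ≤ m := by
      have h3 : (m : ℝ) = (⌊xi0 grp X β₀ A₄⌋₊ : ℝ) + 1 - s0 grp β₀ := by
        rw [hm, Nat.cast_sub (by omega)]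
        push_cast
        rfl
      have h4 := (Nat.lt_floor_add_one (xi0 grp X β₀ A₄)).le
      rw [h3]
      unfold xi0 at h4 ⊢
      linarith
    have h5 : Real.exp (-(0.995 * A₄ * logTerm grp n)) ^ m ≤
        Real.exp (-(0.995 * (4 + 100 / phi0 grp X β₀ ^ 2) * s0 grp β₀ * logTerm grp n)) := by
      rw [← Real.exp_nat_mul]
      refine Real.exp_le_exp.2 ?_
      have := mul_le_mul_of_nonneg_right hmreal
        (show 0 ≤ 0.995 * A₄ * logTerm grp n by positivity)
      have h6 : A₄⁻¹ * (4 + 100 / phi0 grp X β₀ ^ 2) * s0 grp β₀ *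
          (0.995 * A₄ * logTerm grp n) =
          0.995 * (4 + 100 / phi0 grp X β₀ ^ 2) * s0 grp β₀ * logTerm grp n := by
        field_simp
      rw [h6] at this
      linarith
    have h7 := Real.exp_pos (-(0.995 * A₄ * Real.log n))
    have h8 : Real.exp (99 * s0 grp β₀ * logTerm grp n / phi0 grp X β₀ ^ 2) *
        Real.exp (-(0.995 * A₄ * logTerm grp n)) ^ m * 2 ^ (suppCard grp β₀ * gbar grp) *
        Real.exp (2 * s0 grp β₀ * logTerm grp n) ≤ Real.exp (-(Real.log n / 2)) := by
      calc _ ≤ Real.exp (99 * s0 grp β₀ * logTerm grp n / phi0 grp X β₀ ^ 2) *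
            Real.exp (-(0.995 * (4 + 100 / phi0 grp X β₀ ^ 2) * s0 grp β₀ * logTerm grp n)) *
            Real.exp (s0 grp β₀ * logTerm grp n) *
            Real.exp (2 * s0 grp β₀ * logTerm grp n) := by gcongr
        _ ≤ _ := by
            rw [← Real.exp_add, ← Real.exp_add, ← Real.exp_add]
            refine Real.exp_le_exp.2 ?_
            -- Balance: the coefficient of t/φ² is 99 - 99.5 < 0, that of t is 1 + 2 - 3.98 = -0.98,
            -- and t ≥ L ≥ log n.
            set t := s0 grp β₀ * logTerm grp n with ht
            have htL : logTerm grp n ≤ t := le_mul_of_one_le_left hL.le hs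
            have ht0 : 0 ≤ t / phi0 grp X β₀ ^ 2 :=
              div_nonneg (by linarith) (sq_nonneg _)
            have hl1 := hl.two_le
            have e1 : 99 * s0 grp β₀ * logTerm grp n / phi0 grp X β₀ ^ 2 =
              99 * (t / phi0 grp X β₀ ^ 2) := by rw [ht]; ring
            have e2 : 0.995 * (4 + 100 / phi0 grp X β₀ ^ 2) * s0 grp β₀ * logTerm grp n =
              3.98 * t + 99.5 * (t / phi0 grp X β₀ ^ 2) := by rw [ht]; ring
            have e3 : 2 * s0 grp β₀ * logTerm grp n = 2 * t := by rw [ht]; ring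
            rw [e1, e2, e3]
            norm_num
            linarith
    linarith

end Posterior

/-! ### Contraction in the three norms -/

section Contraction

variable {n q d p : ℕ} {grp : Fin d → Fin p} {X : Matrix (Fin n × Fin q) (Fin d) ℝ}
  {β₀ : Fin d → ℝ} {π : ℕ → ℝ} {A₁ A₂ A₃ A₄ : ℝ}

/-- The sparse parameters that are far from the truth in prediction norm have small posterior
mass. -/
lemma posterior_far_le (hl : IsLarge A₁ A₂ A₄ n) (hg : Function.Surjective grp)
    (hX : X ≠ 0) (hp : 0 < p) (hπ : IsSizePrior n grp A₁ A₂ A₃ A₄ π) (hA₁ : 0 < A₁)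
    (hA₂ : 0 < A₂) (hA₃ : 0 < A₃) (hA₄ : 0 < A₄) {M : ℝ}
    (hM : M * dimConst A₄ = 1 / 20000) (hβ : β₀ ∈ truthClass grp X A₄ M)
    (hs : 1 ≤ s0 grp β₀) {z : Fin n → Fin (q + 1)} (hz : scoreEvent X β₀ grp z) :
    posterior grp X π z {β | (suppCard grp β : ℝ) ≤ xi0 grp X β₀ A₄ ∧
      (100 + A₃) * √(dimConst A₄) * √(s0 grp β₀ * logTerm grp n) /
        (psi1 grp X β₀ (xi0 grp X β₀ A₄ + s0 grp β₀) * phi0 grp X β₀) <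
          predNorm X β₀ (β - β₀)} ≤
      ENNReal.ofReal (2 * Real.exp (-(Real.log n / 2))) := by
  have hL := hl.logTerm_pos hg hp
  have hlogL := hl.log_le hg hp
  have hcard := suppCard_le grp β₀
  have hπ0 := hπ.pos hA₁ hp hcard
  have hm1 : Measurable fun β : Fin d → ℝ => (suppCard grp β : ℝ) :=
    (measurable_from_top (f := fun s : ℕ => (s : ℝ))).comp measurable_suppCard
  have hm2 : Measurable fun β : Fin d → ℝ => predNorm X β₀ (β - β₀) :=
    ((continuous_predNorm X β₀).comp (continuous_sub_right β₀)).measurable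
  -- No lower bound on the size is available here, so the prior tail is summed from size 0.
  refine posterior_le_of_exponent_le hl hg hX hp hπ hA₁ hA₂ hA₄ (k := 0) (s₁ := 0)
    (e := -((A₃ + 4) * (s0 grp β₀ * logTerm grp n)))
    ((measurableSet_le hm1 measurable_const).inter (measurableSet_lt measurable_const hm2))
    (fun _ _ => Nat.zero_le _) le_rfl (Nat.zero_le _)
    (fun β hb => exponent_le_of_far grp β₀ hX hA₃ hA₄ hM hL hβ hs hz hb.1 hb.2) ?_
  set t := s0 grp β₀ * logTerm grp n with ht
  have htL : logTerm grp n ≤ t := le_mul_of_one_le_left hL.le hs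
  have hA₁L : 1 / A₁ ≤ Real.exp (logTerm grp n) := by
    rw [← Real.log_le_iff_le_exp (by positivity), one_div, Real.log_inv]
    exact hl.lower.trans hlogL
  -- Going from size 0 to s₀ costs at most e^{A₃L}/A₁ ≤ e^{(A₃ + 1)L} per step. The final exponent
  -- is -(A₃ + 4) + (A₃ + 1) + 2 = -1 times t.
  have hzero : π 0 ≤ Real.exp ((A₃ + 1) * t) * π (suppCard grp β₀) := by
    have h1 := zero_le_pow_mul (a := π) (E := Real.exp ((A₃ + 1) * logTerm grp n))
      (Real.exp_pos _).le (fun s hs => by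
        refine (hπ.le_succ hA₁ hl.pos hp hs).trans
          (mul_le_mul_of_nonneg_right ?_ (hπ.nonneg _ (by omega)))
        rw [add_mul, one_mul, Real.exp_add, div_eq_mul_one_div]
        gcongr) hcard
    rw [← Real.exp_nat_mul] at h1
    refine h1.trans_eq ?_
    rw [ht, s0]
    congr 2
    ring
  calc _ = 2 * (Real.exp (-((A₃ + 4) * t)) * π 0 * Real.exp (2 * t)) := by
        rw [ht, ← mul_assoc (2 : ℝ) (s0 grp β₀)]
        simp
        ring
    _ ≤ 2 * (Real.exp (-((A₃ + 4) * t)) *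
        (Real.exp ((A₃ + 1) * t) * π (suppCard grp β₀)) * Real.exp (2 * t)) := by gcongr
    _ = 2 * Real.exp (-t) * π (suppCard grp β₀) := by
        have : Real.exp (-t) = Real.exp (-((A₃ + 4) * t)) * Real.exp ((A₃ + 1) * t) *
            Real.exp (2 * t) := by
          rw [← Real.exp_add, ← Real.exp_add]; congr 1; ring
        rw [this]; ring
    _ ≤ _ := by
        gcongr
        linarith [hl.two_le]

/-- The error bound, uniform over the models and the true parameters. -/
def errorBound (A₄ : ℝ) (n : ℕ) : ℝ :=
  10 * Real.exp (-(Real.log n / 2)) + 2 * Real.exp (-(0.995 * A₄ * Real.log n))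

lemma tendsto_errorBound (hA₄ : 0 < A₄) : Tendsto (errorBound A₄) atTop (𝓝 0) := by
  have h : Tendsto (fun n : ℕ => Real.log n) atTop atTop :=
    Real.tendsto_log_atTop.comp tendsto_natCast_atTop_atTop
  have h1 : Tendsto (fun n : ℕ => Real.exp (-(Real.log n / 2))) atTop (𝓝 0) :=
    Real.tendsto_exp_neg_atTop_nhds_zero.comp (h.atTop_div_const two_pos)
  have h2 : Tendsto (fun n : ℕ => Real.exp (-(0.995 * A₄ * Real.log n))) atTop (𝓝 0) :=
    Real.tendsto_exp_neg_atTop_nhds_zero.comp (h.const_mul_atTop (by positivity))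
  have h3 := (h1.const_mul 10).add (h2.const_mul 2)
  rw [mul_zero, mul_zero, add_zero] at h3
  exact h3

/-- All three claims reduce to this: it suffices that B avoids every β that is both sparse and close
in prediction norm. Closeness is supplied only for s₀ ≥ 1, since for β₀ = 0 sparsity already forces
β = β₀. The score event is paid for twice, once for each posterior bound. -/
lemma expPosterior_le_errorBound (hl : IsLarge A₁ A₂ A₄ n) (hg : Function.Surjective grp)
    (hX : X ≠ 0) (hp : 0 < p) (hπ : IsSizePrior n grp A₁ A₂ A₃ A₄ π) (hA₁ : 0 < A₁)
    (hA₂ : 0 < A₂) (hA₃ : 0 < A₃) (hA₄ : 0 < A₄) {M : ℝ} (hM0 : 0 < M) (hM1 : M ≤ 1 / 40000)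
    (hM : M * dimConst A₄ = 1 / 20000) (hβ : β₀ ∈ truthClass grp X A₄ M)
    {B : Set (Fin d → ℝ)} (hB : ∀ β, (suppCard grp β : ℝ) ≤ xi0 grp X β₀ A₄ →
      (1 ≤ s0 grp β₀ → predNorm X β₀ (β - β₀) ≤
        (100 + A₃) * √(dimConst A₄) * √(s0 grp β₀ * logTerm grp n) /
          (psi1 grp X β₀ (xi0 grp X β₀ A₄ + s0 grp β₀) * phi0 grp X β₀)) → β ∉ B) :
    expPosterior grp X π β₀ B ≤ ENNReal.ofReal (errorBound A₄ n) := by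
  set T := 3 * Real.exp (-(Real.log n / 2)) with hT
  have hTz := (sum_density_not_scoreEvent_le X β₀ hg hX (hl.logTerm_pos hg hp).le).trans
    (hl.tail_not_scoreEvent hg hp)
  set B₁ : Set (Fin d → ℝ) := {β | xi0 grp X β₀ A₄ < suppCard grp β} with hB₁
  have h1 : expPosterior grp X π β₀ B₁ ≤ ENNReal.ofReal T + ENNReal.ofReal
      (2 * Real.exp (-(Real.log n / 2)) + 2 * Real.exp (-(0.995 * A₄ * Real.log n))) :=
    (expPosterior_le X β₀ π fun z hz =>
      posterior_dimension_le hl hg hX hp hπ hA₁ hA₂ hA₄ hM0 hM1 hβ hz).trans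
        (add_le_add (ENNReal.ofReal_le_ofReal hTz) le_rfl)
  have e1 := Real.exp_pos (-(Real.log n / 2))
  have e2 := Real.exp_pos (-(0.995 * A₄ * Real.log n))
  rcases s0_eq_zero_or_one_le grp β₀ with hs | hs
  · have hsub : B ⊆ B₁ := fun β hb => by
      by_contra h
      exact hB β (not_lt.1 h) (fun h1 => by rw [hs] at h1; norm_num at h1) hb
    refine (expPosterior_mono X β₀ π hsub).trans (h1.trans ?_)
    rw [← ENNReal.ofReal_add (by positivity) (by positivity)]
    refine ENNReal.ofReal_le_ofReal ?_
    unfold errorBound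
    linarith
  · set B₂ : Set (Fin d → ℝ) := {β | (suppCard grp β : ℝ) ≤ xi0 grp X β₀ A₄ ∧
      (100 + A₃) * √(dimConst A₄) * √(s0 grp β₀ * logTerm grp n) /
        (psi1 grp X β₀ (xi0 grp X β₀ A₄ + s0 grp β₀) * phi0 grp X β₀) <
          predNorm X β₀ (β - β₀)} with hB₂
    have h2 : expPosterior grp X π β₀ B₂ ≤ ENNReal.ofReal T + ENNReal.ofReal
        (2 * Real.exp (-(Real.log n / 2))) :=
      (expPosterior_le X β₀ π fun z hz =>
        posterior_far_le hl hg hX hp hπ hA₁ hA₂ hA₃ hA₄ hM hβ hs hz).trans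
          (add_le_add (ENNReal.ofReal_le_ofReal hTz) le_rfl)
    have hsub : B ⊆ B₁ ∪ B₂ := fun β hb => by
      by_contra h
      rw [Set.mem_union, not_or] at h
      have h3 : (suppCard grp β : ℝ) ≤ xi0 grp X β₀ A₄ := not_lt.1 h.1
      exact hB β h3 (fun _ => not_lt.1 fun h4 => h.2 ⟨h3, h4⟩) hb
    refine (expPosterior_mono X β₀ π hsub).trans ((expPosterior_union_le X β₀ π B₁ B₂).trans
      ((add_le_add h1 h2).trans ?_))
    rw [← ENNReal.ofReal_add (by positivity) (by positivity),
      ← ENNReal.ofReal_add (by positivity) (by positivity),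
      ← ENNReal.ofReal_add (by positivity) (by positivity)]
    refine ENNReal.ofReal_le_ofReal ?_
    unfold errorBound
    linarith

lemma eq_of_suppCard_le (hs : s0 grp β₀ = 0) {β : Fin d → ℝ}
    (h : (suppCard grp β : ℝ) ≤ xi0 grp X β₀ A₄) : β - β₀ = 0 := by
  have h1 : xi0 grp X β₀ A₄ = 0 := by simp [xi0, hs]
  rw [h1] at h
  have h2 : suppCard grp β = 0 := by exact_mod_cast h.antisymm (Nat.cast_nonneg _)
  have h3 : suppCard grp β₀ = 0 := by
    unfold s0 at hs
    exact_mod_cast hs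
  rw [(suppCard_eq_zero grp).1 h2, (suppCard_eq_zero grp).1 h3, sub_zero]

lemma sqrt_dimConst_le (hA₄ : 0 < A₄) : √(dimConst A₄) ≤ dimConst A₄ := by
  have h := one_le_dimConst hA₄
  exact (Real.sqrt_le_left (by linarith)).2 (by nlinarith)

lemma not_far_predNorm (hA₃ : 0 < A₃) (hA₄ : 0 < A₄) {β : Fin d → ℝ}
    (hξ : (suppCard grp β : ℝ) ≤ xi0 grp X β₀ A₄)
    (h : 1 ≤ s0 grp β₀ → predNorm X β₀ (β - β₀) ≤
        (100 + A₃) * √(dimConst A₄) * √(s0 grp β₀ * logTerm grp n) /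
          (psi1 grp X β₀ (xi0 grp X β₀ A₄ + s0 grp β₀) * phi0 grp X β₀)) :
    predNorm X β₀ (β - β₀) ≤ (100 + A₃) * dimConst A₄ * √(s0 grp β₀ * logTerm grp n) /
      (psi1 grp X β₀ (xi0 grp X β₀ A₄ + s0 grp β₀) * phi0 grp X β₀) := by
  have hψφ : 0 ≤ psi1 grp X β₀ (xi0 grp X β₀ A₄ + s0 grp β₀) * phi0 grp X β₀ :=
    mul_nonneg (psi1_nonneg grp X β₀ _) (phi_nonneg grp X β₀ _)
  rcases s0_eq_zero_or_one_le grp β₀ with hs | hs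
  · rw [eq_of_suppCard_le hs hξ, hs]
    have : predNorm X β₀ 0 = 0 := by simpa using predNorm_smul X β₀ 0 0
    simp [this]
  · refine (h hs).trans ?_
    gcongr
    exact sqrt_dimConst_le hA₄

/-- Positivity of ψ₂ is essential: were it zero, the radius would be 0 by the convention for
division. -/
lemma not_far_l2 (hX : X ≠ 0) (hA₃ : 0 < A₃) (hA₄ : 0 < A₄) (hL : 0 < logTerm grp n) {M : ℝ}
    (hβ : β₀ ∈ truthClass grp X A₄ M) {β : Fin d → ℝ}
    (hξ : (suppCard grp β : ℝ) ≤ xi0 grp X β₀ A₄)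
    (h : 1 ≤ s0 grp β₀ → predNorm X β₀ (β - β₀) ≤
        (100 + A₃) * √(dimConst A₄) * √(s0 grp β₀ * logTerm grp n) /
          (psi1 grp X β₀ (xi0 grp X β₀ A₄ + s0 grp β₀) * phi0 grp X β₀)) :
    l2 (β - β₀) ≤ (100 + A₃) * dimConst A₄ * √(s0 grp β₀ * logTerm grp n) /
      (psi1 grp X β₀ (xi0 grp X β₀ A₄ + s0 grp β₀) *
        psi2 grp X β₀ (xi0 grp X β₀ A₄ + s0 grp β₀) * phi0 grp X β₀ * starNorm grp X) := by
  have h1 := not_far_predNorm hA₃ hA₄ hξ h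
  rcases s0_eq_zero_or_one_le grp β₀ with hs | hs
  · rw [eq_of_suppCard_le hs hξ, hs]
    simp
  obtain ⟨hφ, hψ⟩ := compat_pos_of_mem_truthClass grp β₀ hX hL hβ hs
  have hξ0 := xi0_nonneg grp (X := X) β₀ hA₄
  have hK := starNorm_pos grp hX
  have hψ2 := psi2_pos grp β₀ hX (by unfold s0 at hs; exact_mod_cast hs)
    (show (suppCard grp β₀ : ℝ) ≤ xi0 grp X β₀ A₄ + s0 grp β₀ by unfold s0; linarith) hψ
  by_cases hb : β - β₀ = 0
  · rw [hb, l2_zero]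
    have := one_le_dimConst hA₄
    positivity
  have h2 := psi2_mul_le grp β₀ hX (t := xi0 grp X β₀ A₄ + s0 grp β₀) (β := β - β₀)
    (Nat.one_le_iff_ne_zero.2 fun h => hb ((suppCard_eq_zero grp).1 h)) (by
      have : (suppCard grp (β - β₀) : ℝ) ≤ suppCard grp β + suppCard grp β₀ := by
        exact_mod_cast suppCard_sub_le grp β₀ β
      unfold s0
      linarith)
  have h3 := h2.trans h1
  rw [le_div_iff₀ (by positivity)] at h3 ⊢
  linarith

/-- The prediction rate contributes √C √(s₀L)/(ψ₁φ) and the passage from P to N another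
√(Cs₀)/(ψ₁φ), where C = `dimConst A₄`; hence C and not √C in M₄. -/
lemma not_far_l21 (hX : X ≠ 0) (hA₄ : 0 < A₄) (hL : 0 < logTerm grp n) {M : ℝ}
    (hβ : β₀ ∈ truthClass grp X A₄ M) {β : Fin d → ℝ}
    (hξ : (suppCard grp β : ℝ) ≤ xi0 grp X β₀ A₄)
    (h : 1 ≤ s0 grp β₀ → predNorm X β₀ (β - β₀) ≤
        (100 + A₃) * √(dimConst A₄) * √(s0 grp β₀ * logTerm grp n) /
          (psi1 grp X β₀ (xi0 grp X β₀ A₄ + s0 grp β₀) * phi0 grp X β₀)) :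
    l21 grp (β - β₀) ≤ (100 + A₃) * dimConst A₄ * s0 grp β₀ * √(logTerm grp n) /
      (psi1 grp X β₀ (xi0 grp X β₀ A₄ + s0 grp β₀) ^ 2 * phi0 grp X β₀ ^ 2 *
        starNorm grp X) := by
  rcases s0_eq_zero_or_one_le grp β₀ with hs | hs
  · rw [eq_of_suppCard_le hs hξ, hs]
    simp
  obtain ⟨hφ, hψ⟩ := compat_pos_of_mem_truthClass grp β₀ hX hL hβ hs
  have hK := starNorm_pos grp hX
  have hC := one_le_dimConst hA₄
  have hs0 := s0_nonneg grp β₀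
  set ψ := psi1 grp X β₀ (xi0 grp X β₀ A₄ + s0 grp β₀)
  set φ := phi0 grp X β₀
  have hψφ : 0 < ψ * φ := mul_pos hψ hφ
  have h1 := compat_mul_l21_le grp β₀ hX hA₄ hφ hξ
  have h2 := h hs
  rw [le_div_iff₀ hψφ] at h2
  rw [le_div_iff₀ (by positivity)]
  have hsqrt : √(dimConst A₄) * √(s0 grp β₀ * logTerm grp n) * √(dimConst A₄ * s0 grp β₀) =
      dimConst A₄ * s0 grp β₀ * √(logTerm grp n) := by
    rw [Real.sqrt_mul hs0, Real.sqrt_mul (by linarith : (0 : ℝ) ≤ dimConst A₄)]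
    calc _ = (√(dimConst A₄) * √(dimConst A₄)) * (√(s0 grp β₀) * √(s0 grp β₀)) *
          √(logTerm grp n) := by ring
      _ = _ := by
        rw [Real.mul_self_sqrt (by linarith), Real.mul_self_sqrt hs0]
  calc l21 grp (β - β₀) * (ψ ^ 2 * φ ^ 2 * starNorm grp X)
      = (ψ * φ * (starNorm grp X * l21 grp (β - β₀))) * (ψ * φ) := by ring
    _ ≤ (predNorm X β₀ (β - β₀) * √(dimConst A₄ * s0 grp β₀)) * (ψ * φ) := by gcongr
    _ = (predNorm X β₀ (β - β₀) * (ψ * φ)) * √(dimConst A₄ * s0 grp β₀) := by ring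
    _ ≤ ((100 + A₃) * √(dimConst A₄) * √(s0 grp β₀ * logTerm grp n)) *
        √(dimConst A₄ * s0 grp β₀) := by gcongr
    _ = (100 + A₃) * (√(dimConst A₄) * √(s0 grp β₀ * logTerm grp n) *
        √(dimConst A₄ * s0 grp β₀)) := by ring
    _ = _ := by rw [hsqrt]; ring

lemma tendsto_iSup_of_le {d : ℕ → ℕ} {C : ∀ n, Set (Fin (d n) → ℝ)}
    {f : ∀ n, (Fin (d n) → ℝ) → ℝ≥0∞} (hA₄ : 0 < A₄)
    (h : ∀ᶠ n in atTop, ∀ β₀ ∈ C n, f n β₀ ≤ ENNReal.ofReal (errorBound A₄ n)) :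
    Tendsto (fun n => ⨆ β₀ ∈ C n, f n β₀) atTop (𝓝 0) := by
  have hlim : Tendsto (fun n => ENNReal.ofReal (errorBound A₄ n)) atTop (𝓝 0) := by
    simpa using ENNReal.tendsto_ofReal (tendsto_errorBound hA₄)
  refine tendsto_of_tendsto_of_tendsto_of_le_of_le' tendsto_const_nhds hlim
    (Eventually.of_forall fun _ => zero_le) ?_
  filter_upwards [h] with n hn
  exact iSup₂_le hn

end Contraction

end GroupLogit

end

theorem theorem2 (A₁ A₂ A₃ A₄ : ℝ) (hA₁ : 0 < A₁) (hA₂ : 0 < A₂) (hA₃ : 0 < A₃) (hA₄ : 0 < A₄) :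
    ∃ M₃ : ℝ, 0 < M₃ ∧ ∃ M₄ : ℝ, 0 < M₄ ∧
      ∀ (q p d : ℕ → ℕ) (grp : ∀ n, Fin (d n) → Fin (p n))
        (X : ∀ n, Matrix (Fin n × Fin (q n)) (Fin (d n)) ℝ) (π : ℕ → ℕ → ℝ),
        (∀ n, 1 ≤ n → Function.Surjective (grp n)) →
        (∀ n, 1 ≤ n → X n ≠ 0) →
        (∀ n, 1 ≤ n → GroupLogit.IsSizePrior n (grp n) A₁ A₂ A₃ A₄ (π n)) →
        Tendsto (fun n => ⨆ β₀ ∈ GroupLogit.truthClass (grp n) (X n) A₄ M₃,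
            GroupLogit.expPosterior (grp n) (X n) (π n) β₀
              {β | M₄ * √(GroupLogit.s0 (grp n) β₀ * GroupLogit.logTerm (grp n) n) /
                  (GroupLogit.psi1 (grp n) (X n) β₀
                      (GroupLogit.xi0 (grp n) (X n) β₀ A₄ + GroupLogit.s0 (grp n) β₀) *
                    GroupLogit.phi0 (grp n) (X n) β₀) <
                GroupLogit.predNorm (X n) β₀ (β - β₀)}) atTop (𝓝 0) ∧
        Tendsto (fun n => ⨆ β₀ ∈ GroupLogit.truthClass (grp n) (X n) A₄ M₃,
            GroupLogit.expPosterior (grp n) (X n) (π n) β₀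
              {β | M₄ * √(GroupLogit.s0 (grp n) β₀ * GroupLogit.logTerm (grp n) n) /
                  (GroupLogit.psi1 (grp n) (X n) β₀
                      (GroupLogit.xi0 (grp n) (X n) β₀ A₄ + GroupLogit.s0 (grp n) β₀) *
                    GroupLogit.psi2 (grp n) (X n) β₀
                      (GroupLogit.xi0 (grp n) (X n) β₀ A₄ + GroupLogit.s0 (grp n) β₀) *
                    GroupLogit.phi0 (grp n) (X n) β₀ * GroupLogit.starNorm (grp n) (X n)) <
                GroupLogit.l2 (β - β₀)}) atTop (𝓝 0) ∧
        Tendsto (fun n => ⨆ β₀ ∈ GroupLogit.truthClass (grp n) (X n) A₄ M₃,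
            GroupLogit.expPosterior (grp n) (X n) (π n) β₀
              {β | M₄ * GroupLogit.s0 (grp n) β₀ * √(GroupLogit.logTerm (grp n) n) /
                  (GroupLogit.psi1 (grp n) (X n) β₀
                      (GroupLogit.xi0 (grp n) (X n) β₀ A₄ + GroupLogit.s0 (grp n) β₀) ^ 2 *
                    GroupLogit.phi0 (grp n) (X n) β₀ ^ 2 * GroupLogit.starNorm (grp n) (X n)) <
                GroupLogit.l21 (grp n) (β - β₀)}) atTop (𝓝 0) := by
  have hC : 1 ≤ GroupLogit.dimConst A₄ := GroupLogit.one_le_dimConst hA₄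
  -- M₃ = 1/(20000 C) meets both demands on the class constant: M₃C = 1/20000 for the contraction
  -- step, and M₃ ≤ 1/40000 for the dimension step because C ≥ 2.
  have hM0 : 0 < 1 / (20000 * GroupLogit.dimConst A₄) := by positivity
  have hM1 : 1 / (20000 * GroupLogit.dimConst A₄) ≤ 1 / 40000 := by
    have : 2 ≤ GroupLogit.dimConst A₄ := by
      have : 0 < 104 / A₄ := by positivity
      unfold GroupLogit.dimConst
      linarith
    exact one_div_le_one_div_of_le (by norm_num) (by linarith)
  have hM : 1 / (20000 * GroupLogit.dimConst A₄) * GroupLogit.dimConst A₄ = 1 / 20000 := by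
    field_simp
  refine ⟨_, hM0, (100 + A₃) * GroupLogit.dimConst A₄, by positivity, ?_⟩
  intro q p d grp X π hg hX hπ
  -- A nonzero X has a column, and the group of that column is an element of `Fin (p n)`.
  have hp : ∀ n, 1 ≤ n → 0 < p n := fun n hn => by
    rcases Nat.eq_zero_or_pos (p n) with h | h
    · refine absurd (Matrix.ext fun r k => ?_) (hX n hn)
      exact (Fin.cast h (grp n k)).elim0
    · exact h
  refine ⟨GroupLogit.tendsto_iSup_of_le hA₄ ?_, GroupLogit.tendsto_iSup_of_le hA₄ ?_,
    GroupLogit.tendsto_iSup_of_le hA₄ ?_⟩ <;>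
  filter_upwards [GroupLogit.eventually_isLarge A₁ A₂ hA₄] with n hl β₀ hβ <;>
  refine GroupLogit.expPosterior_le_errorBound hl (hg n hl.pos) (hX n hl.pos) (hp n hl.pos)
    (hπ n hl.pos) hA₁ hA₂ hA₃ hA₄ hM0 hM1 hM hβ fun β hξ h hlt =>
      (Set.mem_ofPred.1 hlt).not_ge ?_
  · exact GroupLogit.not_far_predNorm hA₃ hA₄ hξ h
  · exact GroupLogit.not_far_l2 (hX n hl.pos) hA₃ hA₄
      (hl.logTerm_pos (hg n hl.pos) (hp n hl.pos)) hβ hξ h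
  · exact GroupLogit.not_far_l21 (hX n hl.pos) hA₄
      (hl.logTerm_pos (hg n hl.pos) (hp n hl.pos)) hβ hξ h
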